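/- **Free fields.** Let $\mathfrak a=\mathfrak a^+\oplus\mathfrak a^-$ be a complex vector space of dimension $2k$ with a non-degenerate form for which $\mathfrak a^\pm$ are isotropic, with bases $a_i^\pm$ of $\mathfrak a^\pm$ ($1\le i\le k$) such that $\langle a_i^-,a_j^+\rangle=\delta_{ij}$. The form is symmetric (fermionic case, $s=-1$) or anti-symmetric (bosonic case, $s=1$). For $r\in\frac12\mathbb Z$ let $x\mapsto x(r)$ be an isomorphism of $\mathfrak a$ onto a copy $\mathfrak a(r)$, and let $\langle x(r),x'(r')\rangle=\langle x,x'\rangle\delta_{r+r',0}$. Consider the Clifford algebra ($s=-1$) or Weyl algebra ($s=1$) generated by the $x(r)$ with relations $uu'-s\,u'u=\langle u,u'\rangle$, where $r$ runs over $\mathbb Z+\frac12$, respectively over $\mathbb Z$. Let $A(\mathfrak a)$, respectively $A(\mathfrak a)_{\rm tw}$, be the module over it induced from the one-dimensional module spanned by a vector $\mathbf v$, respectively $\mathbf v_{\rm tw}$, that is killed by all $x(r)$ with $r>0$ and by all $x(0)$ with $x\in\mathfrak a^+$. An element $g\in GL(\mathfrak a^+)$ acts on $\mathfrak a$ as $(g,g')$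 with $\langle gx,g'y\rangle=\langle x,y\rangle$ for $x\in\mathfrak a^+$, $y\in\mathfrak a^-$, and on $A(\mathfrak a)$ and $A(\mathfrak a)_{\rm tw}$ by $g\cdot x_1(r_1)\cdots x_n(r_n)\mathbf v=(gx_1)(r_1)\cdots(gx_n)(r_n)\mathbf v$. Put $\jmath=\sum_i a_i^+(-\frac12)a_i^-(-\frac12)\mathbf v$ and $\omega=\frac12\sum_i\big(a_i^+(-\frac32)a_i^-(-\frac12)-a_i^+(-\frac12)a_i^-(-\frac32)\big)\mathbf v$. On $A(\mathfrak a)_{\rm tw}$ put $$J(0)=-\tfrac{sk}2+\sum_i\sum_{n\ge0}\big(s\,a_i^-(-n)a_i^+(n)+a_i^+(-n-1)a_i^-(n+1)\big),$$ $$L(0)=-\tfrac{sk}8+\sum_i\sum_{n>0}n\big(a_i^+(-n)a_i^-(n)-s\,a_i^-(-n)a_i^+(n)\big).$$ **The module.** Let $\mathfrak e,\mathfrak a$ be fermionic of dimension $2$ and $\mathfrak b$ bosonic of dimension $4$. Let $W^{(7)}=A(\mathfrak e)\otimes A(\mathfrak a)\otimes A(\mathfrak b)$ and $W^{(7)}_{\rm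 tw}=A(\mathfrak e)_{\rm tw}\otimes A(\mathfrak a)_{\rm tw}\otimes A(\mathfrak b)_{\rm tw}$. Let $\jmath_{\mathfrak e}=\jmath\otimes\mathbf v\otimes\mathbf v$, $\jmath^{(7)}=4\,\mathbf v\otimes\jmath\otimes\mathbf v+\mathbf v\otimes\mathbf v\otimes\jmath$ and $\omega^{(7)}=\omega\otimes\mathbf v\otimes\mathbf v+\mathbf v\otimes\omega\otimes\mathbf v+\mathbf v\otimes\mathbf v\otimes\omega$. On $W^{(7)}_{\rm tw}$ let $J_{\mathfrak e}(0)=J(0)\otimes1\otimes1$, let $J(0)$ be $4\cdot1\otimes J(0)\otimes1+1\otimes1\otimes J(0)$, let $L(0)$ be the sum of the operators $L(0)$ of the three factors, and let $(-1)^F=(-I)\otimes(-I)\otimes I$. Let $G^{(7)}=SL_2(3)$ and $b_3=(-1+\sqrt{-3})/2$. Label the class of one element $t$ of order $3$ by $3A$, and the classes of $t^{-1},-t^{-1},-t$ by $3B,6A,6B$; the classes $1A,2A,4A$ are those of the elements of order $1,2,4$. Let $\varrho:G^{(7)}\to GL(\mathfrak a^+)$ and $\varrho':G^{(7)}\to GL(\mathfrak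 b^+)$ be homomorphisms with characters $\chi_2$ and $\chi_6$, which on the classes $(1A,2A,4A,3A,6A,3B,6B)$ have the values $\chi_2=(1,1,1,b_3,\overline{b_3},\overline{b_3},b_3)$ and $\chi_6=(2,-2,0,-\overline{b_3},b_3,-b_3,\overline{b_3})$. Let $g\in G^{(7)}$ act on $W^{(7)}$ and $W^{(7)}_{\rm tw}$ as $I\otimes\varrho(g)\otimes\varrho'(g)$. **The functions.** Let $q=e^{2\pi i\tau}$, $y=e^{2\pi iz}$, $\eta(\tau)=q^{1/24}\prod_{n>0}(1-q^n)$, $\theta_1(\tau,z)=-iq^{1/8}y^{1/2}\prod_{n>0}(1-y^{-1}q^{n-1})(1-yq^n)(1-q^n)$ and $\theta_2(\tau,z)=q^{1/8}y^{1/2}\prod_{n>0}(1+y^{-1}q^{n-1})(1+yq^n)(1-q^n)$, and let $$\psi^{(7)}_{1A}=2i\frac{\eta(\tau)^3\theta_1(\tau,4z)}{\theta_1(\tau,z)^2},\quad \psi^{(7)}_{2A}=-2i\frac{\eta(\tau)^3\theta_1(\tau,4z)}{\theta_2(\tau,z)^2},\quad \psi^{(7)}_{4A}=-2i\frac{\eta(\tau)\eta(2\tau)\theta_1(\tau,4z)}{\theta_2(2\tau,2z)},$$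 $$\psi^{(7)}_{3A}=\psi^{(7)}_{3B}=-i\frac{\eta(3\tau)}{\theta_1(3\tau,3z)}\Big(\theta_1(\tau,4z+\tfrac13)\theta_1(\tau,z-\tfrac13)+\theta_1(\tau,4z-\tfrac13)\theta_1(\tau,z+\tfrac13)\Big),$$ $$\psi^{(7)}_{6A}=\psi^{(7)}_{6B}=-i\frac{\eta(3\tau)}{\theta_2(3\tau,3z)}\Big(\theta_1(\tau,4z+\tfrac13)\theta_1(\tau,z+\tfrac16)-\theta_1(\tau,4z-\tfrac13)\theta_1(\tau,z-\tfrac16)\Big).$$ **Theorem.** (i) For any super vertex algebra structure on $W^{(7)}$ with vacuum $\mathbf v\otimes\mathbf v\otimes\mathbf v$ and parity $(-1)^F$ such that $Y(x(-\frac12)\mathbf v,z)=\sum_{n\in\mathbb Z}x(n+\frac12)z^{-n-1}$ for $x$ in $\mathfrak e,\mathfrak a,\mathfrak b$, and any canonically twisted module structure on $W^{(7)}_{\rm tw}$ (twisted by $(-I)\otimes(-I)\otimes(-I)$) such that $Y_{\rm tw}(x(-\frac12)\mathbf v,z)=\sum_{n\in\mathbb Z}x(n)z^{-n-\frac12}$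 for these $x$ (where the modes of $\mathfrak e$ and $\mathfrak a$ anti-commute), the operators $J_{\mathfrak e}(0)$, $J(0)$, $L(0)$ above are the coefficients of $z^{-1}$ in $Y_{\rm tw}(\jmath_{\mathfrak e},z)$, of $z^{-1}$ in $Y_{\rm tw}(\jmath^{(7)},z)$ and of $z^{-2}$ in $Y_{\rm tw}(\omega^{(7)},z)$. (ii) $W^{(7)}_{\rm tw}$ is the direct sum of the simultaneous eigenspaces of $J(0)$ and $L(0)$ for the eigenvalues $(m,n)\in\mathbb Z\times\mathbb Z_{\ge0}$; these are finite-dimensional. The group $G^{(7)}$ acts faithfully on $W^{(7)}$ and on $W^{(7)}_{\rm tw}$, and preserves the bigrading of $W^{(7)}_{\rm tw}$. (iii) For every $g\in G^{(7)}$ the operator $(g+g^{-1})J_{\mathfrak e}(0)(-1)^F$ preserves the bigrading, the series $$\widetilde\psi^{(7)}_g=-\operatorname{tr}\big((g+g^{-1})J_{\mathfrak e}(0)(-1)^Fy^{J(0)}q^{L(0)}\,\big|\,W^{(7)}_{\rm tw}\big)$$ lies in $\mathbb C[y][[y^{-1}]][[q]]$, and for all complex $\tau,z$ with $0<-\operatorname{Im}z<\operatorname{Im}\tau$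 it converges absolutely, with sum $\psi^{(7)}_g(\tau,z)$. -/

import Mathlib

open scoped TensorProduct

noncomputable section

namespace UmbralSeven

/-! ## Clifford and Weyl algebras of modes, and their induced modules -/

/-- `fermi`: symmetric form, Clifford algebra.  `bose`: anti-symmetric form, Weyl algebra. -/
inductive Stat
  | fermi
  | bose

/-- The sign `s` in the relation `x ⊗ y - s • y ⊗ x - ⟨x, y⟩`. -/
def Stat.sign : Stat → ℂ
  | .fermi => -1
  | .bose => 1

/-- `ns`: the modes are `a(n + 1/2)`, `n ∈ ℤ`.  `tw`: the modes are `a(n)`, `n ∈ ℤ`. -/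
inductive Sector
  | ns
  | tw

/-- Mode number `n` stands for `a(n + shift / 2)`. -/
def Sector.shift : Sector → ℤ
  | .ns => 1
  | .tw => 0

/-- The polarized space `𝔞 = 𝔞⁺ ⊕ 𝔞⁻` of dimension `2k`, in coordinates with respect to
a basis `a_i^±` of `𝔞^±`. -/
abbrev Pol (k : ℕ) : Type := (Fin k → ℂ) × (Fin k → ℂ)

/-- The basis vector `a_i^+`. -/
def plus {k : ℕ} (i : Fin k) : Pol k := (Pi.single i 1, 0)

/-- The basis vector `a_i^-`. -/
def minus {k : ℕ} (i : Fin k) : Pol k := (0, Pi.single i 1)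

/-- The form on `𝔞`: the subspaces `𝔞^±` are isotropic, `⟨a_i^-, a_j^+⟩ = δ_ij`, and the form is
symmetric for `fermi` and anti-symmetric for `bose`. -/
def form (s : Stat) (k : ℕ) : Pol k →ₗ[ℂ] Pol k →ₗ[ℂ] ℂ :=
  LinearMap.mk₂ ℂ (fun x y => x.2 ⬝ᵥ y.1 - s.sign * (x.1 ⬝ᵥ y.2))
    (by intro x x' y; simp [add_dotProduct]; ring)
    (by intro c x y; simp [smul_dotProduct]; ring)
    (by intro x y y'; simp [dotProduct_add]; ring)
    (by intro c x y; simp [dotProduct_smul]; ring)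

/-- The space of modes `⨁_r 𝔞(r)`. -/
abbrev Modes (k : ℕ) : Type := ℤ →₀ Pol k

/-- The extended form `⟨x(r), y(r')⟩ = ⟨x, y⟩ δ_{r + r', 0}`. -/
def modeForm (s : Stat) (ε : Sector) (k : ℕ) : Modes k →ₗ[ℂ] Modes k →ₗ[ℂ] ℂ :=
  Finsupp.lsum ℂ (fun n : ℤ =>
    (LinearMap.lcomp ℂ ℂ (Finsupp.lapply (R := ℂ) (M := Pol k) (-n - ε.shift))) ∘ₗ form s k)

/-- The relations of the Clifford algebra, respectively the Weyl algebra, of the space of modes. -/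
inductive ModeRel (s : Stat) (ε : Sector) (k : ℕ) :
    TensorAlgebra ℂ (Modes k) → TensorAlgebra ℂ (Modes k) → Prop
  | comm (x y : Modes k) : ModeRel s ε k
      (TensorAlgebra.ι ℂ x * TensorAlgebra.ι ℂ y - s.sign • (TensorAlgebra.ι ℂ y * TensorAlgebra.ι ℂ x))
      (algebraMap ℂ _ (modeForm s ε k x y))

/-- The Clifford algebra, respectively the Weyl algebra, of the space of modes. -/
def ModeAlg (s : Stat) (ε : Sector) (k : ℕ) : Type := RingQuot (ModeRel s ε k)

instance (s : Stat) (ε : Sector) (k : ℕ) : Ring (ModeAlg s ε k) :=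
  inferInstanceAs (Ring (RingQuot (ModeRel s ε k)))

instance (s : Stat) (ε : Sector) (k : ℕ) : Algebra ℂ (ModeAlg s ε k) :=
  inferInstanceAs (Algebra ℂ (RingQuot (ModeRel s ε k)))

/-- The quotient map from the tensor algebra. -/
def ModeAlg.mk (s : Stat) (ε : Sector) (k : ℕ) :
    TensorAlgebra ℂ (Modes k) →ₐ[ℂ] ModeAlg s ε k :=
  RingQuot.mkAlgHom ℂ (ModeRel s ε k)

/-- The natural map from the space of modes to the algebra. -/
def ModeAlg.ι (s : Stat) (ε : Sector) (k : ℕ) : Modes k →ₗ[ℂ] ModeAlg s ε k :=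
  (ModeAlg.mk s ε k).toLinearMap ∘ₗ TensorAlgebra.ι ℂ

/-- The left ideal generated by the positive half of the polarization of the space of modes, that is
by all `x(r)` with `r > 0`, and by `x(0)` with `x ∈ 𝔞⁺`. -/
def annih (s : Stat) (ε : Sector) (k : ℕ) : Submodule (ModeAlg s ε k) (ModeAlg s ε k) :=
  Submodule.span (ModeAlg s ε k)
    {u | ∃ (n : ℤ) (x : Pol k), (0 < 2 * n + ε.shift ∨ (2 * n + ε.shift = 0 ∧ x.2 = 0)) ∧
      u = ModeAlg.ι s ε k (Finsupp.single n x)}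

/-- The module induced from the one-dimensional module `ℂ v` of the subalgebra generated by the
positive half of the modes: the algebra modulo the left ideal generated by that half. -/
def Fock (s : Stat) (ε : Sector) (k : ℕ) : Type := ModeAlg s ε k ⧸ annih s ε k

instance (s : Stat) (ε : Sector) (k : ℕ) : AddCommGroup (Fock s ε k) :=
  inferInstanceAs (AddCommGroup (ModeAlg s ε k ⧸ annih s ε k))

instance (s : Stat) (ε : Sector) (k : ℕ) : Module (ModeAlg s ε k) (Fock s ε k) :=
  inferInstanceAs (Module (ModeAlg s ε k) (ModeAlg s ε k ⧸ annih s ε k))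

instance (s : Stat) (ε : Sector) (k : ℕ) : Module ℂ (Fock s ε k) :=
  inferInstanceAs (Module ℂ (ModeAlg s ε k ⧸ annih s ε k))

instance (s : Stat) (ε : Sector) (k : ℕ) : IsScalarTower ℂ (ModeAlg s ε k) (Fock s ε k) :=
  inferInstanceAs (IsScalarTower ℂ (ModeAlg s ε k) (ModeAlg s ε k ⧸ annih s ε k))

/-- The map `u ↦ u v`. -/
def Fock.mk (s : Stat) (ε : Sector) (k : ℕ) : ModeAlg s ε k →ₗ[ModeAlg s ε k] Fock s ε k :=
  (annih s ε k).mkQ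

/-- The vacuum `v` (respectively `v_tw`). -/
def vac (s : Stat) (ε : Sector) (k : ℕ) : Fock s ε k := Fock.mk s ε k 1

/-- The action of the mode with number `n`, that is of `x(n + shift / 2)`. -/
def mode (s : Stat) (ε : Sector) {k : ℕ} (n : ℤ) (x : Pol k) : Module.End ℂ (Fock s ε k) :=
  Algebra.lsmul ℂ ℂ (Fock s ε k) (ModeAlg.ι s ε k (Finsupp.single n x))

/-! ### Local finiteness of the modes -/

theorem ι_comm (s : Stat) (ε : Sector) {k : ℕ} (x y : Modes k) :
    ModeAlg.ι s ε k x * ModeAlg.ι s ε k y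
      = s.sign • (ModeAlg.ι s ε k y * ModeAlg.ι s ε k x)
        + algebraMap ℂ _ (modeForm s ε k x y) := by
  have h := RingQuot.mkAlgHom_rel ℂ (ModeRel.comm (s := s) (ε := ε) x y)
  have h' : ModeAlg.mk s ε k _ = ModeAlg.mk s ε k _ := h
  rw [map_sub, map_mul, map_smul, map_mul, AlgHom.commutes, sub_eq_iff_eq_add'] at h'
  exact h'

theorem modeForm_single (s : Stat) (ε : Sector) {k : ℕ} (n : ℤ) (x : Pol k) (y : Modes k) :
    modeForm s ε k (Finsupp.single n x) y = form s k x (y (-n - ε.shift)) := by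
  simp [modeForm]

theorem mode_finite (s : Stat) (ε : Sector) {k : ℕ} (w : Fock s ε k) :
    ∃ N : ℕ, ∀ n : ℕ, N ≤ n → ∀ x : Pol k, mode s ε (n : ℤ) x w = 0 := by
  obtain ⟨u, rfl⟩ := Submodule.mkQ_surjective (annih s ε k) w
  obtain ⟨t, rfl⟩ := RingQuot.mkAlgHom_surjective ℂ (ModeRel s ε k) u
  change ∃ N : ℕ, ∀ n : ℕ, N ≤ n → ∀ x : Pol k,
    mode s ε (n : ℤ) x (Fock.mk s ε k (ModeAlg.mk s ε k t)) = 0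
  have key : ∀ (n : ℤ) (x : Pol k) (u : ModeAlg s ε k), mode s ε n x (Fock.mk s ε k u)
      = Fock.mk s ε k (ModeAlg.ι s ε k (Finsupp.single n x) * u) := fun n x u => by
    rw [← smul_eq_mul, map_smul]; rfl
  -- the elements with the claimed property are a subspace, stable under left multiplication
  have hvac : ∀ n : ℕ, 1 ≤ n → ∀ x : Pol k,
      mode s ε (n : ℤ) x (Fock.mk s ε k 1) = 0 := by
    intro n hn x
    rw [key, mul_one]
    refine (Submodule.Quotient.mk_eq_zero _).2 (Submodule.subset_span ⟨n, x, Or.inl ?_, rfl⟩)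
    have : 0 ≤ ε.shift := by cases ε <;> simp [Sector.shift]
    omega
  have hmul : ∀ (y : Modes k) (u : ModeAlg s ε k),
      (∃ N : ℕ, ∀ n : ℕ, N ≤ n → ∀ x : Pol k, mode s ε (n : ℤ) x (Fock.mk s ε k u) = 0) →
      ∃ N : ℕ, ∀ n : ℕ, N ≤ n → ∀ x : Pol k,
        mode s ε (n : ℤ) x (Fock.mk s ε k (ModeAlg.ι s ε k y * u)) = 0 := by
    rintro y u ⟨N, hN⟩
    obtain ⟨M, hM⟩ : ∃ M : ℕ, ∀ m ∈ y.support, -(M : ℤ) < m := by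
      refine ⟨y.support.sup Int.natAbs + 1, fun m hm => ?_⟩
      have := Finset.le_sup (f := Int.natAbs) hm
      omega
    refine ⟨max N M, fun n hn x => ?_⟩
    have h0 : y (-(n : ℤ) - ε.shift) = 0 := by
      by_contra hne
      have h1 := hM _ (Finsupp.mem_support_iff.2 hne)
      have : 0 ≤ ε.shift := by cases ε <;> simp [Sector.shift]
      omega
    have h2 := hN n (le_trans (le_max_left _ _) hn) x
    rw [key] at h2
    rw [key, ← mul_assoc, ι_comm, modeForm_single, h0]
    simp only [map_zero, add_zero, smul_mul_assoc, mul_assoc]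
    rw [← smul_eq_mul (a := ModeAlg.ι s ε k y), ← algebraMap_smul (ModeAlg s ε k) s.sign, map_smul,
      map_smul, h2, smul_zero, smul_zero]
  have hadd : ∀ u v : ModeAlg s ε k,
      (∃ N : ℕ, ∀ n : ℕ, N ≤ n → ∀ x : Pol k, mode s ε (n : ℤ) x (Fock.mk s ε k u) = 0) →
      (∃ N : ℕ, ∀ n : ℕ, N ≤ n → ∀ x : Pol k, mode s ε (n : ℤ) x (Fock.mk s ε k v) = 0) →
      ∃ N : ℕ, ∀ n : ℕ, N ≤ n → ∀ x : Pol k, mode s ε (n : ℤ) x (Fock.mk s ε k (u + v)) = 0 := by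
    rintro u v ⟨N, hN⟩ ⟨M, hM⟩
    refine ⟨max N M, fun n hn x => ?_⟩
    rw [map_add, map_add, hN n (le_trans (le_max_left _ _) hn),
      hM n (le_trans (le_max_right _ _) hn), add_zero]
  suffices H : ∀ v : ModeAlg s ε k,
      (∃ N : ℕ, ∀ n : ℕ, N ≤ n → ∀ x : Pol k, mode s ε (n : ℤ) x (Fock.mk s ε k v) = 0) →
      ∃ N : ℕ, ∀ n : ℕ, N ≤ n → ∀ x : Pol k,
        mode s ε (n : ℤ) x (Fock.mk s ε k (ModeAlg.mk s ε k t * v)) = 0 by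
    simpa using H 1 ⟨1, hvac⟩
  induction t using TensorAlgebra.induction with
  | algebraMap r =>
    rintro v ⟨N, hN⟩
    refine ⟨N, fun n hn x => ?_⟩
    rw [AlgHom.commutes, ← smul_eq_mul, map_smul, algebraMap_smul, map_smul, hN n hn, smul_zero]
  | ι y => exact fun v hv => hmul y v hv
  | mul a b ha hb =>
    intro v hv
    rw [map_mul (ModeAlg.mk s ε k), mul_assoc]
    exact ha _ (hb v hv)
  | add a b ha hb =>
    intro v hv
    rw [map_add, add_mul]
    exact hadd _ _ (ha v hv) (hb v hv)

/-- The sum of a sequence of operators that is finite on every vector. -/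
def locSum {V : Type*} [AddCommGroup V] [Module ℂ V] (f : ℕ → Module.End ℂ V)
    (hf : ∀ w, ∃ N : ℕ, ∀ n, N ≤ n → f n w = 0) : Module.End ℂ V :=
  have hfin : ∀ w, (Function.support fun n => f n w).Finite := fun w => by
    obtain ⟨N, hN⟩ := hf w
    refine (Set.finite_lt_nat N).subset fun n hn => ?_
    by_contra h
    exact hn (hN n (not_lt.1 h))
  { toFun := fun w => ∑ᶠ n, f n w
    map_add' := fun v w => by
      simp only [map_add]
      exact finsum_add_distrib (hfin v) (hfin w)
    map_smul' := fun c w => by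
      simp only [map_smul, RingHom.id_apply]
      exact (smul_finsum' c (hfin w)).symm }

/-! ### The zero modes on the twisted modules -/

/-- The operator `J(0)` on the twisted module:
`-s k / 2 + ∑_i ∑_{n ≥ 0} (s a_i^-(-n) a_i^+(n) + a_i^+(-n-1) a_i^-(n+1))`. -/
def J0 (s : Stat) (k : ℕ) : Module.End ℂ (Fock s .tw k) :=
  algebraMap ℂ _ (-s.sign * k / 2) + ∑ i : Fin k, locSum
    (fun n : ℕ => s.sign • (mode s .tw (-(n : ℤ)) (minus i) * mode s .tw (n : ℤ) (plus i))
      + mode s .tw (-((n + 1 : ℕ) : ℤ)) (plus i) * mode s .tw ((n + 1 : ℕ) : ℤ) (minus i))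
    (fun w => by
      obtain ⟨N, hN⟩ := mode_finite s .tw w
      refine ⟨N, fun n hn => ?_⟩
      rw [LinearMap.add_apply, LinearMap.smul_apply, Module.End.mul_apply, Module.End.mul_apply,
        hN n hn, hN (n + 1) (by omega)]
      simp)

/-- The operator `L(0)` on the twisted module:
`-s k / 8 + ∑_i ∑_{n > 0} n (a_i^+(-n) a_i^-(n) - s a_i^-(-n) a_i^+(n))`. -/
def L0 (s : Stat) (k : ℕ) : Module.End ℂ (Fock s .tw k) :=
  algebraMap ℂ _ (-s.sign * k / 8) + ∑ i : Fin k, locSum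
    (fun n : ℕ => (n : ℂ) • (mode s .tw (-(n : ℤ)) (plus i) * mode s .tw (n : ℤ) (minus i)
      - s.sign • (mode s .tw (-(n : ℤ)) (minus i) * mode s .tw (n : ℤ) (plus i))))
    (fun w => by
      obtain ⟨N, hN⟩ := mode_finite s .tw w
      refine ⟨N, fun n hn => ?_⟩
      rw [LinearMap.smul_apply, LinearMap.sub_apply, LinearMap.smul_apply, Module.End.mul_apply,
        Module.End.mul_apply, hN n hn, hN n hn]
      simp)

/-! ### The action of `GL(𝔞⁺)` -/

/-- The action `(g, g')` on `𝔞 = 𝔞⁺ ⊕ 𝔞⁻`, where `⟨g x, g' y⟩ = ⟨x, y⟩`. -/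
def polAct {k : ℕ} (g : GL (Fin k) ℂ) : Pol k →ₗ[ℂ] Pol k :=
  LinearMap.prodMap (Matrix.mulVecLin (g : Matrix (Fin k) (Fin k) ℂ))
    (Matrix.mulVecLin ((g⁻¹ : GL (Fin k) ℂ) : Matrix (Fin k) (Fin k) ℂ).transpose)

theorem polAct_one {k : ℕ} : polAct (1 : GL (Fin k) ℂ) = LinearMap.id := by
  ext x <;> simp [polAct]

theorem polAct_mul {k : ℕ} (g h : GL (Fin k) ℂ) : polAct (g * h) = polAct g ∘ₗ polAct h := by
  refine LinearMap.ext fun x => ?_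
  simp only [polAct, LinearMap.prodMap_apply, LinearMap.comp_apply, Matrix.mulVecLin_apply,
    Matrix.mulVec_mulVec, mul_inv_rev, Units.val_mul, Matrix.transpose_mul]

theorem form_polAct (s : Stat) {k : ℕ} (g : GL (Fin k) ℂ) (x y : Pol k) :
    form s k (polAct g x) (polAct g y) = form s k x y := by
  have h : ∀ u v : Fin k → ℂ,
      (((g⁻¹ : GL (Fin k) ℂ) : Matrix (Fin k) (Fin k) ℂ).transpose.mulVec u) ⬝ᵥ
        ((g : Matrix (Fin k) (Fin k) ℂ).mulVec v) = u ⬝ᵥ v := by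
    intro u v
    rw [Matrix.mulVec_transpose, ← Matrix.dotProduct_mulVec, Matrix.mulVec_mulVec, ← Units.val_mul,
      inv_mul_cancel, Units.val_one, Matrix.one_mulVec]
  simp only [form, LinearMap.mk₂_apply, polAct, LinearMap.prodMap_apply, Matrix.mulVecLin_apply]
  rw [h, dotProduct_comm (Matrix.mulVec _ x.1), h, dotProduct_comm y.2]

/-- The induced action on the space of modes. -/
def modesAct {k : ℕ} (g : GL (Fin k) ℂ) : Modes k →ₗ[ℂ] Modes k :=
  Finsupp.mapRange.linearMap (polAct g)

theorem modesAct_single {k : ℕ} (g : GL (Fin k) ℂ) (n : ℤ) (x : Pol k) :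
    modesAct g (Finsupp.single n x) = Finsupp.single n (polAct g x) := by
  simp [modesAct]

theorem modeForm_modesAct (s : Stat) (ε : Sector) {k : ℕ} (g : GL (Fin k) ℂ) (x y : Modes k) :
    modeForm s ε k (modesAct g x) (modesAct g y) = modeForm s ε k x y := by
  induction x using Finsupp.induction_linear with
  | zero => simp
  | add a b ha hb => simp only [map_add, LinearMap.add_apply, ha, hb]
  | single n x =>
    rw [modesAct_single, modeForm_single, modeForm_single]
    exact form_polAct s g x _

/-- The induced automorphism of the algebra of modes. -/
def algAct (s : Stat) (ε : Sector) {k : ℕ} (g : GL (Fin k) ℂ) :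
    ModeAlg s ε k →ₐ[ℂ] ModeAlg s ε k :=
  RingQuot.liftAlgHom ℂ ⟨TensorAlgebra.lift ℂ (ModeAlg.ι s ε k ∘ₗ modesAct g), by
    rintro _ _ ⟨x, y⟩
    rw [map_sub, map_smul, map_mul, map_mul, AlgHom.commutes]
    simp only [TensorAlgebra.lift_ι_apply, LinearMap.comp_apply]
    rw [ι_comm, modeForm_modesAct, add_sub_cancel_left]⟩

theorem algAct_ι (s : Stat) (ε : Sector) {k : ℕ} (g : GL (Fin k) ℂ) (x : Modes k) :
    algAct s ε g (ModeAlg.ι s ε k x) = ModeAlg.ι s ε k (modesAct g x) := by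
  refine (RingQuot.liftAlgHom_mkAlgHom_apply ℂ _ _ _).trans ?_
  rw [TensorAlgebra.lift_ι_apply]
  rfl

theorem algHom_ext (s : Stat) (ε : Sector) {k : ℕ} {A : Type*} [Semiring A] [Algebra ℂ A]
    {f g : ModeAlg s ε k →ₐ[ℂ] A} (h : ∀ x, f (ModeAlg.ι s ε k x) = g (ModeAlg.ι s ε k x)) :
    f = g := by
  refine RingQuot.ringQuot_ext' ℂ f g (TensorAlgebra.hom_ext ?_)
  exact LinearMap.ext h

theorem annih_algAct (s : Stat) (ε : Sector) {k : ℕ} (g : GL (Fin k) ℂ) :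
    (annih s ε k).restrictScalars ℂ ≤
      ((annih s ε k).restrictScalars ℂ).comap (algAct s ε g).toLinearMap := by
  intro u hu
  change algAct s ε g u ∈ annih s ε k
  have hu' : u ∈ annih s ε k := hu
  induction hu' using Submodule.span_induction with
  | mem u h =>
    obtain ⟨n, x, hx, rfl⟩ := h
    rw [algAct_ι, modesAct_single]
    refine Submodule.subset_span ⟨n, _, hx.imp id (fun h => ⟨h.1, ?_⟩), rfl⟩
    simp [polAct, h.2]
  | zero => rw [map_zero]; exact zero_mem _
  | add a b ha hb iha ihb => rw [map_add]; exact add_mem (iha ha) (ihb hb)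
  | smul a b hb ih =>
    rw [smul_eq_mul, map_mul, ← smul_eq_mul]
    exact Submodule.smul_mem _ _ (ih hb)

/-- The action of one `g ∈ GL(𝔞⁺)` on the induced module:
`g · x_1(r_1) ⋯ x_n(r_n) v = (g x_1)(r_1) ⋯ (g x_n)(r_n) v`. -/
def fockActLin (s : Stat) (ε : Sector) {k : ℕ} (g : GL (Fin k) ℂ) :
    Fock s ε k →ₗ[ℂ] Fock s ε k :=
  ((annih s ε k).restrictScalars ℂ).mapQ ((annih s ε k).restrictScalars ℂ)
    (algAct s ε g).toLinearMap (annih_algAct s ε g)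

theorem fockActLin_mk (s : Stat) (ε : Sector) {k : ℕ} (g : GL (Fin k) ℂ) (u : ModeAlg s ε k) :
    fockActLin s ε g (Fock.mk s ε k u) = Fock.mk s ε k (algAct s ε g u) := rfl

/-- The action of `GL(𝔞⁺)` on the induced module. -/
def fockAct (s : Stat) (ε : Sector) (k : ℕ) : Representation ℂ (GL (Fin k) ℂ) (Fock s ε k) where
  toFun := fockActLin s ε
  map_one' := by
    refine LinearMap.ext fun w => ?_
    obtain ⟨u, rfl⟩ := Submodule.mkQ_surjective (annih s ε k) w
    have h : algAct s ε (1 : GL (Fin k) ℂ) = AlgHom.id ℂ _ := algHom_ext s ε fun x => by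
      rw [algAct_ι]; simp [modesAct, polAct_one]
    refine (fockActLin_mk s ε 1 u).trans ?_
    rw [h]; rfl
  map_mul' := fun g g' => by
    refine LinearMap.ext fun w => ?_
    obtain ⟨u, rfl⟩ := Submodule.mkQ_surjective (annih s ε k) w
    have h : algAct s ε (g * g') = (algAct s ε g).comp (algAct s ε g') := algHom_ext s ε fun x => by
      rw [AlgHom.comp_apply, algAct_ι, algAct_ι, algAct_ι, modesAct, polAct_mul,
        Finsupp.mapRange.linearMap_comp]
      rfl
    refine (fockActLin_mk s ε (g * g') u).trans ?_
    rw [h]; rfl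

/-! ## Super vertex algebras and twisted modules -/

/-- A super vertex algebra structure on the super vector space `V` with parity involution `P` and
vacuum `v`; `prod n u w` is the coefficient of `z^{-n-1}` in `Y(u, z) w`. -/
structure SuperVertexAlgebra (V : Type*) [AddCommGroup V] [Module ℂ V]
    (P : Module.End ℂ V) (v : V) where
  prod : ℤ → V →ₗ[ℂ] V →ₗ[ℂ] V
  truncation : ∀ u w : V, ∃ N : ℤ, ∀ n ≥ N, prod n u w = 0
  parity_sq : P * P = 1
  parity_vac : P v = v
  parity_prod : ∀ (n : ℤ) (u w : V), P (prod n u w) = prod n (P u) (P w)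
  vac_prod : ∀ (n : ℤ) (w : V), prod n v w = if n = -1 then w else 0
  prod_vac : ∀ (n : ℤ) (u : V), 0 ≤ n → prod n u v = 0
  creation : ∀ u : V, prod (-1) u v = u
  /-- The Borcherds identity, for `u` of parity `i` and `w` of parity `j`. -/
  borcherds : ∀ (i j : ℕ) (u w x : V), P u = (-1 : ℂ) ^ i • u → P w = (-1 : ℂ) ^ j • w →
    ∀ m n k : ℤ,
      ∑ᶠ l : ℕ, Ring.choose (m : ℂ) l • prod (m + k - l) (prod (n + l) u w) x
      = ∑ᶠ l : ℕ, ((-1 : ℂ) ^ l * Ring.choose (n : ℂ) l) •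
          (prod (m + n - l) u (prod (k + l) w x)
            - ((-1 : ℂ) ^ (i * j) * (-1 : ℂ) ^ n) • prod (n + k - l) w (prod (m + l) u x))

/-- A `θ`-twisted module, for an automorphism `θ` with `θ² = 1` of a super vertex algebra.
`act d u w` is the coefficient of `z^{-d/2-1}` in `Y_tw(u, z) w`; it vanishes
if `θ u = u` and `d` is odd, and if `θ u = -u` and `d` is even. -/
structure TwistedModule {V : Type*} [AddCommGroup V] [Module ℂ V] {P : Module.End ℂ V} {v : V}
    (Y : SuperVertexAlgebra V P v) (θ : Module.End ℂ V)
    (M : Type*) [AddCommGroup M] [Module ℂ M] where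
  aut_sq : θ * θ = 1
  aut_vac : θ v = v
  aut_parity : θ * P = P * θ
  aut_prod : ∀ (n : ℤ) (u w : V), θ (Y.prod n u w) = Y.prod n (θ u) (θ w)
  act : ℤ → V →ₗ[ℂ] M →ₗ[ℂ] M
  act_eq_zero : ∀ (a : ℕ) (d : ℤ) (u : V), θ u = (-1 : ℂ) ^ a • u → ¬ d ≡ a [ZMOD 2] → act d u = 0
  truncation : ∀ (u : V) (x : M), ∃ N : ℤ, ∀ d ≥ N, act d u x = 0
  vac_act : ∀ (d : ℤ) (x : M), act d v x = if d = -2 then x else 0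
  /-- The twisted Borcherds identity, with `m = d / 2` and `k = e / 2`, for `u` of parity `i`
  and `w` of parity `j`. -/
  borcherds : ∀ (i j a b : ℕ) (u w : V) (x : M),
    P u = (-1 : ℂ) ^ i • u → P w = (-1 : ℂ) ^ j • w →
    θ u = (-1 : ℂ) ^ a • u → θ w = (-1 : ℂ) ^ b • w →
    ∀ d e n : ℤ, d ≡ a [ZMOD 2] → e ≡ b [ZMOD 2] →
      ∑ᶠ l : ℕ, Ring.choose ((d : ℂ) / 2) l • act (d + e - 2 * l) (Y.prod (n + l) u w) x
      = ∑ᶠ l : ℕ, ((-1 : ℂ) ^ l * Ring.choose (n : ℂ) l) •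
          (act (d + 2 * n - 2 * l) u (act (e + 2 * l) w x)
            - ((-1 : ℂ) ^ (i * j) * (-1 : ℂ) ^ n) •
              act (e + 2 * n - 2 * l) w (act (d + 2 * l) u x))

/-! ## The super vertex operator algebra `W` and its canonically twisted module -/

/-- `A(𝔢) ⊗ A(𝔞) ⊗ A(𝔟)` for `ε = ns`, and `A(𝔢)_tw ⊗ A(𝔞)_tw ⊗ A(𝔟)_tw` for `ε = tw`. -/
abbrev W (ε : Sector) : Type := (Fock .fermi ε 1 ⊗[ℂ] Fock .fermi ε 1) ⊗[ℂ] Fock .bose ε 2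

/-- The operator `A ⊗ B ⊗ C`. -/
def tri {ε : Sector} (A B : Module.End ℂ (Fock .fermi ε 1)) (C : Module.End ℂ (Fock .bose ε 2)) :
    Module.End ℂ (W ε) :=
  TensorProduct.map (TensorProduct.map A B) C

/-- The vacuum `v ⊗ v ⊗ v`. -/
def vacW (ε : Sector) : W ε := (vac .fermi ε 1 ⊗ₜ vac .fermi ε 1) ⊗ₜ vac .bose ε 2

/-- The parity involution `(-1)^F = (-I) ⊗ (-I) ⊗ I`. -/
def parityW (ε : Sector) : Module.End ℂ (W ε) :=
  tri (fockAct .fermi ε 1 (-1)) (fockAct .fermi ε 1 (-1)) 1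

/-- The canonical involution `(-I) ⊗ (-I) ⊗ (-I)`, which is `e^{2πi L(0)}` for `ε = ns`. -/
def canonW (ε : Sector) : Module.End ℂ (W ε) :=
  tri (fockAct .fermi ε 1 (-1)) (fockAct .fermi ε 1 (-1)) (fockAct .bose ε 2 (-1))

/-- The modes of `𝔢` on the tensor product. -/
def modeE (ε : Sector) (n : ℤ) (x : Pol 1) : Module.End ℂ (W ε) := tri (mode .fermi ε n x) 1 1

/-- The modes of `𝔞` on the tensor product; they are odd, so they anti-commute with those
of `𝔢`. -/
def modeA (ε : Sector) (n : ℤ) (x : Pol 1) : Module.End ℂ (W ε) :=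
  tri (fockAct .fermi ε 1 (-1)) (mode .fermi ε n x) 1

/-- The modes of `𝔟` on the tensor product. -/
def modeB (ε : Sector) (n : ℤ) (x : Pol 2) : Module.End ℂ (W ε) := tri 1 1 (mode .bose ε n x)

/-- The super vertex algebra structure on `W` for which `Y(x(-1/2) v, z) = ∑ x(n + 1/2) z^{-n-1}`
for `x` in `𝔢`, `𝔞` and `𝔟`. -/
def IsFreeField (Y : SuperVertexAlgebra (W .ns) (parityW .ns) (vacW .ns)) : Prop :=
  ∀ n : ℤ,
    (∀ x, Y.prod n (modeE .ns (-1) x (vacW .ns)) = modeE .ns n x) ∧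
    (∀ x, Y.prod n (modeA .ns (-1) x (vacW .ns)) = modeA .ns n x) ∧
    (∀ x, Y.prod n (modeB .ns (-1) x (vacW .ns)) = modeB .ns n x)

/-- The canonically twisted module structure for which `Y_tw(x(-1/2) v, z) = ∑ x(n) z^{-n-1/2}`
for `x` in `𝔢`, `𝔞` and `𝔟`. -/
def IsFreeFieldTwisted {Y : SuperVertexAlgebra (W .ns) (parityW .ns) (vacW .ns)}
    (M : TwistedModule Y (canonW .ns) (W .tw)) : Prop :=
  ∀ n : ℤ,
    (∀ x, M.act (2 * n - 1) (modeE .ns (-1) x (vacW .ns)) = modeE .tw n x) ∧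
    (∀ x, M.act (2 * n - 1) (modeA .ns (-1) x (vacW .ns)) = modeA .tw n x) ∧
    (∀ x, M.act (2 * n - 1) (modeB .ns (-1) x (vacW .ns)) = modeB .tw n x)

/-- The vector `∑_i a_i^+(-1/2) a_i^-(-1/2) v`. -/
def jvec (s : Stat) (k : ℕ) : Fock s .ns k :=
  ∑ i : Fin k, mode s .ns (-1) (plus i) (mode s .ns (-1) (minus i) (vac s .ns k))

/-- The Virasoro element
`1/2 ∑_i (a_i^+(-3/2) a_i^-(-1/2) - a_i^+(-1/2) a_i^-(-3/2)) v`. -/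
def ωvec (s : Stat) (k : ℕ) : Fock s .ns k :=
  (1 / 2 : ℂ) • ∑ i : Fin k,
    (mode s .ns (-2) (plus i) (mode s .ns (-1) (minus i) (vac s .ns k))
      - mode s .ns (-1) (plus i) (mode s .ns (-2) (minus i) (vac s .ns k)))

/-- `j_𝔢 = j ⊗ v ⊗ v`. -/
def jE : W .ns := (jvec .fermi 1 ⊗ₜ vac .fermi .ns 1) ⊗ₜ vac .bose .ns 2

/-- `4 v ⊗ j ⊗ v + v ⊗ v ⊗ j`. -/
def jW : W .ns :=
  (4 : ℂ) • ((vac .fermi .ns 1 ⊗ₜ jvec .fermi 1) ⊗ₜ vac .bose .ns 2)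
    + (vac .fermi .ns 1 ⊗ₜ vac .fermi .ns 1) ⊗ₜ jvec .bose 2

/-- `ω ⊗ v ⊗ v + v ⊗ ω ⊗ v + v ⊗ v ⊗ ω`. -/
def ωW : W .ns :=
  (ωvec .fermi 1 ⊗ₜ vac .fermi .ns 1) ⊗ₜ vac .bose .ns 2
    + (vac .fermi .ns 1 ⊗ₜ ωvec .fermi 1) ⊗ₜ vac .bose .ns 2
    + (vac .fermi .ns 1 ⊗ₜ vac .fermi .ns 1) ⊗ₜ ωvec .bose 2

/-- The operator `J_𝔢(0)` on `W_tw`. -/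
def JE : Module.End ℂ (W .tw) := tri (J0 .fermi 1) 1 1

/-- The operator `J(0)` on `W_tw`. -/
def JW : Module.End ℂ (W .tw) := (4 : ℂ) • tri 1 (J0 .fermi 1) 1 + tri 1 1 (J0 .bose 2)

/-- The operator `L(0)` on `W_tw`. -/
def LW : Module.End ℂ (W .tw) :=
  tri (L0 .fermi 1) 1 1 + tri 1 (L0 .fermi 1) 1 + tri 1 1 (L0 .bose 2)

/-- The subspace of `W_tw` on which `J(0) = p.1` and `L(0) = p.2`. -/
def bigraded (p : ℤ × ℕ) : Submodule ℂ (W .tw) :=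
  JW.eigenspace (p.1 : ℂ) ⊓ LW.eigenspace (p.2 : ℂ)

/-! ## The umbral group and its characters -/

/-- The group `SL_2(3)`. -/
abbrev G : Type := Matrix.SpecialLinearGroup (Fin 2) (ZMod 3)

/-- The labels of the conjugacy classes. -/
inductive Cls
  | c1A
  | c2A
  | c4A
  | c3A
  | c6A
  | c3B
  | c6B

open Classical in
/-- The label of the class of `g`, when the label `3A` is given to the class of the element `t` of
order `3`; then `3B` is the class of `t⁻¹`, and `6B`, `6A` are the classes of `-t`, `-t⁻¹`. -/
def cls (t g : G) : Cls :=
  if orderOf g = 1 then .c1A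
  else if orderOf g = 2 then .c2A
  else if orderOf g = 4 then .c4A
  else if orderOf g = 3 then (if IsConj t g then .c3A else .c3B)
  else (if IsConj t (-g) then .c6B else .c6A)

/-- `b_3 = (-1 + √-3) / 2`. -/
def b3 : ℂ := (-1 + Real.sqrt 3 * Complex.I) / 2

/-- The character `χ_2`. -/
def χ2 : Cls → ℂ
  | .c1A => 1
  | .c2A => 1
  | .c4A => 1
  | .c3A => b3
  | .c6A => starRingEnd ℂ b3
  | .c3B => starRingEnd ℂ b3
  | .c6B => b3

/-- The character `χ_6`. -/
def χ6 : Cls → ℂ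
  | .c1A => 2
  | .c2A => -2
  | .c4A => 0
  | .c3A => -starRingEnd ℂ b3
  | .c6A => b3
  | .c3B => -b3
  | .c6B => starRingEnd ℂ b3

/-- The action `g ↦ I ⊗ ϱ(g) ⊗ ϱ'(g)` on `W` (`ε = ns`) and on `W_tw` (`ε = tw`). -/
def actW (ε : Sector) (ϱ : G →* GL (Fin 1) ℂ) (ϱ' : G →* GL (Fin 2) ℂ) :
    Representation ℂ G (W ε) :=
  ((Representation.trivial ℂ G (Fock .fermi ε 1)).tprod ((fockAct .fermi ε 1).comp ϱ)).tprod
    ((fockAct .bose ε 2).comp ϱ')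

/-! ## Twined traces -/

/-- The operator `(g + g⁻¹) J_𝔢(0) (-1)^F` on `W_tw`. -/
def twining (ϱ : G →* GL (Fin 1) ℂ) (ϱ' : G →* GL (Fin 2) ℂ) (g : G) : Module.End ℂ (W .tw) :=
  (actW .tw ϱ ϱ' g + actW .tw ϱ ϱ' g⁻¹) * JE * parityW .tw

open Classical in
/-- The trace of `T` on the subspace `E`, if `T` preserves `E`. -/
def traceOn {V : Type*} [AddCommGroup V] [Module ℂ V] (T : Module.End ℂ V) (E : Submodule ℂ V) : ℂ :=
  if h : ∀ w ∈ E, T w ∈ E then LinearMap.trace ℂ E (T.restrict h) else 0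

/-- The coefficient of `y^{p.1} q^{p.2}` in
`-tr((g + g⁻¹) J_𝔢(0) (-1)^F y^{J(0)} q^{L(0)} | W_tw)`. -/
def ψtilde (ϱ : G →* GL (Fin 1) ℂ) (ϱ' : G →* GL (Fin 2) ℂ) (g : G) (p : ℤ × ℕ) : ℂ :=
  -traceOn (twining ϱ ϱ' g) (bigraded p)

/-! ## The meromorphic Jacobi forms -/

/-- `e(x) = e^{2πi x}`. -/
def e (x : ℂ) : ℂ := Complex.exp (2 * Real.pi * Complex.I * x)

/-- `θ_1(τ, z) = -i q^{1/8} y^{1/2} ∏_{n > 0} (1 - y⁻¹ q^{n-1}) (1 - y q^n) (1 - q^n)`. -/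
def θ1 (τ z : ℂ) : ℂ :=
  -Complex.I * e (τ / 8) * e (z / 2) *
    ∏' n : ℕ, (1 - (e z)⁻¹ * e τ ^ n) * (1 - e z * e τ ^ (n + 1)) * (1 - e τ ^ (n + 1))

/-- `θ_2(τ, z) = q^{1/8} y^{1/2} ∏_{n > 0} (1 + y⁻¹ q^{n-1}) (1 + y q^n) (1 - q^n)`. -/
def θ2 (τ z : ℂ) : ℂ :=
  e (τ / 8) * e (z / 2) *
    ∏' n : ℕ, (1 + (e z)⁻¹ * e τ ^ n) * (1 + e z * e τ ^ (n + 1)) * (1 - e τ ^ (n + 1))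

open Complex in
/-- The meromorphic Jacobi form attached to a conjugacy class; `3A` and `3B`, and `6A` and `6B`,
have the same one. -/
def ψcls : Cls → ℂ → ℂ → ℂ
  | .c1A, τ, z => 2 * I * (ModularForm.eta τ ^ 3 * θ1 τ (4 * z) / θ1 τ z ^ 2)
  | .c2A, τ, z => -2 * I * (ModularForm.eta τ ^ 3 * θ1 τ (4 * z) / θ2 τ z ^ 2)
  | .c4A, τ, z => -2 * I * (ModularForm.eta τ * ModularForm.eta (2 * τ) * θ1 τ (4 * z) / θ2 (2 * τ) (2 * z))
  | .c3A, τ, z | .c3B, τ, z => -I * (ModularForm.eta (3 * τ) / θ1 (3 * τ) (3 * z)) *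
      (θ1 τ (4 * z + 1 / 3) * θ1 τ (z - 1 / 3) + θ1 τ (4 * z - 1 / 3) * θ1 τ (z + 1 / 3))
  | .c6A, τ, z | .c6B, τ, z => -I * (ModularForm.eta (3 * τ) / θ2 (3 * τ) (3 * z)) *
      (θ1 τ (4 * z + 1 / 3) * θ1 τ (z + 1 / 6) - θ1 τ (4 * z - 1 / 3) * θ1 τ (z - 1 / 6))

end UmbralSeven

end

open UmbralSeven

noncomputable section
namespace UmbralSeven

/-! ## Systems of creation and annihilation operators -/

/-! Every free field module has a basis of monomials in creation operators. Monomials with different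
occupation numbers are separated by the number operators, so the basis exists once the vacuum is
known to be non-zero. That is seen by realizing the relations on an exterior algebra
(`vac_fermi_ne_zero`) or on a polynomial ring (`vac_bose_ne_zero`).

On W_tw this basis diagonalizes J(0), L(0), J_𝔢(0) and (-1)^F and, after a change of basis of 𝔟⁺,
also a given g (`wBasis_twining`). The vacuum constants add up to 4·(1/2) − 1 = 1 for J(0) and to
1/8 + 1/8 − 2/8 = 0 for L(0), whence the integral bigrading. The trace becomes a sum over occupation
numbers, which factors over 𝔢, 𝔞 and 𝔟. The factor 𝔞 gives an infinite product, and 𝔟 gives the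
inverse of one, expanded where |y⁻¹| < 1 and |yq| < 1; this is the domain of the theorem. The factor
𝔢 would vanish because of its zero mode, but the insertion of J_𝔢(0) removes the zero and leaves ∏(1
− q^n)² (`hasSum_fermi_charge`). The result is `hasSum_twine`; its convergence also gives the
finiteness of the bigraded pieces (`finite_weight`).

The characters, together with the order of g, determine the eigenvalues of g (`exists_diag_ψcls`).
For orders 1 and 2 the trace is a theta quotient at once. For order 4 the eigenvalues ±i combine to
a theta function at (2τ, 2z). For orders 3 and 6 two of three cube roots of unity, up to a common
sign, occur in the denominator; supplying the third gives a theta function at (3τ, 3z) and an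
additional factor in the numerator.

The zero modes are computed from the twisted Borcherds identity with half-integral exponents: the
binomial coefficients of −1/2 and 1/2 produce the constants −sk/2 and −sk/8 (`FreeFactor.act_jvec`,
`FreeFactor.act_ωvec`). Faithfulness holds because χ_6 takes the value 2 only at the identity. -/

theorem Stat.sign_mul_self (s : Stat) : s.sign * s.sign = 1 := by
  cases s <;> simp [Stat.sign]

theorem Stat.sign_ne_zero (s : Stat) : s.sign ≠ 0 := by
  cases s <;> simp [Stat.sign]

/-- The occupation numbers that occur: all multisets for `bose`, those without repetition for
`fermi`. -/
def Stat.Occ {ι : Type*} (s : Stat) (m : Multiset ι) : Prop :=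
  match s with
  | .fermi => m.Nodup
  | .bose => True

/-- Creation operators `c i` and annihilation operators `a i` on a space generated by a vacuum. -/
structure Oscillators (s : Stat) (ι V : Type*) [DecidableEq ι] [AddCommGroup V] [Module ℂ V] where
  c : ι → Module.End ℂ V
  a : ι → Module.End ℂ V
  v : V
  c_comm : ∀ i j w, c i (c j w) = s.sign • c j (c i w)
  a_c : ∀ i j w, a i (c j w) = s.sign • c j (a i w) + if i = j then w else 0
  a_vac : ∀ i, a i v = 0
  vac_ne : v ≠ 0
  gen : ∀ S : Submodule ℂ V, v ∈ S → (∀ i, ∀ w ∈ S, c i w ∈ S) → (∀ i, ∀ w ∈ S, a i w ∈ S) → S = ⊤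

namespace Oscillators

variable {s : Stat} {ι V : Type*} [DecidableEq ι] [AddCommGroup V] [Module ℂ V]
  (O : Oscillators s ι V)

/-- The monomial `c_{i_1} ⋯ c_{i_n} v`. -/
def mon (l : List ι) : V := l.foldr (fun i w => O.c i w) O.v

@[simp] theorem mon_nil : O.mon [] = O.v := rfl

@[simp] theorem mon_cons (i : ι) (l : List ι) : O.mon (i :: l) = O.c i (O.mon l) := rfl

/-- The scalar is a sign, but only its existence matters: reordering never leaves the line spanned
by a monomial. -/
theorem mon_perm {l l' : List ι} (h : l.Perm l') : ∃ z : ℂ, O.mon l = z • O.mon l' := by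
  induction h with
  | nil => exact ⟨1, by simp⟩
  | cons i _ ih =>
    obtain ⟨z, hz⟩ := ih
    exact ⟨z, by simp [hz]⟩
  | swap i j l => exact ⟨s.sign, by simp [O.c_comm j i]⟩
  | trans _ _ ih ih' =>
    obtain ⟨z, hz⟩ := ih
    obtain ⟨z', hz'⟩ := ih'
    exact ⟨z * z', by rw [hz, hz', smul_smul]⟩

/-- The number operators. -/
def num (i : ι) : Module.End ℂ V := O.c i * O.a i

/-- Moving `a i` and then `c i` past `c j` costs the sign s twice. The signs cancel, so [N_i, c_j] =
δ_ij c_j for both statistics. -/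
theorem num_c (i j : ι) (w : V) :
    O.num i (O.c j w) = O.c j (O.num i w) + if i = j then O.c j w else 0 := by
  simp only [num, Module.End.mul_apply, O.a_c, map_add, map_smul]
  rw [O.c_comm i j, smul_smul, s.sign_mul_self, one_smul]
  split_ifs with h <;> simp [h]

theorem num_mon (i : ι) (l : List ι) : O.num i (O.mon l) = (l.count i : ℂ) • O.mon l := by
  induction l with
  | nil => simp [num, O.a_vac]
  | cons j l ih =>
    rw [mon_cons, num_c, ih, List.count_cons, map_smul]
    by_cases h : i = j
    · simp [h, add_smul]
    · simp [h, Ne.symm h]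

theorem num_mon_multiset (i : ι) (l : List ι) :
    O.num i (O.mon l) = ((l : Multiset ι).count i : ℂ) • O.mon l := by
  rw [num_mon, Multiset.coe_count]

theorem a_c_mon (i : ι) (l : List ι) :
    O.a i (O.c i (O.mon l)) = (1 + s.sign * (l.count i : ℂ)) • O.mon l := by
  have h := O.num_mon i l
  rw [num, Module.End.mul_apply] at h
  rw [O.a_c, h, if_pos rfl, smul_smul, add_smul, one_smul, add_comm]

/-- Annihilating the first factor returns the shorter monomial times 1 + s·(multiplicity). For
bosons this number is positive; for fermions the multiplicity is 0. -/
theorem mon_ne_zero (l : List ι) (hl : s.Occ (l : Multiset ι)) : O.mon l ≠ 0 := by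
  induction l with
  | nil => exact O.vac_ne
  | cons i l ih =>
    intro h
    have h' := O.a_c_mon i l
    rw [mon_cons] at h
    rw [h, map_zero, eq_comm, smul_eq_zero] at h'
    cases s with
    | bose =>
      refine h'.elim (fun h => ?_) (ih trivial)
      simp only [Stat.sign, one_mul] at h
      exact absurd h (by norm_cast; omega)
    | fermi =>
      have hn : (i :: l).Nodup := hl
      rw [List.nodup_cons] at hn
      refine h'.elim (fun h => ?_) (ih hn.2)
      simp [List.count_eq_zero_of_not_mem hn.1] at h

/-- For fermions c_i² = −c_i², hence c_i² = 0, and a repeated factor can be moved next to its copy.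
-/
theorem mon_eq_zero (l : List ι) (hl : ¬ s.Occ (l : Multiset ι)) : O.mon l = 0 := by
  cases s with
  | bose => exact absurd trivial hl
  | fermi =>
    have h : ¬ l.Nodup := hl
    clear hl
    induction l with
    | nil => exact absurd List.nodup_nil h
    | cons i l ih =>
      by_cases hl : l.Nodup
      · have hi : i ∈ l := by
          by_contra hi
          exact h (List.nodup_cons.2 ⟨hi, hl⟩)
        obtain ⟨z, hz⟩ := O.mon_perm (List.perm_cons_erase hi)
        have h2 := O.c_comm i i (O.mon (l.erase i))
        rw [Stat.sign, neg_one_smul, eq_neg_iff_add_eq_zero, ← two_smul ℂ, smul_eq_zero] at h2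
        rw [mon_cons, hz, mon_cons, map_smul, h2.resolve_left two_ne_zero, smul_zero]
      · rw [mon_cons, ih hl, map_zero]

/-- The span is stable under annihilation because `a i` can be commuted through to the vacuum, so
`gen` applies. -/
theorem span_mon : Submodule.span ℂ (Set.range O.mon) = ⊤ := by
  have hc : ∀ i, ∀ w ∈ Submodule.span ℂ (Set.range O.mon),
      O.c i w ∈ Submodule.span ℂ (Set.range O.mon) := by
    intro i w hw
    induction hw using Submodule.span_induction with
    | mem w h =>
      obtain ⟨l, rfl⟩ := h
      exact Submodule.subset_span ⟨i :: l, rfl⟩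
    | zero => simp
    | add x y _ _ hx hy => rw [map_add]; exact add_mem hx hy
    | smul z x _ hx => rw [map_smul]; exact Submodule.smul_mem _ _ hx
  refine O.gen _ (Submodule.subset_span ⟨[], rfl⟩) hc fun i w hw => ?_
  induction hw using Submodule.span_induction with
  | mem w h =>
    obtain ⟨l, rfl⟩ := h
    induction l with
    | nil => simp [O.a_vac]
    | cons j l ih =>
      rw [mon_cons, O.a_c]
      refine add_mem (Submodule.smul_mem _ _ (hc _ _ ih)) ?_
      split_ifs
      exacts [Submodule.subset_span ⟨l, rfl⟩, zero_mem _]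
  | zero => simp
  | add x y _ _ hx hy => rw [map_add]; exact add_mem hx hy
  | smul z x _ hx => rw [map_smul]; exact Submodule.smul_mem _ _ hx

/-- Linear maps that agree on all monomials are equal. -/
theorem hom_ext {V' : Type*} [AddCommGroup V'] [Module ℂ V'] {f g : V →ₗ[ℂ] V'}
    (h : ∀ l, f (O.mon l) = g (O.mon l)) : f = g :=
  LinearMap.ext_on_range O.span_mon h

/-- The monomial with given occupation numbers, for some choice of the order. -/
def vec (m : {m : Multiset ι // s.Occ m}) : V := O.mon m.1.toList

theorem vec_ne_zero (m : {m : Multiset ι // s.Occ m}) : O.vec m ≠ 0 :=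
  O.mon_ne_zero _ (by rw [Multiset.coe_toList]; exact m.2)

theorem num_vec (i : ι) (m : {m : Multiset ι // s.Occ m}) :
    O.num i (O.vec m) = (m.1.count i : ℂ) • O.vec m := by
  rw [vec, num_mon_multiset, Multiset.coe_toList]

theorem span_vec : Submodule.span ℂ (Set.range O.vec) = ⊤ := by
  refine top_unique ?_
  rw [← O.span_mon, Submodule.span_le]
  rintro _ ⟨l, rfl⟩
  by_cases h : s.Occ (l : Multiset ι)
  · obtain ⟨z, hz⟩ := O.mon_perm (l := l) (l' := (l : Multiset ι).toList)
      (by rw [← Multiset.coe_eq_coe, Multiset.coe_toList])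
    rw [hz]
    exact Submodule.smul_mem _ _ (Submodule.subset_span ⟨⟨l, h⟩, rfl⟩)
  · rw [O.mon_eq_zero l h]
    exact zero_mem _

theorem num_comm (i j : ι) : Commute (O.num i) (O.num j) := by
  refine O.hom_ext fun l => ?_
  simp only [Module.End.mul_apply, num_mon, map_smul]
  rw [smul_comm]

/-- The monomials are joint eigenvectors of the commuting number operators, with a different family
of eigenvalues for each multiset. -/
theorem linearIndependent_vec : LinearIndependent ℂ O.vec := by
  have h := Module.End.independent_iInf_maxGenEigenspace_of_forall_mapsTo O.num
    (fun i j μ => Module.End.mapsTo_maxGenEigenspace_of_comm (O.num_comm j i) μ)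
  have hinj : Function.Injective
      (fun (m : {m : Multiset ι // s.Occ m}) (i : ι) => (m.1.count i : ℂ)) := by
    intro m m' hm
    refine Subtype.ext (Multiset.ext.2 fun i => ?_)
    exact Nat.cast_injective (R := ℂ) (congrFun hm i)
  have h' := h.comp hinj
  refine h'.linearIndependent _ (fun m => ?_) O.vec_ne_zero
  refine (Submodule.mem_iInf _).2 fun i => ?_
  refine (Module.End.mem_maxGenEigenspace _ _ _).2 ⟨1, ?_⟩
  rw [pow_one, LinearMap.sub_apply, num_vec, LinearMap.smul_apply, Module.End.one_apply, sub_self]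

/-- The basis of the monomials. -/
def basis : Module.Basis {m : Multiset ι // s.Occ m} ℂ V :=
  Module.Basis.mk O.linearIndependent_vec O.span_vec.ge

theorem basis_apply (m : {m : Multiset ι // s.Occ m}) : O.basis m = O.mon m.1.toList := by
  simp [basis, vec]

end Oscillators

/-! ## The vacuum does not vanish -/

section Model

variable (s : Stat) (ε : Sector) (k : ℕ)

theorem form_apply {s : Stat} {k : ℕ} (x y : Pol k) :
    form s k x y = x.2 ⬝ᵥ y.1 - s.sign * (x.1 ⬝ᵥ y.2) := rfl

theorem form_symm {s : Stat} {k : ℕ} (x y : Pol k) : form s k y x = -s.sign * form s k x y := by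
  simp only [form_apply, dotProduct_comm y.2, dotProduct_comm y.1]
  linear_combination (x.1 ⬝ᵥ y.2) * -s.sign_mul_self

theorem modeForm_single_single {s : Stat} {ε : Sector} {k : ℕ} (n m : ℤ) (x y : Pol k) :
    modeForm s ε k (Finsupp.single n x) (Finsupp.single m y)
      = if n + m + ε.shift = 0 then form s k x y else 0 := by
  rw [modeForm_single, Finsupp.single_apply]
  by_cases h : n + m + ε.shift = 0
  · rw [if_pos h, if_pos (by omega)]
  · rw [if_neg h, if_neg (by omega), map_zero]

theorem modes_bilin_ext {k : ℕ} {B B' : Modes k →ₗ[ℂ] Modes k →ₗ[ℂ] ℂ}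
    (h : ∀ n m x y, B (Finsupp.single n x) (Finsupp.single m y)
      = B' (Finsupp.single n x) (Finsupp.single m y)) : B = B' := by
  refine Finsupp.lhom_ext fun n x => Finsupp.lhom_ext fun m y => h n m x y

theorem modeForm_symm (x y : Modes k) :
    modeForm s ε k y x = -s.sign * modeForm s ε k x y := by
  have h : (modeForm s ε k).flip = (-s.sign) • modeForm s ε k := by
    refine modes_bilin_ext fun n m x y => ?_
    simp only [LinearMap.flip_apply, LinearMap.smul_apply, modeForm_single_single, smul_eq_mul]
    rw [form_symm x y, show m + n + ε.shift = n + m + ε.shift by ring, mul_ite, mul_zero]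
  exact LinearMap.congr_fun₂ h x y

/-- The projection of the space of modes to the creation operators. -/
def creationPart : Modes k →ₗ[ℂ] Modes k :=
  Finsupp.lsum ℂ fun n : ℤ => Finsupp.lsingle n ∘ₗ
    (if 2 * n + ε.shift < 0 then LinearMap.id
      else if 2 * n + ε.shift = 0 then LinearMap.inr ℂ (Fin k → ℂ) (Fin k → ℂ) ∘ₗ LinearMap.snd ℂ _ _
      else 0)

theorem creationPart_single {ε : Sector} {k : ℕ} (n : ℤ) (x : Pol k) :
    creationPart ε k (Finsupp.single n x) = Finsupp.single n
      (if 2 * n + ε.shift < 0 then x else if 2 * n + ε.shift = 0 then (0, x.2) else 0) := by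
  rw [creationPart, Finsupp.lsum_single, LinearMap.comp_apply, Finsupp.lsingle_apply]
  split_ifs <;> simp

/-- The creation half and the annihilation half are both isotropic, so only mixed pairings survive.
Paired modes have opposite degrees; in degree 0 the two halves are 𝔞⁻ and 𝔞⁺. -/
theorem modeForm_split (x y : Modes k) :
    modeForm s ε k x y = modeForm s ε k (x - creationPart ε k x) (creationPart ε k y)
      + modeForm s ε k (creationPart ε k x) (y - creationPart ε k y) := by
  have h : modeForm s ε k = (modeForm s ε k).compl₁₂ (LinearMap.id - creationPart ε k)
      (creationPart ε k) + (modeForm s ε k).compl₁₂ (creationPart ε k)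
        (LinearMap.id - creationPart ε k) := by
    refine modes_bilin_ext fun n m x y => ?_
    simp only [LinearMap.add_apply, LinearMap.compl₁₂_apply, LinearMap.sub_apply,
      LinearMap.id_apply, creationPart_single, ← Finsupp.single_sub, modeForm_single_single]
    by_cases h : n + m + ε.shift = 0
    · simp only [if_pos h]
      rcases lt_trichotomy (2 * n + ε.shift) 0 with h1 | h1 | h1
      · simp [h1, show ¬ 2 * m + ε.shift < 0 by omega, show ¬ 2 * m + ε.shift = 0 by omega]
      · simp [h1, show 2 * m + ε.shift = 0 by omega, form_apply, sub_eq_neg_add]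
      · simp [h1.ne', not_lt.2 h1.le, show 2 * m + ε.shift < 0 by omega]
    · simp only [if_neg h, add_zero]
  exact LinearMap.congr_fun₂ h x y

/-- If the space of modes is represented on `V` by creation and annihilation operators such that
the annihilation operators kill a non-zero vector, then the vacuum is non-zero. -/
theorem vac_ne_zero_of_model {V : Type*} [AddCommGroup V] [Module ℂ V]
    (cr an : Modes k →ₗ[ℂ] Module.End ℂ V) (v : V) (hv : v ≠ 0) (han : ∀ x, an x v = 0)
    (hcc : ∀ x y, cr x * cr y = s.sign • (cr y * cr x))
    (haa : ∀ x y, an x * an y = s.sign • (an y * an x))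
    (hac : ∀ x y, an x * cr y = s.sign • (cr y * an x) + algebraMap ℂ _ (modeForm s ε k x y)) :
    vac s ε k ≠ 0 := by
  let P := creationPart ε k
  let ρ : Modes k →ₗ[ℂ] Module.End ℂ V := cr ∘ₗ P + an ∘ₗ (LinearMap.id - P)
  -- Products of two creation or two annihilation parts cancel. The mixed products leave the two
  -- terms of `modeForm_split`, one of them by the symmetry of the form.
  have hρ : ∀ x y, ρ x * ρ y - s.sign • (ρ y * ρ x) = algebraMap ℂ _ (modeForm s ε k x y) := by
    intro x y
    have h1 := hcc (P x) (P y)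
    have h2 := haa (x - P x) (y - P y)
    have h3 := hac (x - P x) (P y)
    have h4 := hac (y - P y) (P x)
    have e1 : ρ x = cr (P x) + an (x - P x) := by simp [ρ]
    have e2 : ρ y = cr (P y) + an (y - P y) := by simp [ρ]
    have h5 : modeForm s ε k (P x) (y - P y)
      = -s.sign * modeForm s ε k (y - P y) (P x) := modeForm_symm _ _ _ _ _
    rw [modeForm_split s ε k x y]
    change _ = algebraMap ℂ _ (modeForm s ε k (x - P x) (P y) + modeForm s ε k (P x) (y - P y))
    rw [h5, e1, e2, add_mul, mul_add, mul_add, add_mul, mul_add, mul_add, h1, h2, h3, h4,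
      map_add, neg_mul, map_neg]
    simp only [smul_add, smul_smul, s.sign_mul_self, one_smul, Algebra.algebraMap_eq_smul_one]
    abel
  let F : ModeAlg s ε k →ₐ[ℂ] Module.End ℂ V :=
    RingQuot.liftAlgHom ℂ ⟨TensorAlgebra.lift ℂ ρ, by
      rintro _ _ ⟨x, y⟩
      rw [map_sub, map_smul, map_mul, map_mul, AlgHom.commutes]
      simp only [TensorAlgebra.lift_ι_apply]
      exact hρ x y⟩
  have hF : ∀ x, F (ModeAlg.ι s ε k x) = ρ x := fun x =>
    (RingQuot.liftAlgHom_mkAlgHom_apply ℂ _ _ _).trans (TensorAlgebra.lift_ι_apply _ _)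
  -- The generators of the left ideal have no creation part, so they act through `an` and kill `v`.
  -- If the vacuum were zero, 1 would lie in the ideal and would kill `v` too.
  have hkill : ∀ u ∈ annih s ε k, F u v = 0 := by
    intro u hu
    induction hu using Submodule.span_induction with
    | mem u h =>
      obtain ⟨n, x, hx, rfl⟩ := h
      have hP : P (Finsupp.single n x) = 0 := by
        change creationPart ε k _ = 0
        rw [creationPart_single]
        rcases hx with hx | ⟨hx, hx2⟩
        · rw [if_neg (by omega), if_neg (by omega), Finsupp.single_zero]
        · rw [if_neg (by omega), if_pos hx, hx2]
          exact Finsupp.single_zero n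
      rw [hF]
      simp [ρ, hP, han]
    | zero => simp
    | add a b _ _ ha hb => rw [map_add, LinearMap.add_apply, ha, hb, add_zero]
    | smul a b _ hb => rw [smul_eq_mul, map_mul, Module.End.mul_apply, hb, map_zero]
  intro h
  have h1 : (1 : ModeAlg s ε k) ∈ annih s ε k := (Submodule.Quotient.mk_eq_zero _).1 h
  have h2 := hkill 1 h1
  rw [map_one] at h2
  exact hv h2

-- The model is the exterior algebra of the space of modes: exterior multiplication creates,
-- contraction with the form annihilates.
open CliffordAlgebra in
theorem vac_fermi_ne_zero : vac .fermi ε k ≠ 0 := by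
  let E := ExteriorAlgebra ℂ (Modes k)
  refine vac_ne_zero_of_model .fermi ε k (V := E)
    ((LinearMap.mul ℂ E) ∘ₗ ExteriorAlgebra.ι ℂ)
    (contractLeft ∘ₗ modeForm .fermi ε k) 1 one_ne_zero ?_ ?_ ?_ ?_
  · intro x
    exact contractLeft_one _ _
  · intro x y
    refine LinearMap.ext fun w => ?_
    simp only [Module.End.mul_apply, LinearMap.comp_apply, LinearMap.mul_apply', Stat.sign,
      LinearMap.smul_apply, neg_one_smul, ← mul_assoc]
    rw [eq_neg_of_add_eq_zero_left (ExteriorAlgebra.ι_add_mul_swap (R := ℂ) x y), neg_mul]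
  · intro x y
    refine LinearMap.ext fun w => ?_
    simp only [Module.End.mul_apply, LinearMap.comp_apply, Stat.sign,
      LinearMap.smul_apply, neg_one_smul]
    exact contractLeft_comm _ _ _
  · intro x y
    refine LinearMap.ext fun w => ?_
    simp only [Module.End.mul_apply, LinearMap.comp_apply, LinearMap.mul_apply', Stat.sign,
      LinearMap.smul_apply, LinearMap.add_apply, neg_one_smul]
    refine (contractLeft_ι_mul _ _ _).trans ?_
    rw [sub_eq_neg_add]
    rfl

/-- The variables of the polynomial model of the bosonic module. -/
abbrev ModeVar (k : ℕ) : Type := ℤ × (Fin k ⊕ Fin k)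

/-- The linear polynomial of a mode. -/
def modePoly : Modes k →ₗ[ℂ] MvPolynomial (ModeVar k) ℂ :=
  Finsupp.lsum ℂ fun n : ℤ => LinearMap.coprod
    (Fintype.linearCombination ℂ fun i => MvPolynomial.X (n, Sum.inl i))
    (Fintype.linearCombination ℂ fun i => MvPolynomial.X (n, Sum.inr i))

/-- The coordinate vectors of the space of modes. -/
def modeVec (j : ModeVar k) : Modes k := Finsupp.single j.1 (Sum.elim plus minus j.2)

/-- The derivation given by a linear form on the space of modes. -/
def modeDer : (Modes k →ₗ[ℂ] ℂ) →ₗ[ℂ]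
    Derivation ℂ (MvPolynomial (ModeVar k) ℂ) (MvPolynomial (ModeVar k) ℂ) where
  toFun φ := MvPolynomial.mkDerivation ℂ fun j => MvPolynomial.C (φ (modeVec k j))
  map_add' φ ψ := MvPolynomial.derivation_ext fun j => by
    simp [MvPolynomial.mkDerivation_X]
  map_smul' z φ := MvPolynomial.derivation_ext fun j => by
    simp [MvPolynomial.mkDerivation_X, MvPolynomial.smul_eq_C_mul]

theorem pol_eq_sum {k : ℕ} (x : Pol k) :
    x = (∑ i, x.1 i • plus i) + ∑ i, x.2 i • minus i := by
  refine Prod.ext ?_ ?_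
  · funext j
    simp [plus, minus, Prod.fst_sum, Finset.sum_apply, Pi.single_apply]
  · funext j
    simp [plus, minus, Prod.snd_sum, Finset.sum_apply, Pi.single_apply]

theorem modeDer_modePoly (φ : Modes k →ₗ[ℂ] ℂ) (x : Modes k) :
    modeDer k φ (modePoly k x) = MvPolynomial.C (φ x) := by
  have h : (modeDer k φ).toLinearMap ∘ₗ modePoly k
      = (Algebra.linearMap ℂ (MvPolynomial (ModeVar k) ℂ)) ∘ₗ φ := by
    refine Finsupp.lhom_ext fun n x => ?_
    have hx : Finsupp.single n x = (∑ i, x.1 i • modeVec k (n, Sum.inl i))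
        + ∑ i, x.2 i • modeVec k (n, Sum.inr i) := by
      conv_lhs => rw [pol_eq_sum x]
      simp only [modeVec, Finsupp.smul_single, Sum.elim_inl, Sum.elim_inr, Finsupp.single_add,
        ← Finsupp.single_finsetSum]
    rw [LinearMap.comp_apply, LinearMap.comp_apply, modePoly, Finsupp.lsum_single, hx]
    simp only [LinearMap.coprod_apply, Fintype.linearCombination_apply, map_add, map_sum, map_smul,
      Derivation.coeFn_coe, modeDer, LinearMap.coe_mk, AddHom.coe_mk, MvPolynomial.mkDerivation_X,
      Algebra.linearMap_apply, MvPolynomial.algebraMap_eq]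
  exact LinearMap.congr_fun h x

/-- The model is a polynomial ring: multiplication by linear polynomials creates, derivations with
constant coefficients annihilate. These derivations commute because their commutator kills the
variables. -/
theorem vac_bose_ne_zero : vac .bose ε k ≠ 0 := by
  let E := MvPolynomial (ModeVar k) ℂ
  have hcomm : ∀ φ ψ : Modes k →ₗ[ℂ] ℂ, ⁅modeDer k φ, modeDer k ψ⁆ = 0 := by
    intro φ ψ
    refine MvPolynomial.derivation_ext fun j => ?_
    simp [Derivation.commutator_apply, modeDer, MvPolynomial.mkDerivation_X]
  refine vac_ne_zero_of_model .bose ε k (V := E)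
    ((LinearMap.mul ℂ E) ∘ₗ modePoly k)
    ({ toFun := fun D => D.toLinearMap
       map_add' := fun _ _ => rfl
       map_smul' := fun _ _ => rfl } ∘ₗ modeDer k ∘ₗ modeForm .bose ε k) 1 one_ne_zero ?_ ?_ ?_ ?_
  · intro x
    exact Derivation.map_one_eq_zero _
  · intro x y
    refine LinearMap.ext fun w => ?_
    simp only [Module.End.mul_apply, LinearMap.comp_apply, LinearMap.mul_apply', Stat.sign,
      one_smul]
    ring
  · intro x y
    refine LinearMap.ext fun w => ?_
    have h := congrArg (fun D => D w) (hcomm (modeForm .bose ε k x) (modeForm .bose ε k y))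
    simp only [Derivation.commutator_apply, Derivation.zero_apply, sub_eq_zero] at h
    simpa [Stat.sign] using h
  · intro x y
    refine LinearMap.ext fun w => ?_
    have h := modeDer_modePoly k (modeForm .bose ε k x) y
    simp only [Module.End.mul_apply, LinearMap.comp_apply, LinearMap.mul_apply', Stat.sign,
      LinearMap.add_apply, one_smul, LinearMap.coe_mk, AddHom.coe_mk,
      Derivation.coeFn_coe, Derivation.leibniz, h, smul_eq_mul, Module.algebraMap_end_apply]
    rw [mul_comm w, ← MvPolynomial.smul_eq_C_mul]

theorem vac_ne_zero : vac s ε k ≠ 0 := by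
  cases s
  exacts [vac_fermi_ne_zero ε k, vac_bose_ne_zero ε k]

end Model

/-! ## Modes on the induced modules -/

section FockModes

variable {s : Stat} {ε : Sector} {k : ℕ}

theorem mode_mk (n : ℤ) (x : Pol k) (u : ModeAlg s ε k) :
    mode s ε n x (Fock.mk s ε k u) = Fock.mk s ε k (ModeAlg.ι s ε k (Finsupp.single n x) * u) := by
  rw [← smul_eq_mul, map_smul]
  rfl

theorem fock_mk_surjective : Function.Surjective (Fock.mk s ε k) :=
  Submodule.mkQ_surjective (annih s ε k)

theorem fock_mk_smul (z : ℂ) (u : ModeAlg s ε k) :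
    Fock.mk s ε k (z • u) = z • Fock.mk s ε k u := rfl

theorem mode_mode (n m : ℤ) (x y : Pol k) (w : Fock s ε k) :
    mode s ε n x (mode s ε m y w) = s.sign • mode s ε m y (mode s ε n x w)
      + (if n + m + ε.shift = 0 then form s k x y else 0) • w := by
  obtain ⟨u, rfl⟩ := fock_mk_surjective w
  rw [mode_mk, mode_mk, mode_mk, mode_mk, ← mul_assoc, ι_comm, modeForm_single_single, add_mul,
    map_add, Algebra.algebraMap_eq_smul_one, smul_one_mul, smul_mul_assoc, mul_assoc,
    fock_mk_smul, fock_mk_smul]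

theorem mode_vac {n : ℤ} {x : Pol k}
    (h : 0 < 2 * n + ε.shift ∨ (2 * n + ε.shift = 0 ∧ x.2 = 0)) :
    mode s ε n x (vac s ε k) = 0 := by
  rw [vac, mode_mk, mul_one]
  exact (Submodule.Quotient.mk_eq_zero _).2 (Submodule.subset_span ⟨n, x, h, rfl⟩)

/-- The modes as a linear map. -/
def modeLin (s : Stat) (ε : Sector) (n : ℤ) : Pol k →ₗ[ℂ] Module.End ℂ (Fock s ε k) :=
  (Algebra.lsmul ℂ ℂ (Fock s ε k)).toLinearMap ∘ₗ ModeAlg.ι s ε k ∘ₗ Finsupp.lsingle n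

theorem modeLin_apply (n : ℤ) (x : Pol k) : modeLin s ε n x = mode s ε n x := rfl

theorem mode_smul (n : ℤ) (z : ℂ) (x : Pol k) (w : Fock s ε k) :
    mode s ε n (z • x) w = z • mode s ε n x w := by
  rw [← modeLin_apply, map_smul]
  rfl

/-- The induced module is generated by its vacuum; this supplies `gen` in `twOsc`. -/
theorem fock_induction (S : Submodule ℂ (Fock s ε k)) (hv : vac s ε k ∈ S)
    (hS : ∀ n x, ∀ w ∈ S, mode s ε n x w ∈ S) : S = ⊤ := by
  have hS' : ∀ (y : Modes k) (u : ModeAlg s ε k), Fock.mk s ε k u ∈ S →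
      Fock.mk s ε k (ModeAlg.ι s ε k y * u) ∈ S := by
    intro y u hu
    induction y using Finsupp.induction_linear with
    | zero => simp
    | add a b ha hb => rw [map_add, add_mul, map_add]; exact add_mem ha hb
    | single n x => rw [← mode_mk]; exact hS n x _ hu
  have H : ∀ (t : TensorAlgebra ℂ (Modes k)) (v : ModeAlg s ε k), Fock.mk s ε k v ∈ S →
      Fock.mk s ε k (ModeAlg.mk s ε k t * v) ∈ S := by
    intro t
    induction t using TensorAlgebra.induction with
    | algebraMap r =>
      intro v hv
      rw [AlgHom.commutes, Algebra.algebraMap_eq_smul_one, smul_one_mul, fock_mk_smul]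
      exact Submodule.smul_mem _ _ hv
    | ι y => exact fun v hv => hS' y v hv
    | mul a b ha hb =>
      intro v hv
      rw [map_mul (ModeAlg.mk s ε k), mul_assoc]
      exact ha _ (hb v hv)
    | add a b ha hb =>
      intro v hv
      rw [map_add (ModeAlg.mk s ε k), add_mul, map_add]
      exact add_mem (ha v hv) (hb v hv)
  refine top_unique fun w _ => ?_
  obtain ⟨u, rfl⟩ := fock_mk_surjective w
  obtain ⟨t, rfl⟩ := RingQuot.mkAlgHom_surjective ℂ (ModeRel s ε k) u
  have h := H t 1 hv
  rwa [mul_one] at h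

theorem fockAct_vac (g : GL (Fin k) ℂ) : fockAct s ε k g (vac s ε k) = vac s ε k := by
  change fockActLin s ε g (Fock.mk s ε k 1) = _
  rw [fockActLin_mk, map_one]
  rfl

theorem fockAct_mode (g : GL (Fin k) ℂ) (n : ℤ) (x : Pol k) (w : Fock s ε k) :
    fockAct s ε k g (mode s ε n x w) = mode s ε n (polAct g x) (fockAct s ε k g w) := by
  obtain ⟨u, rfl⟩ := fock_mk_surjective w
  change fockActLin s ε g _ = mode s ε n _ (fockActLin s ε g _)
  rw [mode_mk, fockActLin_mk, fockActLin_mk, mode_mk, map_mul, algAct_ι, modesAct_single]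

theorem form_minus_plus (i j : Fin k) : form s k (minus i) (plus j) = if i = j then 1 else 0 := by
  simp [form_apply, minus, plus, Pi.single_apply, eq_comm]

theorem form_plus_minus (i j : Fin k) :
    form s k (plus i) (minus j) = if i = j then -s.sign else 0 := by
  rw [form_symm (minus j), form_minus_plus]
  simp [eq_comm]

theorem form_plus_plus (i j : Fin k) : form s k (plus i) (plus j) = 0 := by
  simp [form_apply, plus]

theorem form_minus_minus (i j : Fin k) : form s k (minus i) (minus j) = 0 := by
  simp [form_apply, minus]

theorem form_left_injective {x y : Pol k} (h : ∀ z, form s k z x = form s k z y) : x = y := by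
  refine Prod.ext (funext fun i => ?_) (funext fun i => ?_)
  · simpa [form_apply, minus] using h (minus i)
  · simpa [form_apply, plus, s.sign_ne_zero] using h (plus i)

/-- The vectors `x(-1/2) v`, respectively `x(-1) v_tw`, determine `x`. -/
theorem mode_neg_one_vac_injective {x y : Pol k}
    (h : mode s ε (-1) x (vac s ε k) = mode s ε (-1) y (vac s ε k)) : x = y := by
  have hε : 0 ≤ ε.shift ∧ ε.shift ≤ 1 := by cases ε <;> simp [Sector.shift]
  refine form_left_injective (s := s) fun z => ?_
  -- The mode with number 1 − shift is the one that pairs with number −1. It returns the vacuum with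
  -- coefficient ⟨z, x⟩, and the form is non-degenerate.
  have key : ∀ x : Pol k, mode s ε (1 - ε.shift) z (mode s ε (-1) x (vac s ε k))
      = form s k z x • vac s ε k := fun x => by
    rw [mode_mode, mode_vac (Or.inl (by omega)), if_pos (by ring), map_zero, smul_zero, zero_add]
  have h' := congrArg (mode s ε (1 - ε.shift) z) h
  rw [key, key] at h'
  exact smul_left_injective ℂ (vac_ne_zero s ε k) h'

end FockModes

/-! ## The twisted module as a system of oscillators -/

/-- The creation operators on the twisted module: `inl (i, n)` stands for `a_i^+(-n-1)`, and
`inr (i, n)` for `a_i^-(-n)`. -/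
abbrev ModeIx (k : ℕ) : Type := (Fin k × ℕ) ⊕ (Fin k × ℕ)

section Twisted

variable (s : Stat) (k : ℕ)

/-- The creation operators. -/
def twCreate : ModeIx k → Module.End ℂ (Fock s .tw k)
  | .inl (i, n) => mode s .tw (-((n + 1 : ℕ) : ℤ)) (plus i)
  | .inr (i, n) => mode s .tw (-(n : ℤ)) (minus i)

/-- The dual annihilation operators. -/
def twAnnihilate : ModeIx k → Module.End ℂ (Fock s .tw k)
  | .inl (i, n) => mode s .tw ((n + 1 : ℕ) : ℤ) (minus i)
  | .inr (i, n) => -s.sign • mode s .tw (n : ℤ) (plus i)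

variable {s k}

/-- No two creation operators have a contraction: those of equal charge lie in an isotropic space,
and a^+(−n−1), a^-(−m) have negative total degree. -/
theorem twCreate_comm (i j : ModeIx k) (w : Fock s .tw k) :
    twCreate s k i (twCreate s k j w) = s.sign • twCreate s k j (twCreate s k i w) := by
  rcases i with ⟨i, n⟩ | ⟨i, n⟩ <;> rcases j with ⟨j, m⟩ | ⟨j, m⟩
  · simp only [twCreate, mode_mode (-((n + 1 : ℕ) : ℤ)), form_plus_plus]
    simp
  · simp only [twCreate, mode_mode (-((n + 1 : ℕ) : ℤ))]
    rw [if_neg (by simp only [Sector.shift]; omega), zero_smul, add_zero]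
  · simp only [twCreate, mode_mode (-(n : ℤ)) (-((m + 1 : ℕ) : ℤ))]
    rw [if_neg (by simp only [Sector.shift]; omega), zero_smul, add_zero]
  · simp only [twCreate, mode_mode (-(n : ℤ)) (-(m : ℤ)), form_minus_minus]
    simp

/-- The factor −s in `twAnnihilate` compensates ⟨a_i^+, a_i^-⟩ = −s, so that both kinds of modes
obey the same normalized relation. -/
theorem twAnnihilate_create (i j : ModeIx k) (w : Fock s .tw k) :
    twAnnihilate s k i (twCreate s k j w)
      = s.sign • twCreate s k j (twAnnihilate s k i w) + if i = j then w else 0 := by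
  rcases i with ⟨i, n⟩ | ⟨i, n⟩ <;> rcases j with ⟨j, m⟩ | ⟨j, m⟩
  · simp only [twCreate, twAnnihilate, mode_mode ((n + 1 : ℕ) : ℤ), form_minus_plus,
      Sum.inl.injEq, Prod.mk.injEq]
    by_cases h1 : i = j
    · by_cases h2 : n = m
      · rw [if_pos (by simp only [Sector.shift]; omega), if_pos h1, if_pos ⟨h1, h2⟩, one_smul]
      · rw [if_neg (by simp only [Sector.shift]; omega), if_neg (by tauto), zero_smul]
    · simp [h1]
  · simp only [twCreate, twAnnihilate, mode_mode ((n + 1 : ℕ) : ℤ), form_minus_minus]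
    simp
  · simp only [twCreate, twAnnihilate, LinearMap.smul_apply, mode_mode (n : ℤ), form_plus_plus]
    simp [smul_smul]
  · simp only [twCreate, twAnnihilate, LinearMap.smul_apply, mode_mode (n : ℤ), form_plus_minus,
      Sum.inr.injEq, Prod.mk.injEq, smul_add, map_smul, smul_smul, mul_comm]
    congr 1
    by_cases h1 : i = j
    · by_cases h2 : n = m
      · rw [if_pos (by simp only [Sector.shift]; omega), if_pos h1, if_pos ⟨h1, h2⟩, neg_mul_neg,
          s.sign_mul_self, one_smul]
      · rw [if_neg (by simp only [Sector.shift]; omega), if_neg (by tauto), mul_zero, zero_smul]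
    · simp [h1]

/-- The boundary case n = 0 separates this from `mode_minus_eq`: a^+(0) annihilates whereas a^-(0)
creates. -/
theorem mode_plus_eq (i : Fin k) (n : ℤ) : (∃ j, mode s .tw n (plus i) = twCreate s k j) ∨
    ∃ (z : ℂ) (j : _), mode s .tw n (plus i) = z • twAnnihilate s k j := by
  rcases lt_or_ge n 0 with h | h
  · refine Or.inl ⟨.inl (i, (-n - 1).toNat), ?_⟩
    rw [twCreate]
    congr 1
    omega
  · refine Or.inr ⟨-s.sign, .inr (i, n.toNat), ?_⟩
    rw [twAnnihilate, smul_smul, neg_mul_neg, s.sign_mul_self, one_smul, Int.toNat_of_nonneg h]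

theorem mode_minus_eq (i : Fin k) (n : ℤ) : (∃ j, mode s .tw n (minus i) = twCreate s k j) ∨
    ∃ j, mode s .tw n (minus i) = twAnnihilate s k j := by
  rcases le_or_gt n 0 with h | h
  · refine Or.inl ⟨.inr (i, (-n).toNat), ?_⟩
    rw [twCreate]
    congr 1
    omega
  · refine Or.inr ⟨.inl (i, (n - 1).toNat), ?_⟩
    rw [twAnnihilate]
    congr 1
    omega

theorem mode_eq_sum (ε : Sector) (n : ℤ) (x : Pol k) : mode s ε n x
    = (∑ i, x.1 i • mode s ε n (plus i)) + ∑ i, x.2 i • mode s ε n (minus i) := by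
  conv_lhs => rw [pol_eq_sum x]
  simp only [← modeLin_apply, map_add, map_sum, map_smul]

variable (s k) in
/-- The twisted module as a system of oscillators. -/
def twOsc : Oscillators s (ModeIx k) (Fock s .tw k) where
  c := twCreate s k
  a := twAnnihilate s k
  v := vac s .tw k
  c_comm := twCreate_comm
  a_c := twAnnihilate_create
  a_vac := by
    rintro (⟨i, n⟩ | ⟨i, n⟩)
    · exact mode_vac (Or.inl (by simp only [Sector.shift]; omega))
    · rw [twAnnihilate, LinearMap.smul_apply, mode_vac, smul_zero]
      rcases Nat.eq_zero_or_pos n with h | h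
      · exact Or.inr ⟨by simp [h, Sector.shift], rfl⟩
      · exact Or.inl (by simp only [Sector.shift]; omega)
  vac_ne := vac_ne_zero s .tw k
  gen S hv hc ha := by
    refine fock_induction S hv fun n x w hw => ?_
    rw [mode_eq_sum, LinearMap.add_apply, LinearMap.sum_apply, LinearMap.sum_apply]
    refine add_mem (sum_mem fun i _ => ?_) (sum_mem fun i _ => ?_)
    · refine Submodule.smul_mem _ _ ?_
      obtain ⟨j, h⟩ | ⟨z, j, h⟩ := mode_plus_eq (s := s) i n
      · rw [h]; exact hc j w hw
      · rw [h]; exact Submodule.smul_mem _ _ (ha j w hw)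
    · refine Submodule.smul_mem _ _ ?_
      obtain ⟨j, h⟩ | ⟨j, h⟩ := mode_minus_eq (s := s) i n
      · rw [h]; exact hc j w hw
      · rw [h]; exact ha j w hw

end Twisted

/-! ## The zero modes and the group on monomials -/

/-- The eigenvalue of `J(0)` under which a creation operator has weight one. -/
def charge {k : ℕ} : ModeIx k → ℤ
  | .inl _ => 1
  | .inr _ => -1

/-- The energy of a creation operator. -/
def energy {k : ℕ} : ModeIx k → ℕ
  | .inl (_, n) => n + 1
  | .inr (_, n) => n

/-- The eigenvalue of a creation operator under a diagonal matrix. -/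
def diagWeight {k : ℕ} (d : Fin k → ℂˣ) : ModeIx k → ℂˣ
  | .inl (i, _) => d i
  | .inr (i, _) => (d i)⁻¹

/-- The diagonal matrix with given invertible entries. -/
def diagGL {k : ℕ} (d : Fin k → ℂˣ) : GL (Fin k) ℂ where
  val := Matrix.diagonal fun i => (d i : ℂ)
  inv := Matrix.diagonal fun i => ((d i)⁻¹ : ℂˣ)
  val_inv := by simp [Matrix.diagonal_mul_diagonal]
  inv_val := by simp [Matrix.diagonal_mul_diagonal]

/-- Converts a sum of number operator eigenvalues over all modes into a sum over the factors of a
monomial: each factor contributes once, at its own position `pos`. It serves both `J0` and `L0`. -/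
theorem sum_finsum_list {κ : Type*} {k : ℕ} (F : Fin k → ℕ → List κ → ℂ) (wt : κ → ℂ)
    (pos : κ → Fin k × ℕ) (h0 : ∀ i n, F i n [] = 0)
    (hc : ∀ i n j l, F i n (j :: l) = F i n l + if pos j = (i, n) then wt j else 0) (l : List κ) :
    (∀ i, (Function.support fun n => F i n l).Finite) ∧
      ∑ i, ∑ᶠ n, F i n l = (l.map wt).sum := by
  induction l with
  | nil => simp [h0]
  | cons j l ih =>
    have hf : ∀ i, (Function.support fun n => if pos j = (i, n) then wt j else 0).Finite := by
      intro i
      refine (Set.finite_singleton (pos j).2).subset fun n hn => ?_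
      by_contra h
      refine hn (if_neg fun h' => h ?_)
      rw [h']
      rfl
    have hs : ∀ i, ∑ᶠ n, (if pos j = (i, n) then wt j else 0)
        = if (pos j).1 = i then wt j else 0 := by
      intro i
      rw [finsum_eq_single _ (pos j).2]
      · by_cases h : (pos j).1 = i
        · rw [if_pos h, if_pos (by rw [← h])]
        · rw [if_neg h, if_neg (fun h' => h (by rw [h']))]
      · intro n hn
        exact if_neg fun h' => hn (by rw [h'])
    refine ⟨fun i => ?_, ?_⟩
    · simp only [hc]
      exact ((ih.1 i).union (hf i)).subset (Function.support_add _ _)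
    · simp only [hc, List.map_cons, List.sum_cons]
      rw [← ih.2, add_comm (wt j)]
      simp only [finsum_add_distrib (ih.1 _) (hf _), Finset.sum_add_distrib, hs]
      simp

section ZeroModes

variable {s : Stat} {k : ℕ}

theorem twOsc_num_inl (i : Fin k) (n : ℕ) (w : Fock s .tw k) : (twOsc s k).num (.inl (i, n)) w
    = mode s .tw (-((n + 1 : ℕ) : ℤ)) (plus i) (mode s .tw ((n + 1 : ℕ) : ℤ) (minus i) w) := rfl

theorem twOsc_num_inr (i : Fin k) (n : ℕ) (w : Fock s .tw k) : (twOsc s k).num (.inr (i, n)) w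
    = -(s.sign • mode s .tw (-(n : ℤ)) (minus i) (mode s .tw (n : ℤ) (plus i) w)) := by
  change twCreate s k (.inr (i, n)) (twAnnihilate s k (.inr (i, n)) w) = _
  rw [twAnnihilate, LinearMap.smul_apply, map_smul, neg_smul]
  rfl

/-- The summand s a_i^-(−n) a_i^+(n) is minus a number operator, so J(0) is its constant plus the
number of a^+ factors minus the number of a^- factors. -/
theorem J0_mon (l : List (ModeIx k)) : J0 s k ((twOsc s k).mon l)
    = (-s.sign * k / 2 + ((l.map charge).sum : ℤ)) • (twOsc s k).mon l := by
  obtain ⟨hf, hs⟩ := sum_finsum_list (k := k)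
    (fun i n l => ((l : Multiset (ModeIx k)).count (.inl (i, n)) : ℂ)
      - (l : Multiset (ModeIx k)).count (.inr (i, n)))
    (fun j : ModeIx k => (charge j : ℂ)) (Sum.elim id id) (by simp) (by
      intro i n j l
      rw [← Multiset.cons_coe, Multiset.count_cons, Multiset.count_cons]
      rcases j with j | j
      · by_cases h : j = (i, n)
        · simp [charge, h]; ring
        · simp [h, Ne.symm h]
      · by_cases h : j = (i, n)
        · simp [charge, h]; ring
        · simp [h, Ne.symm h]) l
  rw [J0, LinearMap.add_apply, Module.algebraMap_end_apply, LinearMap.sum_apply, add_smul]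
  congr 1
  have hs' : (((l.map charge).sum : ℤ) : ℂ) = (l.map fun j => (charge j : ℂ)).sum := by
    rw [Int.cast_list_sum, List.map_map]
    rfl
  rw [hs', ← hs, Finset.sum_smul]
  refine Finset.sum_congr rfl fun i _ => ?_
  rw [finsum_smul]
  refine finsum_congr fun n => ?_
  have h1 := (twOsc s k).num_mon_multiset (.inl (i, n)) l
  have h2 := (twOsc s k).num_mon_multiset (.inr (i, n)) l
  rw [twOsc_num_inl] at h1
  rw [twOsc_num_inr, neg_eq_iff_eq_neg] at h2
  rw [LinearMap.add_apply, LinearMap.smul_apply, Module.End.mul_apply, Module.End.mul_apply, h1, h2,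
    sub_smul, neg_add_eq_sub]

theorem L0_mon (l : List (ModeIx k)) : L0 s k ((twOsc s k).mon l)
    = (-s.sign * k / 8 + ((l.map energy).sum : ℕ)) • (twOsc s k).mon l := by
  obtain ⟨hf, hs⟩ := sum_finsum_list (k := k)
    -- The operator a_i^+(−n) has index (i, n − 1). At n = 0 the truncated subtraction is harmless
    -- because of the factor n.
    (fun i n l => (n : ℂ) * ((l : Multiset (ModeIx k)).count (.inl (i, n - 1))
      + (l : Multiset (ModeIx k)).count (.inr (i, n))))
    (fun j : ModeIx k => (energy j : ℂ)) (Sum.elim (fun p => (p.1, p.2 + 1)) id) (by simp) (by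
      intro i n j l
      rw [← Multiset.cons_coe, Multiset.count_cons, Multiset.count_cons]
      rcases j with ⟨i', n'⟩ | j
      · rcases n with _ | n
        · simp
        · by_cases h : (i', n') = (i, n)
          · obtain ⟨rfl, rfl⟩ := Prod.mk.inj h
            simp [energy]; ring
          · simp [Ne.symm h, energy]
            rintro rfl rfl
            exact absurd rfl h
      · by_cases h : j = (i, n)
        · simp [h, energy]; ring
        · simp [h, Ne.symm h]) l
  rw [L0, LinearMap.add_apply, Module.algebraMap_end_apply, LinearMap.sum_apply, add_smul]
  congr 1
  have hs' : (((l.map energy).sum : ℕ) : ℂ) = (l.map fun j => (energy j : ℂ)).sum := by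
    rw [Nat.cast_list_sum, List.map_map]
    rfl
  rw [hs', ← hs, Finset.sum_smul]
  refine Finset.sum_congr rfl fun i _ => ?_
  rw [finsum_smul]
  refine finsum_congr fun n => ?_
  rw [LinearMap.smul_apply, mul_smul]
  rcases n with _ | n
  · simp
  congr 1
  have h1 := (twOsc s k).num_mon_multiset (.inl (i, n)) l
  have h2 := (twOsc s k).num_mon_multiset (.inr (i, n + 1)) l
  rw [twOsc_num_inl] at h1
  rw [twOsc_num_inr, neg_eq_iff_eq_neg] at h2
  rw [LinearMap.sub_apply, LinearMap.smul_apply, Module.End.mul_apply, Module.End.mul_apply, h1, h2,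
    add_smul, sub_neg_eq_add]
  rfl

theorem polAct_plus (g : GL (Fin k) ℂ) (i : Fin k) :
    polAct g (plus i) = ∑ j, (g : Matrix (Fin k) (Fin k) ℂ) j i • plus j := by
  rw [pol_eq_sum (polAct g (plus i))]
  simp [polAct, plus]

theorem polAct_minus (g : GL (Fin k) ℂ) (i : Fin k) : polAct g (minus i)
    = ∑ j, ((g⁻¹ : GL (Fin k) ℂ) : Matrix (Fin k) (Fin k) ℂ) i j • minus j := by
  rw [pol_eq_sum (polAct g (minus i))]
  simp [polAct, minus]

/-- An element of `GL(𝔞⁺)` maps a creation operator to a combination of creation operators of the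
same charge and energy. -/
theorem fockAct_create (g : GL (Fin k) ℂ) (j : ModeIx k) : ∃ (z : Fin k → ℂ) (j' : Fin k → ModeIx k),
    (∀ i, charge (j' i) = charge j ∧ energy (j' i) = energy j) ∧
    ∀ w, fockAct s .tw k g ((twOsc s k).c j w)
      = ∑ i, z i • (twOsc s k).c (j' i) (fockAct s .tw k g w) := by
  rcases j with ⟨i, n⟩ | ⟨i, n⟩
  · refine ⟨fun i' => (g : Matrix (Fin k) (Fin k) ℂ) i' i, fun i' => .inl (i', n),
      fun _ => ⟨rfl, rfl⟩, fun w => ?_⟩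
    change fockAct s .tw k g (mode s .tw _ (plus i) w) = _
    rw [fockAct_mode, polAct_plus, ← modeLin_apply, map_sum, LinearMap.sum_apply]
    simp only [map_smul, LinearMap.smul_apply]
    rfl
  · refine ⟨fun i' => ((g⁻¹ : GL (Fin k) ℂ) : Matrix (Fin k) (Fin k) ℂ) i i',
      fun i' => .inr (i', n), fun _ => ⟨rfl, rfl⟩, fun w => ?_⟩
    change fockAct s .tw k g (mode s .tw _ (minus i) w) = _
    rw [fockAct_mode, polAct_minus, ← modeLin_apply, map_sum, LinearMap.sum_apply]
    simp only [map_smul, LinearMap.smul_apply]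
    rfl

/-- An operator that acts on monomials by a weight that depends only on charge and energy commutes
with `GL(𝔞⁺)`. -/
theorem fockAct_commute_of_weight (T : Module.End ℂ (Fock s .tw k)) (z₀ : ℂ) (f : ModeIx k → ℂ)
    (hT : ∀ l, T ((twOsc s k).mon l) = (z₀ + (l.map f).sum) • (twOsc s k).mon l)
    (hf : ∀ j j' : ModeIx k, charge j' = charge j → energy j' = energy j → f j' = f j)
    (g : GL (Fin k) ℂ) : Commute T (fockAct s .tw k g) := by
  -- On monomials the hypothesis says [T, c_j] = f_j c_j. Since g mixes only creation operators with
  -- equal f, commutation follows by induction on the length.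
  have hc : ∀ j w, T ((twOsc s k).c j w)
      = (twOsc s k).c j (T w) + f j • (twOsc s k).c j w := by
    intro j
    refine LinearMap.congr_fun (f := T ∘ₗ (twOsc s k).c j)
      (g := (twOsc s k).c j ∘ₗ T + f j • (twOsc s k).c j) ((twOsc s k).hom_ext fun l => ?_)
    have h := hT (j :: l)
    rw [Oscillators.mon_cons, List.map_cons, List.sum_cons] at h
    rw [LinearMap.comp_apply, h, LinearMap.add_apply, LinearMap.comp_apply, hT, map_smul,
      LinearMap.smul_apply, ← add_smul]
    congr 1
    ring
  refine (twOsc s k).hom_ext fun l => ?_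
  rw [Module.End.mul_apply, Module.End.mul_apply, hT, map_smul]
  induction l with
  | nil =>
    have h := hT []
    rw [Oscillators.mon_nil] at h ⊢
    have hv : fockAct s .tw k g (twOsc s k).v = (twOsc s k).v := fockAct_vac g
    rw [hv, h]
  | cons j l ih =>
    obtain ⟨z, j', hj, h⟩ := fockAct_create (s := s) g j
    rw [Oscillators.mon_cons, h, map_sum, Finset.smul_sum]
    refine Finset.sum_congr rfl fun i _ => ?_
    rw [map_smul, hc, ih, hf j (j' i) (hj i).1 (hj i).2, List.map_cons, List.sum_cons, map_smul]
    module

theorem J0_commute (g : GL (Fin k) ℂ) : Commute (J0 s k) (fockAct s .tw k g) :=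
  fockAct_commute_of_weight _ (-s.sign * k / 2) (fun j => (charge j : ℂ)) (fun l => by
    rw [J0_mon, Int.cast_list_sum, List.map_map]; rfl)
    (fun j j' h _ => by rw [h]) g

theorem L0_commute (g : GL (Fin k) ℂ) : Commute (L0 s k) (fockAct s .tw k g) :=
  fockAct_commute_of_weight _ (-s.sign * k / 8) (fun j => (energy j : ℂ)) (fun l => by
    rw [L0_mon, Nat.cast_list_sum, List.map_map]; rfl)
    (fun j j' _ h => by rw [h]) g

theorem fockAct_diag_mon (d : Fin k → ℂˣ) (l : List (ModeIx k)) :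
    fockAct s .tw k (diagGL d) ((twOsc s k).mon l)
      = (((l.map (diagWeight d)).prod : ℂˣ) : ℂ) • (twOsc s k).mon l := by
  induction l with
  | nil => exact (fockAct_vac (s := s) (ε := .tw) (diagGL d)).trans (one_smul _ _).symm
  | cons j l ih =>
    have hp : ∀ i, polAct (diagGL d) (plus i) = (d i : ℂ) • plus i := by
      intro i
      rw [polAct_plus, Finset.sum_eq_single i]
      · simp [diagGL]
      · intro j _ hj
        simp [diagGL, Matrix.diagonal_apply_ne _ hj]
      · simp
    have hm : ∀ i, polAct (diagGL d) (minus i) = (((d i)⁻¹ : ℂˣ) : ℂ) • minus i := by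
      intro i
      rw [polAct_minus, Finset.sum_eq_single i]
      · simp [diagGL]
      · intro j _ hj
        simp [diagGL, Matrix.diagonal_apply_ne' _ hj]
      · simp
    rw [Oscillators.mon_cons, List.map_cons, List.prod_cons, Units.val_mul, mul_smul]
    rcases j with ⟨i, n⟩ | ⟨i, n⟩
    · change fockAct s .tw k _ (mode s .tw _ (plus i) _) = _
      rw [fockAct_mode, ih, hp, map_smul, mode_smul, smul_comm]
      rfl
    · change fockAct s .tw k _ (mode s .tw _ (minus i) _) = _
      rw [fockAct_mode, ih, hm, map_smul, mode_smul, smul_comm]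
      rfl

theorem basis_J0 (m : {m : Multiset (ModeIx k) // s.Occ m}) : J0 s k ((twOsc s k).basis m)
    = (-s.sign * k / 2 + ((m.1.map charge).sum : ℤ)) • (twOsc s k).basis m := by
  rw [Oscillators.basis_apply, J0_mon, ← Multiset.sum_coe, ← Multiset.map_coe, Multiset.coe_toList]

theorem basis_L0 (m : {m : Multiset (ModeIx k) // s.Occ m}) : L0 s k ((twOsc s k).basis m)
    = (-s.sign * k / 8 + ((m.1.map energy).sum : ℕ)) • (twOsc s k).basis m := by
  rw [Oscillators.basis_apply, L0_mon, ← Multiset.sum_coe, ← Multiset.map_coe, Multiset.coe_toList]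

theorem basis_diag (d : Fin k → ℂˣ) (m : {m : Multiset (ModeIx k) // s.Occ m}) :
    fockAct s .tw k (diagGL d) ((twOsc s k).basis m)
      = (((m.1.map (diagWeight d)).prod : ℂˣ) : ℂ) • (twOsc s k).basis m := by
  rw [Oscillators.basis_apply, fockAct_diag_mon, ← Multiset.prod_coe, ← Multiset.map_coe,
    Multiset.coe_toList]

theorem diagGL_neg_one : diagGL (fun _ : Fin k => (-1 : ℂˣ)) = -1 := by
  ext i j
  by_cases h : i = j <;> simp [diagGL, h]

end ZeroModes

/-! ## Spaces graded by the weights of a basis -/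

section WeightBasis

variable {I V P : Type*} [AddCommGroup V] [Module ℂ V] (b : Module.Basis I ℂ V)

theorem repr_of_diagonal {T : Module.End ℂ V} {f : I → ℂ} (hT : ∀ i, T (b i) = f i • b i)
    (w : V) (i : I) : b.repr (T w) i = f i * b.repr w i := by
  have h : (Finsupp.lapply i ∘ₗ b.repr.toLinearMap) ∘ₗ T
      = f i • (Finsupp.lapply i ∘ₗ b.repr.toLinearMap) := by
    refine b.ext fun j => ?_
    by_cases h : j = i
    · simp [hT, h]
    · simp [hT, h]
  exact LinearMap.congr_fun h w

/-- The span of the basis vectors of weight `p`. -/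
def weightSpace (wt : I → P) (p : P) : Submodule ℂ V :=
  (Finsupp.supported ℂ ℂ {i | wt i = p}).comap b.repr.toLinearMap

theorem mem_weightSpace {wt : I → P} {p : P} {w : V} :
    w ∈ weightSpace b wt p ↔ ∀ i, b.repr w i ≠ 0 → wt i = p := by
  change b.repr w ∈ Finsupp.supported ℂ ℂ _ ↔ _
  rw [Finsupp.mem_supported]
  simp [Set.subset_def]

theorem weightSpace_isInternal [DecidableEq P] (wt : I → P) :
    DirectSum.IsInternal (weightSpace b wt) := by
  rw [DirectSum.isInternal_submodule_iff_iSupIndep_and_iSup_eq_top]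
  have hsup : ∀ S : Set P, ⨆ p ∈ S, weightSpace b wt p
      ≤ (Finsupp.supported ℂ ℂ {i | wt i ∈ S}).comap b.repr.toLinearMap := by
    intro S
    refine iSup₂_le fun p hp => Submodule.comap_mono (Finsupp.supported_mono fun i hi => ?_)
    rw [Set.mem_ofPred_eq] at hi ⊢
    rwa [hi]
  constructor
  · intro p
    rw [Submodule.disjoint_def]
    intro w hw hw'
    have h2 := hsup {j | j ≠ p} hw'
    rw [Submodule.mem_comap, Finsupp.mem_supported] at h2
    refine b.repr.map_eq_zero_iff.1 (Finsupp.ext fun i => ?_)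
    by_contra hi
    exact h2 (Finsupp.mem_support_iff.2 hi) ((mem_weightSpace b).1 hw i hi)
  · classical
    refine top_unique ?_
    rw [← b.span_eq, Submodule.span_le]
    rintro _ ⟨i, rfl⟩
    refine Submodule.mem_iSup_of_mem (wt i) ((mem_weightSpace b).2 fun j hj => ?_)
    by_contra h
    refine hj ?_
    rw [b.repr_self, Finsupp.single_apply, if_neg]
    rintro rfl
    exact h rfl

/-- The basis of a weight space. -/
def weightBasis (wt : I → P) (p : P) : Module.Basis {i // wt i = p} ℂ (weightSpace b wt p) :=
  .ofRepr ((b.repr.submoduleMap _).trans ((LinearEquiv.ofEq _ _ (by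
      rw [weightSpace, Submodule.map_comap_eq_of_surjective b.repr.surjective])).trans
    (Finsupp.supportedEquivFinsupp {i | wt i = p})))

theorem weightBasis_apply (wt : I → P) (p : P) (i : {i // wt i = p}) :
    (weightBasis b wt p i : V) = b i := by
  classical
  refine b.repr.injective ?_
  rw [b.repr_self]
  have key : ∀ w : weightSpace b wt p, ∀ j : {i // wt i = p},
      (weightBasis b wt p).repr w j = b.repr (w : V) j := fun w j => rfl
  ext j
  by_cases hj : wt j = p
  · rw [← key _ ⟨j, hj⟩, (weightBasis b wt p).repr_self]
    rw [Finsupp.single_apply, Finsupp.single_apply]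
    simp only [Subtype.ext_iff]
  · rw [Finsupp.single_apply, if_neg (fun h => hj (by rw [← h]; exact i.2))]
    by_contra h0
    exact hj ((mem_weightSpace b).1 (weightBasis b wt p i).2 j h0)

theorem mapsTo_weightSpace {T : Module.End ℂ V} {f : I → ℂ} (hT : ∀ i, T (b i) = f i • b i)
    (wt : I → P) (p : P) : ∀ w ∈ weightSpace b wt p, T w ∈ weightSpace b wt p := by
  intro w hw
  rw [mem_weightSpace] at hw ⊢
  intro i hi
  rw [repr_of_diagonal b hT] at hi
  exact hw i (right_ne_zero_of_mul hi)

theorem traceOn_weightSpace {T : Module.End ℂ V} {f : I → ℂ} (hT : ∀ i, T (b i) = f i • b i)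
    (wt : I → P) (p : P) [Fintype {i // wt i = p}] :
    traceOn T (weightSpace b wt p) = ∑ i : {i // wt i = p}, f i := by
  classical
  have h := mapsTo_weightSpace b hT wt p
  rw [traceOn, dif_pos h, LinearMap.trace_eq_matrix_trace ℂ (weightBasis b wt p), Matrix.trace]
  refine Finset.sum_congr rfl fun i _ => ?_
  have h1 : T.restrict h (weightBasis b wt p i) = f i • weightBasis b wt p i := by
    refine Subtype.ext ?_
    rw [LinearMap.restrict_apply, Submodule.coe_smul]
    simp only [weightBasis_apply, hT]
  rw [Matrix.diag_apply, LinearMap.toMatrix_apply, h1]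
  simp

theorem eigenspace_inf_eq_weightSpace {T T' : Module.End ℂ V} {f : I → ℤ} {f' : I → ℕ}
    (hT : ∀ i, T (b i) = (f i : ℂ) • b i) (hT' : ∀ i, T' (b i) = (f' i : ℂ) • b i) (p : ℤ × ℕ) :
    T.eigenspace (p.1 : ℂ) ⊓ T'.eigenspace (p.2 : ℂ) = weightSpace b (fun i => (f i, f' i)) p := by
  ext w
  rw [Submodule.mem_inf, Module.End.mem_eigenspace_iff, Module.End.mem_eigenspace_iff,
    mem_weightSpace, ← b.repr.injective.eq_iff, ← b.repr.injective.eq_iff, Finsupp.ext_iff,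
    Finsupp.ext_iff]
  simp only [repr_of_diagonal b hT, repr_of_diagonal b hT', map_smul, Finsupp.smul_apply,
    smul_eq_mul, mul_eq_mul_right_iff, Int.cast_inj, Nat.cast_inj, ← forall_and]
  refine forall_congr' fun i => ?_
  rw [Prod.ext_iff]
  tauto

end WeightBasis

/-! ## The basis of the twisted module `W_tw` -/

theorem diagGL_inv {k : ℕ} (d : Fin k → ℂˣ) : (diagGL d)⁻¹ = diagGL d⁻¹ := by
  refine inv_eq_of_mul_eq_one_right (Units.ext ?_)
  simp [diagGL, Matrix.diagonal_mul_diagonal]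

/-- The basis of monomials of `A(𝔞)_tw`, moved by an element of `GL(𝔞⁺)`. -/
def fockBasis (s : Stat) {k : ℕ} (h : GL (Fin k) ℂ) :
    Module.Basis {m : Multiset (ModeIx k) // s.Occ m} ℂ (Fock s .tw k) :=
  (twOsc s k).basis.map (LinearEquiv.ofLinearMap (fockAct s .tw k h) (fockAct s .tw k h⁻¹)
    (by rw [← Module.End.mul_eq_comp, ← map_mul, mul_inv_cancel, map_one]; rfl)
    (by rw [← Module.End.mul_eq_comp, ← map_mul, inv_mul_cancel, map_one]; rfl))

section FockBasis

variable {s : Stat} {k : ℕ} (h : GL (Fin k) ℂ) (m : {m : Multiset (ModeIx k) // s.Occ m})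

theorem fockBasis_apply : fockBasis s h m = fockAct s .tw k h ((twOsc s k).basis m) := rfl

theorem fockBasis_J0 : J0 s k (fockBasis s h m)
    = (-s.sign * k / 2 + ((m.1.map charge).sum : ℤ)) • fockBasis s h m := by
  rw [fockBasis_apply, ← Module.End.mul_apply, (J0_commute h).eq, Module.End.mul_apply, basis_J0,
    map_smul]

theorem fockBasis_L0 : L0 s k (fockBasis s h m)
    = (-s.sign * k / 8 + ((m.1.map energy).sum : ℕ)) • fockBasis s h m := by
  rw [fockBasis_apply, ← Module.End.mul_apply, (L0_commute h).eq, Module.End.mul_apply, basis_L0,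
    map_smul]

/-- Translating the monomials by h makes a conjugate of a diagonal matrix act diagonally. As h
commutes with J(0) and L(0), their eigenvalues are not affected. -/
theorem fockBasis_diag (d : Fin k → ℂˣ) : fockAct s .tw k (h * diagGL d * h⁻¹) (fockBasis s h m)
    = (((m.1.map (diagWeight d)).prod : ℂˣ) : ℂ) • fockBasis s h m := by
  rw [fockBasis_apply, ← Module.End.mul_apply, ← map_mul, inv_mul_cancel_right, map_mul,
    Module.End.mul_apply, basis_diag, map_smul]

theorem fockBasis_one_diag (d : Fin k → ℂˣ) : fockAct s .tw k (diagGL d) (fockBasis s 1 m)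
    = (((m.1.map (diagWeight d)).prod : ℂˣ) : ℂ) • fockBasis s 1 m := by
  simpa using fockBasis_diag 1 m d

theorem fockBasis_one_neg_one : fockAct s .tw k (-1) (fockBasis s 1 m)
    = ((-1 : ℂ) ^ Multiset.card m.1) • fockBasis s 1 m := by
  rw [← diagGL_neg_one, fockBasis_one_diag]
  have hc : diagWeight (fun _ : Fin k => (-1 : ℂˣ)) = fun _ => -1 := by
    funext j
    rcases j with ⟨i, n⟩ | ⟨i, n⟩ <;> simp [diagWeight]
  rw [hc, Multiset.map_const', Multiset.prod_replicate]
  simp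

end FockBasis

/-- The index set of the basis of a free field module. -/
abbrev OccIx (s : Stat) (k : ℕ) : Type := {m : Multiset (ModeIx k) // s.Occ m}

/-- The index set of the basis of `W_tw`. -/
abbrev WIx : Type := (OccIx .fermi 1 × OccIx .fermi 1) × OccIx .bose 2

/-- The eigenvalue of `J(0)` on a monomial of `W_tw`. -/
def WIx.J (i : WIx) : ℤ := 1 + 4 * (i.1.2.1.map charge).sum + (i.2.1.map charge).sum

/-- The eigenvalue of `L(0)` on a monomial of `W_tw`. -/
def WIx.L (i : WIx) : ℕ :=
  (i.1.1.1.map energy).sum + (i.1.2.1.map energy).sum + (i.2.1.map energy).sum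

/-- The eigenvalue of the twining operator on a monomial of `W_tw`. -/
def WIx.twine (i : WIx) (c : Fin 1 → ℂˣ) (d : Fin 2 → ℂˣ) : ℂ :=
  (1 / 2 + ((i.1.1.1.map charge).sum : ℤ)) * (-1) ^ Multiset.card i.1.1.1 *
    ((-1) ^ Multiset.card i.1.2.1 * ((i.1.2.1.map (diagWeight c)).prod : ℂˣ)) *
    ((i.2.1.map (diagWeight d)).prod : ℂˣ)

/-- A basis of `W_tw` that consists of eigenvectors of `J(0)` and `L(0)`. -/
def wBasis (h : GL (Fin 2) ℂ) : Module.Basis WIx ℂ (W .tw) :=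
  ((fockBasis .fermi 1).tensorProduct (fockBasis .fermi 1)).tensorProduct (fockBasis .bose h)

theorem wBasis_apply (h : GL (Fin 2) ℂ) (i : WIx) : wBasis h i
    = (fockBasis .fermi 1 i.1.1 ⊗ₜ fockBasis .fermi 1 i.1.2) ⊗ₜ fockBasis .bose h i.2 := by
  simp [wBasis, Module.Basis.tensorProduct_apply']

theorem tri_tmul {ε : Sector} (A B : Module.End ℂ (Fock .fermi ε 1))
    (C : Module.End ℂ (Fock .bose ε 2)) (x y : Fock .fermi ε 1) (z : Fock .bose ε 2) :
    tri A B C ((x ⊗ₜ y) ⊗ₜ z) = (A x ⊗ₜ B y) ⊗ₜ C z := rfl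

theorem actW_apply {ε : Sector} (ϱ : G →* GL (Fin 1) ℂ) (ϱ' : G →* GL (Fin 2) ℂ) (g : G) :
    actW ε ϱ ϱ' g = tri 1 (fockAct .fermi ε 1 (ϱ g)) (fockAct .bose ε 2 (ϱ' g)) := rfl

section WBasis

variable (h : GL (Fin 2) ℂ) (i : WIx)

theorem wBasis_JW : JW (wBasis h i) = (i.J : ℂ) • wBasis h i := by
  rw [wBasis_apply, JW, LinearMap.add_apply, LinearMap.smul_apply, tri_tmul, tri_tmul, fockBasis_J0,
    fockBasis_J0]
  simp only [Module.End.one_apply, TensorProduct.tmul_smul, ← TensorProduct.smul_tmul', smul_smul,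
    ← add_smul]
  -- The vacuum constants are 4·(1/2) from 𝔞 and −1 from 𝔟; their sum is the 1 in `WIx.J`.
  congr 1
  simp [WIx.J, Stat.sign]
  ring

theorem wBasis_LW : LW (wBasis h i) = (i.L : ℂ) • wBasis h i := by
  rw [wBasis_apply, LW, LinearMap.add_apply, LinearMap.add_apply, tri_tmul, tri_tmul, tri_tmul,
    fockBasis_L0, fockBasis_L0, fockBasis_L0]
  simp only [Module.End.one_apply, TensorProduct.tmul_smul, ← TensorProduct.smul_tmul', ← add_smul]
  -- The vacuum energies 1/8, 1/8 and −2/8 cancel.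
  congr 1
  simp only [WIx.L, Stat.sign, Nat.cast_add, Nat.cast_one, Nat.cast_ofNat]
  ring

theorem wBasis_JE :
    JE (wBasis h i) = (1 / 2 + ((i.1.1.1.map charge).sum : ℤ) : ℂ) • wBasis h i := by
  rw [wBasis_apply, JE, tri_tmul, fockBasis_J0]
  simp only [Module.End.one_apply, ← TensorProduct.smul_tmul']
  congr 1
  simp [Stat.sign]

theorem wBasis_parityW : parityW .tw (wBasis h i)
    = ((-1 : ℂ) ^ Multiset.card i.1.1.1 * (-1) ^ Multiset.card i.1.2.1) • wBasis h i := by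
  rw [wBasis_apply, parityW, tri_tmul, fockBasis_one_neg_one, fockBasis_one_neg_one]
  simp only [Module.End.one_apply, TensorProduct.tmul_smul, ← TensorProduct.smul_tmul', smul_smul]
  rw [mul_comm]

theorem wBasis_actW {ϱ : G →* GL (Fin 1) ℂ} {ϱ' : G →* GL (Fin 2) ℂ} {g : G} {c : Fin 1 → ℂˣ}
    {d : Fin 2 → ℂˣ} (hc : ϱ g = diagGL c) (hd : ϱ' g = h * diagGL d * h⁻¹) :
    actW .tw ϱ ϱ' g (wBasis h i) = ((((i.1.2.1.map (diagWeight c)).prod : ℂˣ) : ℂ) *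
      ((i.2.1.map (diagWeight d)).prod : ℂˣ)) • wBasis h i := by
  rw [wBasis_apply, actW_apply, tri_tmul, hc, hd, fockBasis_one_diag, fockBasis_diag]
  simp only [Module.End.one_apply, TensorProduct.tmul_smul, ← TensorProduct.smul_tmul', smul_smul]
  rw [mul_comm]

theorem wBasis_twining {ϱ : G →* GL (Fin 1) ℂ} {ϱ' : G →* GL (Fin 2) ℂ} {g : G} {c : Fin 1 → ℂˣ}
    {d : Fin 2 → ℂˣ} (hc : ϱ g = diagGL c) (hd : ϱ' g = h * diagGL d * h⁻¹) :
    twining ϱ ϱ' g (wBasis h i) = (i.twine c d + i.twine c⁻¹ d⁻¹) • wBasis h i := by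
  have hc' : ϱ g⁻¹ = diagGL c⁻¹ := by rw [map_inv, hc, diagGL_inv]
  have hd' : ϱ' g⁻¹ = h * diagGL d⁻¹ * h⁻¹ := by rw [map_inv, hd, ← diagGL_inv]; group
  rw [twining, Module.End.mul_apply, wBasis_parityW, map_smul, Module.End.mul_apply, wBasis_JE,
    map_smul, LinearMap.add_apply, wBasis_actW h i hc hd, wBasis_actW h i hc' hd', ← add_smul,
    smul_smul, smul_smul]
  congr 1
  rw [WIx.twine, WIx.twine]
  ring

/-- The bigraded pieces do not depend on h, so the basis can be adapted to each group element
separately. -/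
theorem bigraded_eq (h : GL (Fin 2) ℂ) (p : ℤ × ℕ) :
    bigraded p = weightSpace (wBasis h) (fun i => (i.J, i.L)) p :=
  eigenspace_inf_eq_weightSpace (wBasis h) (wBasis_JW h) (wBasis_LW h) p

end WBasis

/-- The creation operators of positive charge are the a_i^+(−n−1), whose energy is at least 1. This
bounds the powers of y at each power of q. -/
theorem charge_le_energy {k : ℕ} (m : Multiset (ModeIx k)) :
    (m.map charge).sum ≤ ((m.map energy).sum : ℕ) := by
  induction m using Multiset.induction with
  | empty => simp
  | cons j m ih =>
    have hj : charge j ≤ (energy j : ℤ) := by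
      rcases j with ⟨i, n⟩ | ⟨i, n⟩ <;> simp only [charge, energy] <;> omega
    simp only [Multiset.map_cons, Multiset.sum_cons, Nat.cast_add]
    exact add_le_add hj ih

theorem WIx.J_le (i : WIx) : i.J ≤ 1 + 4 * (i.L : ℤ) := by
  have h1 := charge_le_energy i.1.2.1
  have h2 := charge_le_energy i.2.1
  simp only [WIx.J, WIx.L, Nat.cast_add]
  omega

theorem bigraded_isInternal : DirectSum.IsInternal bigraded := by
  have h : bigraded = weightSpace (wBasis 1) (fun i => (i.J, i.L)) := funext (bigraded_eq 1)
  rw [h]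
  exact weightSpace_isInternal _ _

theorem tri_commute {ε : Sector} {A A' B B' : Module.End ℂ (Fock .fermi ε 1)}
    {C C' : Module.End ℂ (Fock .bose ε 2)} (hA : Commute A A') (hB : Commute B B')
    (hC : Commute C C') : Commute (tri A B C) (tri A' B' C') := by
  rw [commute_iff_eq, tri, tri, ← TensorProduct.map_mul, ← TensorProduct.map_mul, hA.eq, hB.eq,
    hC.eq, TensorProduct.map_mul, TensorProduct.map_mul]

theorem mem_bigraded_of_commute {T : Module.End ℂ (W .tw)} (hJ : Commute JW T) (hL : Commute LW T)
    (p : ℤ × ℕ) : ∀ w ∈ bigraded p, T w ∈ bigraded p := by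
  rintro w ⟨h1, h2⟩
  rw [SetLike.mem_coe, Module.End.mem_eigenspace_iff] at h1 h2
  refine ⟨?_, ?_⟩ <;> rw [SetLike.mem_coe, Module.End.mem_eigenspace_iff]
  · rw [← Module.End.mul_apply, hJ.eq, Module.End.mul_apply, h1, map_smul]
  · rw [← Module.End.mul_apply, hL.eq, Module.End.mul_apply, h2, map_smul]

theorem actW_mem_bigraded (ϱ : G →* GL (Fin 1) ℂ) (ϱ' : G →* GL (Fin 2) ℂ) (g : G) (p : ℤ × ℕ) :
    ∀ w ∈ bigraded p, actW .tw ϱ ϱ' g w ∈ bigraded p := by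
  rw [actW_apply]
  refine mem_bigraded_of_commute ?_ ?_ p
  · exact ((tri_commute (Commute.refl _) (J0_commute _) (Commute.one_left _)).smul_left _).add_left
      (tri_commute (Commute.refl _) (Commute.one_left _) (J0_commute _))
  · exact ((tri_commute (Commute.one_right _) (Commute.one_left _) (Commute.one_left _)).add_left
      (tri_commute (Commute.refl _) (L0_commute _) (Commute.one_left _))).add_left
      (tri_commute (Commute.refl _) (Commute.one_left _) (L0_commute _))


/-! ## Normally ordered products in twisted modules -/

/-- These are the coefficients of (1 − x)⁻¹, followed by those of (1 − x)⁻²; they appear on the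
right of the Borcherds identity for n = −1 and n = −2. -/
theorem neg_one_pow_mul_choose_neg_one (l : ℕ) :
    (-1 : ℂ) ^ l * Ring.choose (((-1 : ℤ)) : ℂ) l = 1 := by
  rw [Int.cast_neg, Int.cast_one, Ring.choose_neg, add_sub_cancel_left, Ring.choose_natCast,
    Nat.choose_self]
  simp [Int.negOnePow, Units.smul_def, ← mul_pow]

theorem neg_one_pow_mul_choose_neg_two (l : ℕ) :
    (-1 : ℂ) ^ l * Ring.choose (((-2 : ℤ)) : ℂ) l = (l : ℂ) + 1 := by
  have h : (2 : ℂ) + l - 1 = ((l + 1 : ℕ) : ℂ) := by push_cast; ring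
  rw [Int.cast_neg, Int.cast_ofNat, Ring.choose_neg, h, Ring.choose_natCast,
    Nat.choose_succ_self_right]
  rw [Nat.cast_succ, Units.smul_def, zsmul_eq_mul, ← mul_assoc]
  simp [Int.negOnePow, ← mul_pow]

/-- This coefficient is the source of the constant −sk/8 in L(0). -/
theorem choose_half_two : Ring.choose (1 / 2 : ℂ) 2 = -1 / 8 := by
  rw [Ring.choose_eq_smul]
  have h : (descPochhammer ℤ 2) = Polynomial.X * (Polynomial.X - 1) := by
    rw [descPochhammer_succ_left]
    simp [descPochhammer_one]
  rw [h, Polynomial.smeval_mul, Polynomial.smeval_sub]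
  simp [Nat.factorial]
  norm_num

theorem finsum_eq_finsum_succ {V : Type*} [AddCommMonoid V] (f : ℕ → V) (h : f 0 = 0) :
    ∑ᶠ n, f n = ∑ᶠ n, f (n + 1) := by
  rw [← finsum_mem_range Nat.succ_injective (f := f), ← finsum_mem_univ]
  refine (finsum_mem_inter_support_eq' _ _ _ fun n hn => ⟨fun _ => ?_, fun _ => trivial⟩)
  rcases n with _ | n
  · exact absurd h hn
  · exact ⟨n, rfl⟩

section NormalOrder

variable {V : Type*} [AddCommGroup V] [Module ℂ V] {P : Module.End ℂ V} {v : V}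
  {Y : SuperVertexAlgebra V P v} {θ : Module.End ℂ V} {M : Type*} [AddCommGroup M] [Module ℂ M]
  (T : TwistedModule Y θ M) {i : ℕ} {u w : V} {c : ℂ}
  (hPu : P u = (-1 : ℂ) ^ i • u) (hPw : P w = (-1 : ℂ) ^ i • w) (hu : θ u = -u) (hw : θ w = -w)
  (h0 : Y.prod 0 u w = c • v) (hn : ∀ n : ℤ, 0 < n → Y.prod n u w = 0)

include hPu hPw hu hw h0 hn

theorem TwistedModule.act_prod_neg_one (x : M) :
    T.act 0 (Y.prod (-1) u w) x = (c / 2) • x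
      + ∑ᶠ l : ℕ, (T.act (2 * (-((l + 1 : ℕ) : ℤ)) - 1) u (T.act (2 * ((l + 1 : ℕ) : ℤ) - 1) w x)
        + (-1 : ℂ) ^ (i * i) • T.act (2 * (-(l : ℤ)) - 1) w (T.act (2 * (l : ℤ) - 1) u x)) := by
  -- The exponents are m = −1/2, k = 1/2, n = −1. The left side stops after l = 1, where the
  -- coefficient −1/2 meets u₀w = c·v; this is the origin of c/2.
  have h := T.borcherds i i 1 1 u w x hPu hPw (by simpa using hu) (by simpa using hw) (-1) 1 (-1)
    (by decide) (by decide)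
  have hl : (∑ᶠ l : ℕ, Ring.choose (((-1 : ℤ) : ℂ) / 2) l •
      T.act (-1 + 1 - 2 * l) (Y.prod (-1 + l) u w) x)
      = T.act 0 (Y.prod (-1) u w) x - (c / 2) • x := by
    rw [finsum_eq_sum_of_support_subset (s := Finset.range 2)]
    · rw [Finset.sum_range_succ, Finset.sum_range_one, Ring.choose_zero_right,
        Ring.choose_one_right]
      have e1 : (-1 + ((1 : ℕ) : ℤ)) = 0 := by norm_num
      have e2 : (-1 + 1 - 2 * ((1 : ℕ) : ℤ)) = -2 := by norm_num
      have e3 : (-1 + ((0 : ℕ) : ℤ)) = -1 := by norm_num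
      have e4 : (-1 + 1 - 2 * ((0 : ℕ) : ℤ)) = 0 := by norm_num
      rw [e1, e2, e3, e4, h0, map_smul, LinearMap.smul_apply, T.vac_act, if_pos rfl, smul_smul,
        one_smul, sub_eq_add_neg, ← neg_smul]
      congr 2
      push_cast
      ring
    · intro l hl
      by_contra hl'
      refine hl ?_
      have : 1 < l := by simpa using hl'
      simp only [hn (-1 + l) (by omega), map_zero, LinearMap.zero_apply, smul_zero]
  rw [hl, sub_eq_iff_eq_add'] at h
  rw [h]
  congr 1
  refine finsum_congr fun l => ?_
  have e1 : (-1 + 2 * (-1) - 2 * (l : ℤ)) = 2 * (-((l + 1 : ℕ) : ℤ)) - 1 := by push_cast; ring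
  have e2 : (1 + 2 * (l : ℤ)) = 2 * ((l + 1 : ℕ) : ℤ) - 1 := by push_cast; ring
  have e3 : (1 + 2 * (-1) - 2 * (l : ℤ)) = 2 * (-(l : ℤ)) - 1 := by ring
  have e4 : (-1 + 2 * (l : ℤ)) = 2 * (l : ℤ) - 1 := by ring
  rw [neg_one_pow_mul_choose_neg_one, one_smul, zpow_neg_one, inv_neg_one, e1, e2, e3, e4,
    show (-1 : ℂ) ^ (i * i) * -1 = -((-1 : ℂ) ^ (i * i)) by ring, neg_smul, sub_neg_eq_add]

theorem TwistedModule.act_prod_neg_two (x : M) :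
    T.act 2 (Y.prod (-2) u w) x = (c / 8) • x - (1 / 2 : ℂ) • T.act 0 (Y.prod (-1) u w) x
      + ∑ᶠ l : ℕ, ((l : ℂ) + 1) •
        (T.act (2 * (-((l + 1 : ℕ) : ℤ)) - 1) u (T.act (2 * ((l + 1 : ℕ) : ℤ) - 1) w x)
        - (-1 : ℂ) ^ (i * i) •
          T.act (2 * (-((l + 1 : ℕ) : ℤ)) - 1) w (T.act (2 * ((l + 1 : ℕ) : ℤ) - 1) u x)) := by
  -- Here m = k = 1/2 and n = −2. The left side has the terms l = 0, 1, 2 with coefficients 1, 1/2,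
  -- −1/8.
  have h := T.borcherds i i 1 1 u w x hPu hPw (by simpa using hu) (by simpa using hw) 1 1 (-2)
    (by decide) (by decide)
  have hl : (∑ᶠ l : ℕ, Ring.choose (((1 : ℤ) : ℂ) / 2) l •
      T.act (1 + 1 - 2 * l) (Y.prod (-2 + l) u w) x)
      = T.act 2 (Y.prod (-2) u w) x
        - ((c / 8) • x - (1 / 2 : ℂ) • T.act 0 (Y.prod (-1) u w) x) := by
    rw [finsum_eq_sum_of_support_subset (s := Finset.range 3)]
    · rw [Finset.sum_range_succ, Finset.sum_range_succ, Finset.sum_range_one,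
        Ring.choose_zero_right, Ring.choose_one_right, Int.cast_one, choose_half_two]
      have e1 : (-2 + ((1 : ℕ) : ℤ)) = -1 := by norm_num
      have e2 : (1 + 1 - 2 * ((1 : ℕ) : ℤ)) = 0 := by norm_num
      have e3 : (-2 + ((0 : ℕ) : ℤ)) = -2 := by norm_num
      have e4 : (1 + 1 - 2 * ((0 : ℕ) : ℤ)) = 2 := by norm_num
      have e5 : (-2 + ((2 : ℕ) : ℤ)) = 0 := by norm_num
      have e6 : (1 + 1 - 2 * ((2 : ℕ) : ℤ)) = -2 := by norm_num
      rw [e1, e2, e3, e4, e5, e6, h0, map_smul, LinearMap.smul_apply, T.vac_act, if_pos rfl]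
      module
    · intro l hl
      by_contra hl'
      refine hl ?_
      have : 3 ≤ l := by simpa using hl'
      simp only [hn (-2 + l) (by omega), map_zero, LinearMap.zero_apply, smul_zero]
  rw [hl, sub_eq_iff_eq_add'] at h
  rw [h]
  congr 1
  refine finsum_congr fun l => ?_
  have e1 : (1 + 2 * (-2) - 2 * (l : ℤ)) = 2 * (-((l + 1 : ℕ) : ℤ)) - 1 := by push_cast; ring
  have e2 : (1 + 2 * (l : ℤ)) = 2 * ((l + 1 : ℕ) : ℤ) - 1 := by push_cast; ring
  rw [neg_one_pow_mul_choose_neg_two, show ((-1 : ℂ) ^ (-2 : ℤ)) = 1 by norm_num, mul_one, e1, e2]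

end NormalOrder

/-! ### The three free fields inside `W` and their bilinear zero modes. -/

/-- The parity of the generating fields. -/
def Stat.parity : Stat → ℕ
  | .fermi => 1
  | .bose => 0

theorem Stat.neg_one_pow_parity (s : Stat) : (-1 : ℂ) ^ (s.parity * s.parity) = s.sign := by
  cases s <;> simp [Stat.parity, Stat.sign]

/-- A free field inside `W`, with its modes on `W` and on `W_tw`; `K₀` and `K` embed the module of the
free field as a tensor factor. -/
structure FreeFactor {Y : SuperVertexAlgebra (W .ns) (parityW .ns) (vacW .ns)}
    (M : TwistedModule Y (canonW .ns) (W .tw)) (s : Stat) (k : ℕ)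
    (K₀ : Fock s .ns k →ₗ[ℂ] W .ns) (K : Fock s .tw k →ₗ[ℂ] W .tw) where
  X : Pol k → W .ns
  parity : ∀ x, parityW .ns (X x) = (-1 : ℂ) ^ s.parity • X x
  canon : ∀ x, canonW .ns (X x) = -X x
  K₀_vac : K₀ (vac s .ns k) = vacW .ns
  prod : ∀ n x y, Y.prod n (X x) (X y) = K₀ (mode s .ns n x (mode s .ns (-1) y (vac s .ns k)))
  act : ∀ (m n : ℤ) x y w, M.act (2 * m - 1) (X x) (M.act (2 * n - 1) (X y) (K w))
    = K (mode s .tw m x (mode s .tw n y w))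

namespace FreeFactor

variable {Y : SuperVertexAlgebra (W .ns) (parityW .ns) (vacW .ns)}
  {M : TwistedModule Y (canonW .ns) (W .tw)} {s : Stat} {k : ℕ}
  {K₀ : Fock s .ns k →ₗ[ℂ] W .ns} {K : Fock s .tw k →ₗ[ℂ] W .tw} (F : FreeFactor M s k K₀ K)

include F

theorem prod_zero (x y : Pol k) : Y.prod 0 (F.X x) (F.X y) = form s k x y • vacW .ns := by
  rw [F.prod, mode_mode, mode_vac (Or.inl (by simp [Sector.shift])), map_zero, smul_zero, zero_add,
    if_pos (by simp [Sector.shift]), map_smul, F.K₀_vac]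

theorem prod_pos (x y : Pol k) (n : ℤ) (hn : 0 < n) : Y.prod n (F.X x) (F.X y) = 0 := by
  rw [F.prod, mode_mode, mode_vac (Or.inl (by simp only [Sector.shift]; omega)), map_zero,
    smul_zero, zero_add, if_neg (by simp only [Sector.shift]; omega), zero_smul, map_zero]

theorem act_pair_one (x y : Pol k) (w : Fock s .tw k) :
    M.act 0 (K₀ (mode s .ns (-1) x (mode s .ns (-1) y (vac s .ns k)))) (K w)
      = K ((form s k x y / 2) • w + ∑ᶠ l : ℕ,
        (mode s .tw (-((l + 1 : ℕ) : ℤ)) x (mode s .tw ((l + 1 : ℕ) : ℤ) y w)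
          + s.sign • mode s .tw (-(l : ℤ)) y (mode s .tw (l : ℤ) x w))) := by
  rw [← F.prod, M.act_prod_neg_one (F.parity x) (F.parity y) (F.canon x) (F.canon y)
    (F.prod_zero x y) (F.prod_pos x y), map_add, map_smul, map_finsum]
  · simp only [F.act, s.neg_one_pow_parity, map_add, map_smul]
  -- Finiteness of the support is what lets `K` pass through the sum.
  · obtain ⟨N, hN⟩ := mode_finite s .tw w
    refine (Set.finite_lt_nat N).subset fun l hl => ?_
    by_contra h
    refine hl ?_
    have h' : N ≤ l := not_lt.1 h
    simp only [hN l h', hN (l + 1) (by omega), map_zero, smul_zero, add_zero]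

theorem act_pair_two (x y : Pol k) (w : Fock s .tw k) :
    M.act 2 (K₀ (mode s .ns (-2) x (mode s .ns (-1) y (vac s .ns k)))) (K w)
      = K ((form s k x y / 8) • w + ∑ᶠ l : ℕ, ((l : ℂ) + 1) •
        (mode s .tw (-((l + 1 : ℕ) : ℤ)) x (mode s .tw ((l + 1 : ℕ) : ℤ) y w)
          - s.sign • mode s .tw (-((l + 1 : ℕ) : ℤ)) y (mode s .tw ((l + 1 : ℕ) : ℤ) x w)))
        - (1 / 2 : ℂ) • M.act 0 (K₀ (mode s .ns (-1) x (mode s .ns (-1) y (vac s .ns k)))) (K w) := by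
  rw [← F.prod, ← F.prod, M.act_prod_neg_two (F.parity x) (F.parity y) (F.canon x) (F.canon y)
    (F.prod_zero x y) (F.prod_pos x y), map_add, map_smul, map_finsum, sub_add_eq_add_sub]
  · simp only [F.act, s.neg_one_pow_parity, map_sub, map_smul]
  · obtain ⟨N, hN⟩ := mode_finite s .tw w
    refine (Set.finite_lt_nat N).subset fun l hl => ?_
    by_contra h
    refine hl ?_
    have h' : N ≤ l := not_lt.1 h
    simp only [hN (l + 1) (by omega), map_zero, smul_zero, sub_zero]

/-- The constant is ⟨a_i^+, a_i^-⟩/2 = −s/2 for each i. -/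
theorem act_jvec (w : Fock s .tw k) : M.act 0 (K₀ (jvec s k)) (K w) = K (J0 s k w) := by
  rw [jvec, map_sum, map_sum, LinearMap.sum_apply]
  simp only [F.act_pair_one]
  rw [← map_sum, J0, LinearMap.add_apply, LinearMap.sum_apply, Finset.sum_add_distrib,
    Module.algebraMap_end_apply]
  congr 2
  · simp only [form_plus_minus, if_true]
    rw [Finset.sum_const, Finset.card_univ, Fintype.card_fin, ← Nat.cast_smul_eq_nsmul ℂ, smul_smul]
    congr 1
    ring
  · refine Finset.sum_congr rfl fun i _ => finsum_congr fun l => ?_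
    rw [LinearMap.add_apply, add_comm]
    rfl

/-- Once the two factors in the second term of ω are exchanged, both terms have the shape treated in
`act_pair_two`, with the roles of a_i^+ and a_i^- interchanged. Their mode sums add up, the
corrections by M.act 0 cancel, and the constants add to −s/4; the factor 1/2 in ω leaves −s/8 for
each i. -/
theorem act_ωvec (w : Fock s .tw k) : M.act 2 (K₀ (ωvec s k)) (K w) = K (L0 s k w) := by
  have hcomm : ∀ (i : Fin k) (n : ℤ), n < 0 →
      mode s .ns (-1) (plus i) (mode s .ns n (minus i) (vac s .ns k))
      = s.sign • mode s .ns n (minus i) (mode s .ns (-1) (plus i) (vac s .ns k)) := by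
    intro i n hn
    rw [mode_mode, if_neg (by simp only [Sector.shift]; omega), zero_smul, add_zero]
  have hfin : ∀ i : Fin k, (Function.support fun l : ℕ => ((l : ℂ) + 1) •
      (mode s .tw (-((l + 1 : ℕ) : ℤ)) (plus i) (mode s .tw ((l + 1 : ℕ) : ℤ) (minus i) w)
        - s.sign • mode s .tw (-((l + 1 : ℕ) : ℤ)) (minus i)
          (mode s .tw ((l + 1 : ℕ) : ℤ) (plus i) w))).Finite := by
    intro i
    obtain ⟨N, hN⟩ := mode_finite s .tw w
    refine (Set.finite_lt_nat N).subset fun l hl => ?_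
    by_contra h
    refine hl ?_
    have h' : N ≤ l := not_lt.1 h
    simp only [hN (l + 1) (by omega), map_zero, smul_zero, sub_zero]
  have key : ∀ i : Fin k, M.act 2 (K₀
      (mode s .ns (-2) (plus i) (mode s .ns (-1) (minus i) (vac s .ns k))
      - mode s .ns (-1) (plus i) (mode s .ns (-2) (minus i) (vac s .ns k)))) (K w)
      = K ((-s.sign / 4) • w + (2 : ℂ) • ∑ᶠ l : ℕ, ((l : ℂ) + 1) •
        (mode s .tw (-((l + 1 : ℕ) : ℤ)) (plus i) (mode s .tw ((l + 1 : ℕ) : ℤ) (minus i) w)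
          - s.sign • mode s .tw (-((l + 1 : ℕ) : ℤ)) (minus i)
            (mode s .tw ((l + 1 : ℕ) : ℤ) (plus i) w))) := by
    intro i
    have hswap : ∑ᶠ l : ℕ, ((l : ℂ) + 1) •
        (mode s .tw (-((l + 1 : ℕ) : ℤ)) (minus i) (mode s .tw ((l + 1 : ℕ) : ℤ) (plus i) w)
          - s.sign • mode s .tw (-((l + 1 : ℕ) : ℤ)) (plus i)
            (mode s .tw ((l + 1 : ℕ) : ℤ) (minus i) w))
        = -s.sign • ∑ᶠ l : ℕ, ((l : ℂ) + 1) •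
        (mode s .tw (-((l + 1 : ℕ) : ℤ)) (plus i) (mode s .tw ((l + 1 : ℕ) : ℤ) (minus i) w)
          - s.sign • mode s .tw (-((l + 1 : ℕ) : ℤ)) (minus i)
            (mode s .tw ((l + 1 : ℕ) : ℤ) (plus i) w)) := by
      rw [smul_finsum' _ (hfin i)]
      refine finsum_congr fun l => ?_
      rw [smul_comm]
      congr 1
      rw [smul_sub, smul_smul, neg_mul, s.sign_mul_self]
      module
    have h1 := F.act_pair_two (plus i) (minus i) w
    have h2 := F.act_pair_two (minus i) (plus i) w
    have h3 := hcomm i (-1) (by norm_num)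
    rw [form_plus_minus, if_pos rfl, h3] at h1
    rw [form_minus_plus, if_pos rfl, hswap] at h2
    rw [hcomm i (-2) (by norm_num), map_sub, map_sub, LinearMap.sub_apply, map_smul, map_smul,
      LinearMap.smul_apply, h1, h2, map_smul, map_smul, LinearMap.smul_apply]
    simp only [map_add, map_smul]
    generalize K (∑ᶠ l : ℕ, _) = S
    have hs := s.sign_mul_self
    have hS : s.sign • -s.sign • S = -S := by rw [smul_smul, mul_neg, hs, neg_one_smul]
    rw [smul_sub, smul_add, hS]
    module
  rw [ωvec, map_smul, map_smul, LinearMap.smul_apply, map_sum, map_sum, LinearMap.sum_apply]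
  simp only [key]
  rw [← map_sum, ← map_smul, L0, LinearMap.add_apply, LinearMap.sum_apply, Finset.sum_add_distrib,
    Module.algebraMap_end_apply, smul_add]
  congr 2
  · rw [← Finset.smul_sum, Finset.sum_const, Finset.card_univ, Fintype.card_fin,
      ← Nat.cast_smul_eq_nsmul ℂ, smul_smul, smul_smul]
    congr 1
    ring
  · rw [Finset.smul_sum]
    refine Finset.sum_congr rfl fun i _ => ?_
    rw [smul_smul, one_div, inv_mul_cancel₀ two_ne_zero, one_smul]
    -- The sum in `L0` begins with the vanishing term n = 0, while the Borcherds identity begins at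
    -- n = 1.
    refine Eq.trans ?_ (finsum_eq_finsum_succ _ ?_).symm
    · refine finsum_congr fun l => ?_
      rw [LinearMap.smul_apply, LinearMap.sub_apply, LinearMap.smul_apply, ← Nat.cast_succ]
      rfl
    · simp

end FreeFactor

theorem fockAct_neg_one_neg_one {s : Stat} {ε : Sector} {k : ℕ} (w : Fock s ε k) :
    fockAct s ε k (-1) (fockAct s ε k (-1) w) = w := by
  rw [← Module.End.mul_apply, ← map_mul, neg_mul_neg, one_mul, map_one]
  rfl

theorem fockAct_neg_one_mode {s : Stat} {ε : Sector} {k : ℕ} (n : ℤ) (x : Pol k) :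
    fockAct s ε k (-1) (mode s ε n x (vac s ε k)) = -mode s ε n x (vac s ε k) := by
  have h : polAct (-1 : GL (Fin k) ℂ) x = (-1 : ℂ) • x := by
    refine Prod.ext ?_ ?_
    · simp [polAct]
    · simp [polAct, inv_neg]
  rw [fockAct_mode, fockAct_vac, h, mode_smul, neg_one_smul]

section ZeroModesW

variable {Y : SuperVertexAlgebra (W .ns) (parityW .ns) (vacW .ns)}
  {M : TwistedModule Y (canonW .ns) (W .tw)} (hY : IsFreeField Y) (hM : IsFreeFieldTwisted M)

include hY hM

/-- The free field of `𝔢`. -/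
def freeFactorE (y : Fock .fermi .tw 1) (z : Fock .bose .tw 2) : FreeFactor M .fermi 1
    ((TensorProduct.mk ℂ _ _).flip (vac .bose .ns 2) ∘ₗ
      (TensorProduct.mk ℂ _ _).flip (vac .fermi .ns 1))
    ((TensorProduct.mk ℂ _ _).flip z ∘ₗ (TensorProduct.mk ℂ _ _).flip y) where
  X x := modeE .ns (-1) x (vacW .ns)
  parity x := by
    rw [modeE, vacW, tri_tmul, parityW, tri_tmul, fockAct_neg_one_mode, Module.End.one_apply,
      fockAct_vac]
    rw [Stat.parity, pow_one, ← neg_one_smul ℂ (mode _ _ _ _ _), ← TensorProduct.smul_tmul',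
      ← TensorProduct.smul_tmul']
    rfl
  canon x := by
    rw [modeE, vacW, tri_tmul, canonW, tri_tmul, fockAct_neg_one_mode, Module.End.one_apply,
      Module.End.one_apply, fockAct_vac, fockAct_vac]
    simp [TensorProduct.neg_tmul]
  K₀_vac := rfl
  prod n x y := by rw [(hY n).1 x]; rfl
  act m n x y w := by rw [(hM m).1 x, (hM n).1 y]; rfl

/-- The free field of `𝔞`. -/
def freeFactorA (x : Fock .fermi .tw 1) (z : Fock .bose .tw 2) : FreeFactor M .fermi 1
    ((TensorProduct.mk ℂ _ _).flip (vac .bose .ns 2) ∘ₗ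
      TensorProduct.mk ℂ _ _ (vac .fermi .ns 1))
    ((TensorProduct.mk ℂ _ _).flip z ∘ₗ TensorProduct.mk ℂ _ _ x) where
  X x := modeA .ns (-1) x (vacW .ns)
  parity x := by
    rw [modeA, vacW, tri_tmul, parityW, tri_tmul, fockAct_neg_one_mode, Module.End.one_apply,
      fockAct_vac, fockAct_vac]
    rw [Stat.parity, pow_one, ← neg_one_smul ℂ (mode _ _ _ _ _), TensorProduct.tmul_smul,
      ← TensorProduct.smul_tmul']
  canon x := by
    rw [modeA, vacW, tri_tmul, canonW, tri_tmul, fockAct_neg_one_mode, Module.End.one_apply,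
      fockAct_vac, fockAct_vac, fockAct_vac]
    simp [TensorProduct.neg_tmul, TensorProduct.tmul_neg]
  K₀_vac := rfl
  prod n x y := by
    rw [(hY n).2.1 x, modeA, modeA, vacW, tri_tmul, tri_tmul, fockAct_vac, fockAct_vac]
    rfl
  act m n x' y w := by
    rw [(hM m).2.1 x', (hM n).2.1 y]
    -- Each of the two modes of 𝔞 applies −I to the factor of 𝔢, and (−I)² = 1, so the sign
    -- disappears from bilinear expressions.
    change ((fockAct .fermi .tw 1 (-1) (fockAct .fermi .tw 1 (-1) x)) ⊗ₜ _) ⊗ₜ _ = _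
    rw [fockAct_neg_one_neg_one]
    rfl

/-- The free field of `𝔟`. -/
def freeFactorB (x : Fock .fermi .tw 1) (y : Fock .fermi .tw 1) : FreeFactor M .bose 2
    (TensorProduct.mk ℂ _ _ (vac .fermi .ns 1 ⊗ₜ vac .fermi .ns 1))
    (TensorProduct.mk ℂ _ _ (x ⊗ₜ y)) where
  X x := modeB .ns (-1) x (vacW .ns)
  parity x := by
    rw [modeB, vacW, tri_tmul, parityW, tri_tmul, Module.End.one_apply, Module.End.one_apply,
      fockAct_vac]
    simp [Stat.parity]
  canon x := by
    rw [modeB, vacW, tri_tmul, canonW, tri_tmul, fockAct_neg_one_mode, Module.End.one_apply,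
      fockAct_vac]
    simp [TensorProduct.tmul_neg]
  K₀_vac := rfl
  prod n x y := by rw [(hY n).2.2 x]; rfl
  act m n x' y' w := by rw [(hM m).2.2 x', (hM n).2.2 y']; rfl

theorem act_jE : M.act 0 jE = JE := by
  -- On pure tensors with two components held fixed, only one free field acts.
  refine TensorProduct.ext_threefold fun x y z => ?_
  exact (freeFactorE hY hM y z).act_jvec x

theorem act_jW : M.act 0 jW = JW := by
  refine TensorProduct.ext_threefold fun x y z => ?_
  rw [jW, map_add, map_smul, JW, LinearMap.add_apply, LinearMap.add_apply, LinearMap.smul_apply,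
    LinearMap.smul_apply]
  refine congrArg₂ _ (congrArg _ ?_) ?_
  · exact (freeFactorA hY hM x z).act_jvec y
  · exact (freeFactorB hY hM x y).act_jvec z

theorem act_ωW : M.act 2 ωW = LW := by
  refine TensorProduct.ext_threefold fun x y z => ?_
  rw [ωW, map_add, map_add, LW]
  simp only [LinearMap.add_apply]
  refine congrArg₂ _ (congrArg₂ _ ?_ ?_) ?_
  · exact (freeFactorE hY hM y z).act_ωvec x
  · exact (freeFactorA hY hM x z).act_ωvec y
  · exact (freeFactorB hY hM x y).act_ωvec z

end ZeroModesW

/-! ## Sums over occupation numbers -/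

section OccupationSums

open Filter Topology

variable {ι R : Type*} [NormedField R] [CompleteSpace R] {x : ι → R}

open Classical in
/-- A multiset supported on `insert i s` is a multiplicity of `i` and a multiset supported on
`s`. -/
def multisetInsertEquiv {i : ι} {s : Finset ι} (hi : i ∉ s) :
    {m : Multiset ι // ∀ j ∈ m, j ∈ insert i s} ≃ ℕ × {m : Multiset ι // ∀ j ∈ m, j ∈ s} where
  toFun m := (m.1.count i, ⟨m.1.filter (fun j => ¬ j = i), fun j hj => by
    rw [Multiset.mem_filter] at hj
    exact (Finset.mem_insert.1 (m.2 j hj.1)).resolve_left hj.2⟩)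
  invFun p := ⟨Multiset.replicate p.1 i + p.2.1, fun j hj => by
    rcases Multiset.mem_add.1 hj with h | h
    · rw [Multiset.eq_of_mem_replicate h]; exact Finset.mem_insert_self _ _
    · exact Finset.mem_insert_of_mem (p.2.2 j h)⟩
  left_inv m := by
    refine Subtype.ext ?_
    change Multiset.replicate (m.1.count i) i + _ = m.1
    rw [← Multiset.filter_eq', Multiset.filter_add_not]
  right_inv p := by
    have h0 : i ∉ p.2.1 := fun h => hi (p.2.2 i h)
    refine Prod.ext ?_ (Subtype.ext ?_)
    · change Multiset.count i (_ + _) = _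
      rw [Multiset.count_add, Multiset.count_replicate_self, Multiset.count_eq_zero_of_notMem h0,
        add_zero]
    · change Multiset.filter _ (_ + _) = _
      rw [Multiset.filter_add, Multiset.filter_eq_nil.2, zero_add, Multiset.filter_eq_self]
      · rintro j hj rfl
        exact h0 hj
      · intro j hj h
        exact h (Multiset.eq_of_mem_replicate hj)

/-- Induction on the finite set: the multiplicity of a new mode is independent of the rest and sums
to a geometric series. -/
theorem hasSum_multiset_finset (hx : ∀ i, ‖x i‖ < 1) (s : Finset ι) :
    Summable (fun m : {m : Multiset ι // ∀ j ∈ m, j ∈ s} => ‖(m.1.map x).prod‖) ∧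
      HasSum (fun m : {m : Multiset ι // ∀ j ∈ m, j ∈ s} => (m.1.map x).prod)
        (∏ i ∈ s, (1 - x i)⁻¹) := by
  classical
  induction s using Finset.induction_on with
  | empty =>
    have h0 : ∀ m : {m : Multiset ι // ∀ j ∈ m, j ∈ (∅ : Finset ι)}, m = ⟨0, by simp⟩ := by
      intro m
      refine Subtype.ext (Multiset.eq_zero_of_forall_notMem fun j hj => ?_)
      simpa using m.2 j hj
    have : Unique {m : Multiset ι // ∀ j ∈ m, j ∈ (∅ : Finset ι)} := ⟨⟨⟨0, by simp⟩⟩, h0⟩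
    refine ⟨Summable.of_finite, ?_⟩
    convert hasSum_unique (fun m : {m : Multiset ι // ∀ j ∈ m, j ∈ (∅ : Finset ι)} =>
      (m.1.map x).prod)
    rw [h0 default]
    simp
  | insert i s hi ih =>
    have hprod : ∀ m : {m : Multiset ι // ∀ j ∈ m, j ∈ insert i s}, (m.1.map x).prod
        = x i ^ (multisetInsertEquiv hi m).1
          * (((multisetInsertEquiv hi m).2 : Multiset ι).map x).prod := by
      intro m
      conv_lhs => rw [← (multisetInsertEquiv hi).symm_apply_apply m]
      change (Multiset.map x (Multiset.replicate _ i + _)).prod = _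
      rw [Multiset.map_add, Multiset.prod_add, Multiset.map_replicate, Multiset.prod_replicate]
    have hg : Summable fun n : ℕ => ‖x i ^ n‖ := by
      simpa using summable_geometric_of_lt_one (norm_nonneg _) (hx i)
    have hs : Summable fun p : ℕ × {m : Multiset ι // ∀ j ∈ m, j ∈ s} =>
        ‖x i ^ p.1 * (p.2.1.map x).prod‖ :=
      Summable.mul_norm (f := fun n : ℕ => x i ^ n)
        (g := fun m : {m : Multiset ι // ∀ j ∈ m, j ∈ s} => (m.1.map x).prod) hg ih.1
    simp only [hprod, Finset.prod_insert hi]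
    have hm := (hasSum_geometric_of_norm_lt_one (hx i)).mul ih.2 hs.of_norm
    exact ⟨(Equiv.summable_iff (multisetInsertEquiv hi) (f := fun p : ℕ × {m : Multiset ι //
        ∀ j ∈ m, j ∈ s} => ‖x i ^ p.1 * (p.2.1.map x).prod‖)).2 hs,
      (Equiv.hasSum_iff (multisetInsertEquiv hi) (f := fun p : ℕ × {m : Multiset ι //
        ∀ j ∈ m, j ∈ s} => x i ^ p.1 * (p.2.1.map x).prod)).2 hm⟩

/-- The finite products ∏(1 − y_i) decrease to the infinite product, which is positive because y is
summable and no factor vanishes. -/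
theorem exists_prod_inv_one_sub_le {y : ι → ℝ} (h0 : ∀ i, 0 ≤ y i) (h1 : ∀ i, y i < 1)
    (hy : Summable y) : ∃ C, ∀ s : Finset ι, ∏ i ∈ s, (1 - y i)⁻¹ ≤ C := by
  classical
  have hs : Summable fun i => ‖-y i‖ := by simpa using hy.norm
  have hm := (multipliable_one_add_of_summable hs).hasProd
  have hne := tprod_one_add_ne_zero_of_summable
    (fun i => by rw [← sub_eq_add_neg]; exact (sub_pos.2 (h1 i)).ne') hs
  simp only [← sub_eq_add_neg] at hm hne
  have hpos : ∀ s : Finset ι, 0 < ∏ i ∈ s, (1 - y i) := fun s =>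
    Finset.prod_pos fun i _ => sub_pos.2 (h1 i)
  have hle : ∀ s : Finset ι, ∏' i, (1 - y i) ≤ ∏ i ∈ s, (1 - y i) := fun s => by
    refine le_of_tendsto hm ((eventually_ge_atTop s).mono fun t ht => ?_)
    rw [← Finset.prod_sdiff ht]
    refine mul_le_of_le_one_left (hpos s).le (Finset.prod_le_one ?_ ?_)
    · exact fun i _ => (sub_pos.2 (h1 i)).le
    · exact fun i _ => sub_le_self _ (h0 i)
  have hP : 0 < ∏' i, (1 - y i) :=
    lt_of_le_of_ne (ge_of_tendsto' hm fun s => (hpos s).le) hne.symm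
  refine ⟨(∏' i, (1 - y i))⁻¹, fun s => ?_⟩
  rw [Finset.prod_inv_distrib]
  exact inv_anti₀ hP (hle s)

omit [CompleteSpace R] in
theorem norm_multiset_prod (m : Multiset ι) : ‖(m.map x).prod‖ = (m.map fun i => ‖x i‖).prod := by
  induction m using Multiset.induction with
  | empty => simp
  | cons i m ih => simp [ih]

-- Finitely many multisets involve finitely many modes, so a finite partial sum is at most a finite
-- product of geometric series, and these products are uniformly bounded.
omit [CompleteSpace R] in
theorem summable_multiset_norm (hx : ∀ i, ‖x i‖ < 1) (hs : Summable fun i => ‖x i‖) :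
    Summable fun m : Multiset ι => ‖(m.map x).prod‖ := by
  classical
  obtain ⟨C, hC⟩ := exists_prod_inv_one_sub_le (fun i => norm_nonneg (x i)) hx hs
  refine summable_of_sum_le (fun m => norm_nonneg _) (c := C) fun u => ?_
  set s : Finset ι := u.sup Multiset.toFinset
  obtain ⟨-, h⟩ := hasSum_multiset_finset (x := fun i => ‖x i‖) (by simpa using hx) s
  refine le_trans ?_ (hC s)
  simp only [norm_multiset_prod]
  have hu : ∀ m ∈ u, ∀ j ∈ m, j ∈ s := by
    intro m hm j hj
    exact Finset.mem_of_subset (Finset.le_sup (f := Multiset.toFinset) hm)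
      (Multiset.mem_toFinset.2 hj)
  have h' := sum_le_hasSum (u.attach.map ⟨fun m => ⟨m.1, hu m.1 m.2⟩, fun m m' hm =>
    Subtype.ext (congrArg (fun z => z.1) hm)⟩) (fun m _ => ?_) h
  · rw [Finset.sum_map] at h'
    refine le_trans (le_of_eq ?_) h'
    exact (Finset.sum_attach u fun m => (m.map fun i => ‖x i‖).prod).symm
  · rw [← norm_multiset_prod]
    exact norm_nonneg _

/-- The generating function of the bosonic occupation numbers. -/
theorem hasSum_multiset (hx : ∀ i, ‖x i‖ < 1) (hs : Summable fun i => ‖x i‖) :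
    HasSum (fun m : Multiset ι => (m.map x).prod) (∏' i, (1 - x i))⁻¹ := by
  classical
  have hsum := summable_multiset_norm hx hs
  have hs' : Summable fun i => ‖-x i‖ := by simpa using hs
  have hm := (multipliable_one_add_of_summable hs').hasProd
  have hne := tprod_one_add_ne_zero_of_summable (fun i h => by
    have h1 : x i = 1 := by linear_combination -h
    have h2 := hx i
    rw [h1, norm_one] at h2
    exact lt_irrefl _ h2) hs'
  simp only [← sub_eq_add_neg] at hm hne
  -- The multisets are exhausted by those supported on finite sets of modes. Dominated convergence
  -- gives the limit of the sums; the limit of the products is known.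
  have hlim : Tendsto (fun s : Finset ι => ∑' m : Multiset ι,
      {m : Multiset ι | ∀ j ∈ m, j ∈ s}.indicator (fun m => (m.map x).prod) m) atTop
      (𝓝 (∑' m : Multiset ι, (m.map x).prod)) := by
    refine tendsto_tsum_of_dominated_convergence hsum (fun m => ?_) (Eventually.of_forall
      fun s m => norm_indicator_le_norm_self _ _)
    refine tendsto_const_nhds.congr' ((eventually_ge_atTop m.toFinset).mono fun s hs => ?_)
    exact (Set.indicator_of_mem (s := {m : Multiset ι | ∀ j ∈ m, j ∈ s})
      (fun j hj => hs (Multiset.mem_toFinset.2 hj)) (fun m => (m.map x).prod)).symm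
  have heq : ∀ s : Finset ι, ∑' m : Multiset ι,
      {m : Multiset ι | ∀ j ∈ m, j ∈ s}.indicator (fun m => (m.map x).prod) m
      = (∏ i ∈ s, (1 - x i))⁻¹ := by
    intro s
    rw [← tsum_subtype, ← Finset.prod_inv_distrib]
    exact (hasSum_multiset_finset hx s).2.tsum_eq
  simp only [heq] at hlim
  have h := tendsto_nhds_unique hlim (Tendsto.inv₀ hm hne)
  rw [← h]
  exact hsum.of_norm.hasSum

/-- Sets of occupied modes as multisets without repetition. -/
def nodupEquiv (ι : Type*) : {m : Multiset ι // Stat.fermi.Occ m} ≃ Finset ι where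
  toFun m := ⟨m.1, m.2⟩
  invFun s := ⟨s.1, s.2⟩
  left_inv _ := rfl
  right_inv _ := rfl

/-- The generating function of the fermionic occupation numbers. -/
theorem hasSum_nodup (hs : Summable fun i => ‖x i‖) :
    HasSum (fun m : {m : Multiset ι // Stat.fermi.Occ m} => (m.1.map x).prod)
      (∏' i, (1 + x i)) := by
  have h := summable_finsetProd_of_summable_norm hs
  rw [tprod_one_add h]
  exact (Equiv.hasSum_iff (nodupEquiv ι)).2 h.hasSum

omit [CompleteSpace R] in
theorem summable_nodup_norm (hs : Summable fun i => ‖x i‖) :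
    Summable fun m : {m : Multiset ι // Stat.fermi.Occ m} => ‖(m.1.map x).prod‖ := by
  have h := (hasSum_nodup (x := fun i => ‖x i‖) (by simpa using hs)).summable
  simpa only [norm_multiset_prod] using h

/-- The generating function of the fermionic occupation numbers with the charge inserted, when
the weight of a neutralizing mode `i₀` is `-1`. -/
theorem hasSum_nodup_charge {x : ι → ℂ} {w : ι → ℤ} (hw : ∀ i, |w i| ≤ 1) (i₀ : ι)
    (hx₀ : x i₀ = -1) (hw₀ : w i₀ = -1) (hs : Summable fun i => ‖x i‖) :
    (Summable fun m : {m : Multiset ι // Stat.fermi.Occ m} =>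
      ‖(1 / 2 + ((m.1.map w).sum : ℤ)) * (m.1.map x).prod‖) ∧
    HasSum (fun m : {m : Multiset ι // Stat.fermi.Occ m} =>
      (1 / 2 + ((m.1.map w).sum : ℤ)) * (m.1.map x).prod)
      (1 / 2 * ∏' i, (1 + open Classical in Function.update x i₀ 1 i)) := by
  classical
  let F : Finset ι → ℂ := fun S => (1 / 2 + ((∑ i ∈ S, w i : ℤ) : ℂ)) * ∏ i ∈ S, x i
  have hF : Summable fun S => ‖F S‖ := by
    -- The charge of S is at most card S in absolute value and 1/2 + card S ≤ 2 ^ card S, so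
    -- doubling the weights dominates the series.
    have h2 : Summable fun S : Finset ι => ‖∏ i ∈ S, (2 * x i)‖ := by
      refine (summable_finsetProd_of_summable_norm (f := fun i => 2 * x i) ?_).norm
      simpa using hs.mul_left 2
    refine Summable.of_nonneg_of_le (fun S => norm_nonneg _) (fun S => ?_) h2
    rw [norm_mul, Finset.prod_mul_distrib, norm_mul, Finset.prod_const, norm_pow]
    refine mul_le_mul_of_nonneg_right ?_ (norm_nonneg _)
    have h1 : |∑ i ∈ S, w i| ≤ (S.card : ℤ) := by
      refine (Finset.abs_sum_le_sum_abs _ _).trans ((Finset.sum_le_sum fun i _ => hw i).trans ?_)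
      simp
    have h3 : ‖((∑ i ∈ S, w i : ℤ) : ℂ)‖ ≤ (S.card : ℝ) := by
      rw [Complex.norm_intCast]
      exact_mod_cast h1
    have h4 : ((S.card + 1 : ℕ) : ℝ) ≤ ((2 ^ S.card : ℕ) : ℝ) := by
      exact_mod_cast Nat.lt_two_pow_self
    push_cast at h4
    have h5 : ‖(1 / 2 : ℂ)‖ = 1 / 2 := by norm_num
    have h6 : ‖(2 : ℂ)‖ = 2 := by norm_num
    refine (norm_add_le _ _).trans ?_
    rw [h5, h6]
    linarith
  -- The map σ toggles the occupation of i₀. If T omits i₀ and has charge W, the two terms give (1/2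
  -- + W) − (W − 1/2) = 1 times the product over T, and the charge drops out.
  let σ : Finset ι ≃ Finset ι :=
    Function.Involutive.toPerm (fun S => symmDiff S {i₀}) fun S => symmDiff_symmDiff_cancel_right _ _
  have hins : ∀ T : Finset ι, i₀ ∉ T → F (insert i₀ T) + F T
      = ∏ i ∈ T, Function.update x i₀ 1 i := by
    intro T hT
    have hu : ∏ i ∈ T, Function.update x i₀ 1 i = ∏ i ∈ T, x i := by
      refine Finset.prod_congr rfl fun i hi => Function.update_of_ne ?_ _ _
      rintro rfl
      exact hT hi
    simp only [F, Finset.sum_insert hT, Finset.prod_insert hT, hx₀, hw₀, hu]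
    push_cast
    ring
  have hσ : ∀ S, F S + F (σ S) = ∏ i ∈ S, Function.update x i₀ 1 i := by
    intro S
    by_cases h : i₀ ∈ S
    · obtain ⟨T, hT, rfl⟩ : ∃ T, i₀ ∉ T ∧ insert i₀ T = S :=
        ⟨S.erase i₀, Finset.notMem_erase _ _, Finset.insert_erase h⟩
      have h' : σ (insert i₀ T) = T := by
        change symmDiff _ _ = _
        ext j
        simp only [Finset.mem_symmDiff, Finset.mem_insert, Finset.mem_singleton]
        by_cases hj : j = i₀ <;> simp [hj, hT]
      rw [h', hins T hT, Finset.prod_insert hT, Function.update_self, one_mul]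
    · have h' : σ S = insert i₀ S := by
        change symmDiff _ _ = _
        ext j
        simp only [Finset.mem_symmDiff, Finset.mem_insert, Finset.mem_singleton]
        by_cases hj : j = i₀ <;> simp [hj, h]
      rw [h', add_comm, hins S h]
  -- The sum of F S + F (σ S) over all S is twice the sum of F, which explains the factor 1/2. Each
  -- term is the product over S without i₀, that is the product with weight 1 at i₀.
  have hA := hF.of_norm.hasSum
  have hA2 := hA.add ((Equiv.hasSum_iff σ).2 hA)
  simp only [Function.comp_apply, hσ] at hA2
  have hs' : Summable fun i => ‖Function.update x i₀ 1 i‖ := by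
    refine (hs.update i₀ 1).congr fun i => ?_
    by_cases h : i = i₀
    · subst h; simp
    · simp [h]
  have hval := tprod_one_add (summable_finsetProd_of_summable_norm hs')
  rw [hA2.tsum_eq] at hval
  have hFe : ∀ m : {m : Multiset ι // Stat.fermi.Occ m},
      (1 / 2 + ((m.1.map w).sum : ℤ)) * (m.1.map x).prod = F (nodupEquiv ι m) := fun m => rfl
  simp only [hFe]
  constructor
  · exact (Equiv.summable_iff (nodupEquiv ι) (f := fun S => ‖F S‖)).2 hF
  · rw [hval, show (1 / 2 : ℂ) * ((∑' S, F S) + ∑' S, F S) = ∑' S, F S by ring]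
    exact (Equiv.hasSum_iff (nodupEquiv ι) (f := F)).2 hA

end OccupationSums

/-! ## The trace functions as infinite products -/

/-- The infinite product `∏_{n ≥ 0} (1 - a q^n)`. -/
def qprod (a q : ℂ) : ℂ := ∏' n : ℕ, (1 - a * q ^ n)

section QProd

variable {q : ℂ} (hq : ‖q‖ < 1)

include hq

theorem summable_norm_mul_pow (a : ℂ) : Summable fun n : ℕ => ‖a * q ^ n‖ := by
  simpa using (summable_geometric_of_lt_one (norm_nonneg q) hq).mul_left ‖a‖

theorem multipliable_qprod (a : ℂ) : Multipliable fun n : ℕ => 1 - a * q ^ n := by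
  simp only [sub_eq_add_neg]
  exact multipliable_one_add_of_summable (by simpa using summable_norm_mul_pow hq a)

theorem qprod_ne_zero {a : ℂ} (ha : ‖a‖ < 1) : qprod a q ≠ 0 := by
  have hs : Summable fun n : ℕ => ‖-(a * q ^ n)‖ := by simpa using summable_norm_mul_pow hq a
  have h := tprod_one_add_ne_zero_of_summable (fun n h => ?_) hs
  · simpa only [qprod, sub_eq_add_neg] using h
  · have h1 : a * q ^ n = 1 := by linear_combination -h
    have h2 : ‖a * q ^ n‖ < 1 := by
      rw [norm_mul, norm_pow]
      exact mul_lt_one_of_nonneg_of_lt_one_left (norm_nonneg a) ha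
        (pow_le_one₀ (norm_nonneg q) hq.le)
    rw [h1, norm_one] at h2
    exact lt_irrefl _ h2

theorem qprod_mul_neg (a : ℂ) : qprod a q * qprod (-a) q = qprod (a ^ 2) (q ^ 2) := by
  rw [qprod, qprod, ← (multipliable_qprod hq a).tprod_mul (multipliable_qprod hq (-a))]
  refine tprod_congr fun n => ?_
  ring

/-- Factor by factor this is (1 − x)(1 − ωx)(1 − ω²x) = 1 − x³. -/
theorem qprod_mul_cube {ω : ℂ} (hω : ω ^ 2 + ω + 1 = 0) (a : ℂ) :
    qprod a q * qprod (ω * a) q * qprod (ω ^ 2 * a) q = qprod (a ^ 3) (q ^ 3) := by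
  rw [qprod, qprod, qprod, ← (multipliable_qprod hq a).tprod_mul (multipliable_qprod hq _),
    ← ((multipliable_qprod hq a).mul (multipliable_qprod hq _)).tprod_mul (multipliable_qprod hq _)]
  refine tprod_congr fun n => ?_
  linear_combination (-(a * q ^ n) + (a * q ^ n) ^ 2 * ω - (a * q ^ n) ^ 3 * (ω - 1)) * hω

theorem summable_modeIx {k : ℕ} {f : ModeIx k → ℂ} {α β : Fin k → ℂ}
    (hl : ∀ i n, f (.inl (i, n)) = α i * q ^ n) (hr : ∀ i n, f (.inr (i, n)) = β i * q ^ n) :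
    Summable fun j => ‖f j‖ := by
  refine Summable.sum _ ?_ ?_
  · refine (summable_prod_of_nonneg (f := fun p => ‖f (.inl p)‖) fun _ => norm_nonneg _).2
      ⟨fun i => ?_, Summable.of_finite⟩
    simpa only [hl] using summable_norm_mul_pow hq (α i)
  · refine (summable_prod_of_nonneg (f := fun p => ‖f (.inr p)‖) fun _ => norm_nonneg _).2
      ⟨fun i => ?_, Summable.of_finite⟩
    simpa only [hr] using summable_norm_mul_pow hq (β i)

omit hq in
theorem tprod_modeIx {k : ℕ} {f : ModeIx k → ℂ} (hf : Summable fun j => ‖f j‖) :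
    ∏' j, (1 + f j) = (∏ i, ∏' n, (1 + f (.inl (i, n)))) * ∏ i, ∏' n, (1 + f (.inr (i, n))) := by
  have hl : Summable fun p => ‖f (.inl p)‖ := hf.comp_injective Sum.inl_injective
  have hr : Summable fun p => ‖f (.inr p)‖ := hf.comp_injective Sum.inr_injective
  have hl' := multipliable_one_add_of_summable hl
  have hr' := multipliable_one_add_of_summable hr
  have hl₂ : ∀ i, Multipliable fun n => 1 + f (.inl (i, n)) := fun i =>
    multipliable_one_add_of_summable (f := fun n => f (.inl (i, n)))
      (Summable.comp_injective (f := fun p => ‖f (.inl p)‖) hl (Prod.mk_right_injective i))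
  have hr₂ : ∀ i, Multipliable fun n => 1 + f (.inr (i, n)) := fun i =>
    multipliable_one_add_of_summable (f := fun n => f (.inr (i, n)))
      (Summable.comp_injective (f := fun p => ‖f (.inr p)‖) hr (Prod.mk_right_injective i))
  have h₁ := Multipliable.tprod_sum (f := fun j => 1 + f j) hl' hr'
  have h₂ := Multipliable.tprod_prod' (f := fun p => 1 + f (.inl p)) hl' hl₂
  have h₃ := Multipliable.tprod_prod' (f := fun p => 1 + f (.inr p)) hr' hr₂
  rw [h₁, h₂, h₃, tprod_fintype (β := Fin k), tprod_fintype (β := Fin k)]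

end QProd

/-- The weight of a creation operator in the trace functions. -/
def modeTerm {k : ℕ} (z : ℂ) (d : Fin k → ℂˣ) (y q : ℂ) (j : ModeIx k) : ℂ :=
  z * (diagWeight d j : ℂ) * y ^ charge j * q ^ energy j

section ModeTerm

variable {k : ℕ} (z : ℂ) (d : Fin k → ℂˣ) {y q : ℂ}

theorem modeTerm_inl (i : Fin k) (n : ℕ) :
    modeTerm z d y q (.inl (i, n)) = z * (d i * y * q) * q ^ n := by
  simp only [modeTerm, diagWeight, charge, energy, zpow_one]
  ring

theorem modeTerm_inr (i : Fin k) (n : ℕ) :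
    modeTerm z d y q (.inr (i, n)) = z * ((d i : ℂ)⁻¹ * y⁻¹) * q ^ n := by
  simp only [modeTerm, diagWeight, charge, energy, zpow_neg_one, Units.val_inv_eq_inv_val]
  ring

theorem modeTerm_prod (hy : y ≠ 0) (m : Multiset (ModeIx k)) : (m.map (modeTerm z d y q)).prod
    = z ^ Multiset.card m * ((m.map (diagWeight d)).prod : ℂˣ) * y ^ (m.map charge).sum
      * q ^ (m.map energy).sum := by
  induction m using Multiset.induction with
  | empty => simp
  | cons j m ih =>
    simp only [Multiset.map_cons, Multiset.prod_cons, Multiset.sum_cons, Multiset.card_cons, ih,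
      modeTerm, Units.val_mul, zpow_add₀ hy, pow_add, pow_one]
    ring

variable (hq : ‖q‖ < 1)

include hq

theorem summable_modeTerm : Summable fun j => ‖modeTerm z d y q j‖ :=
  summable_modeIx hq (modeTerm_inl z d) (modeTerm_inr z d)

theorem tprod_one_sub_modeTerm : ∏' j, (1 + modeTerm (-1) d y q j)
    = (∏ i, qprod (d i * y * q) q) * ∏ i, qprod ((d i : ℂ)⁻¹ * y⁻¹) q := by
  rw [tprod_modeIx (summable_modeTerm (-1) d hq)]
  simp only [modeTerm_inl, modeTerm_inr, neg_mul, one_mul, ← sub_eq_add_neg]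
  rfl

/-- The geometric series require all weights to have norm below 1. The largest norms are |yq|, for
a^+(−1), and |y⁻¹|, for the zero mode a^-(0); this dictates the domain. -/
theorem hasSum_bose (hd : ∀ i, ‖(d i : ℂ)‖ = 1) (hy1 : 1 < ‖y‖) (hyq : ‖y‖ * ‖q‖ < 1) :
    (Summable fun m : OccIx .bose k => ‖(m.1.map (modeTerm 1 d y q)).prod‖) ∧
    HasSum (fun m : OccIx .bose k => (m.1.map (modeTerm 1 d y q)).prod)
      ((∏ i, qprod (d i * y * q) q) * ∏ i, qprod ((d i : ℂ)⁻¹ * y⁻¹) q)⁻¹ := by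
  have hx : ∀ j, ‖modeTerm 1 d y q j‖ < 1 := by
    have hle : ∀ n, ‖q‖ ^ n ≤ 1 := fun n => pow_le_one₀ (norm_nonneg q) hq.le
    rintro (⟨i, n⟩ | ⟨i, n⟩)
    · rw [modeTerm_inl, one_mul, norm_mul, norm_mul, norm_mul, hd, one_mul, norm_pow]
      exact mul_lt_one_of_nonneg_of_lt_one_left (by positivity) hyq (hle n)
    · rw [modeTerm_inr, one_mul, norm_mul, norm_mul, norm_inv, hd, inv_one, one_mul, norm_pow,
        norm_inv]
      exact mul_lt_one_of_nonneg_of_lt_one_left (by positivity) (inv_lt_one_of_one_lt₀ hy1) (hle n)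
  have hs := summable_modeTerm 1 d (y := y) hq
  have hneg : ∀ j, 1 + modeTerm (-1) d y q j = 1 - modeTerm 1 d y q j := fun j => by
    rw [modeTerm, modeTerm]; ring
  rw [← tprod_one_sub_modeTerm d hq]
  simp only [hneg]
  let e : OccIx .bose k ≃ Multiset (ModeIx k) := Equiv.subtypeUnivEquiv fun _ => trivial
  have h₁ := summable_multiset_norm hx hs
  have h₂ := hasSum_multiset hx hs
  rw [← Equiv.summable_iff e] at h₁
  rw [← Equiv.hasSum_iff e] at h₂
  exact ⟨h₁, h₂⟩

theorem hasSum_fermi : (Summable fun m : OccIx .fermi k => ‖(m.1.map (modeTerm (-1) d y q)).prod‖) ∧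
    HasSum (fun m : OccIx .fermi k => (m.1.map (modeTerm (-1) d y q)).prod)
      ((∏ i, qprod (d i * y * q) q) * ∏ i, qprod ((d i : ℂ)⁻¹ * y⁻¹) q) := by
  have hs := summable_modeTerm (-1) d (y := y) hq
  rw [← tprod_one_sub_modeTerm d hq]
  exact ⟨summable_nodup_norm hs, hasSum_nodup hs⟩

/-- Without the charge, the zero mode a^-(0) would contribute 1 − 1 = 0. With the charge it
contributes (1/2)·2 instead, and the remaining modes of either charge give `qprod q q`. -/
theorem hasSum_fermi_charge : (Summable fun m : OccIx .fermi 1 =>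
      ‖(1 / 2 + ((m.1.map charge).sum : ℤ)) * (m.1.map (modeTerm (-1) 1 1 q)).prod‖) ∧
    HasSum (fun m : OccIx .fermi 1 =>
      (1 / 2 + ((m.1.map charge).sum : ℤ)) * (m.1.map (modeTerm (-1) 1 1 q)).prod)
      (qprod q q ^ 2) := by
  classical
  have hs := summable_modeTerm (-1) (1 : Fin 1 → ℂˣ) (y := 1) hq
  have h := hasSum_nodup_charge (x := modeTerm (-1) (1 : Fin 1 → ℂˣ) 1 q) (w := charge)
    (by rintro (j | j) <;> simp [charge]) (.inr (0, 0)) (by simp [modeTerm_inr])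
    rfl hs
  have hs' : Summable fun j => ‖Function.update (modeTerm (-1) (1 : Fin 1 → ℂˣ) 1 q)
      (.inr (0, 0)) 1 j‖ := by
    refine (hs.update (.inr (0, 0)) 1).congr fun j => ?_
    by_cases h : j = .inr (0, 0)
    · subst h; simp
    · simp [h]
  have h1 : ∏' n, (1 + Function.update (modeTerm (-1) (1 : Fin 1 → ℂˣ) 1 q) (.inr (0, 0)) 1
      (.inl (0, n))) = qprod q q := by
    refine tprod_congr fun n => ?_
    rw [Function.update_of_ne (by simp), modeTerm_inl]
    simp [sub_eq_add_neg]
  have h2 : ∀ n, 1 + Function.update (modeTerm (-1) (1 : Fin 1 → ℂˣ) 1 q) (.inr (0, 0)) 1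
      (.inr (0, n + 1)) = 1 - q * q ^ n := by
    intro n
    rw [Function.update_of_ne (by simp), modeTerm_inr]
    simp [sub_eq_add_neg, pow_succ']
  have h3 : ∏' n, (1 + Function.update (modeTerm (-1) (1 : Fin 1 → ℂˣ) 1 q) (.inr (0, 0)) 1
      (.inr (0, n))) = 2 * qprod q q := by
    rw [tprod_eq_zero_mul']
    · rw [Function.update_self, tprod_congr h2]
      norm_num [qprod]
    · simp only [h2]
      exact multipliable_qprod hq q
  have h4 := tprod_modeIx hs'
  rw [Fin.prod_univ_one, Fin.prod_univ_one, h1, h3] at h4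
  have hv : qprod q q ^ 2 = 1 / 2 * (qprod q q * (2 * qprod q q)) := by ring
  rw [hv, ← h4]
  convert h

end ModeTerm

/-- The value of the trace function attached to the eigenvalues of a group element. -/
def twineValue (c : ℂ) (d₀ d₁ : ℂ) (y q : ℂ) : ℂ :=
  y * qprod q q ^ 2 * (qprod (c * y ^ 4 * q) q * qprod (c⁻¹ * (y ^ 4)⁻¹) q) /
    ((qprod (d₀ * y * q) q * qprod (d₁ * y * q) q) * (qprod (d₀⁻¹ * y⁻¹) q * qprod (d₁⁻¹ * y⁻¹) q))

/-- J(0) sees 𝔞 with multiplicity 4 and does not see 𝔢, so the three factors carry y⁴, 1 and y; the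
isolated y is the charge of the vacuum. -/
theorem twine_eq (c : Fin 1 → ℂˣ) (d : Fin 2 → ℂˣ) {y q : ℂ} (hy : y ≠ 0) (i : WIx) :
    i.twine c d * (y ^ i.J * q ^ i.L)
      = y * ((((1 / 2 + ((i.1.1.1.map charge).sum : ℤ)) * (i.1.1.1.map (modeTerm (-1) 1 1 q)).prod)
          * (i.1.2.1.map (modeTerm (-1) c (y ^ 4) q)).prod)
        * (i.2.1.map (modeTerm 1 d y q)).prod) := by
  have h1 : (i.1.1.1.map (diagWeight (1 : Fin 1 → ℂˣ))).prod = 1 := by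
    refine Multiset.prod_eq_one fun u hu => ?_
    obtain ⟨j, -, rfl⟩ := Multiset.mem_map.1 hu
    rcases j with ⟨j, n⟩ | ⟨j, n⟩ <;> simp [diagWeight]
  have h2 : ∀ m : ℤ, y ^ (4 * m) = (y ^ 4) ^ m := fun m => by
    rw [zpow_mul]; norm_cast
  rw [modeTerm_prod _ _ one_ne_zero, modeTerm_prod _ _ (pow_ne_zero 4 hy), modeTerm_prod _ _ hy, h1,
    WIx.twine, WIx.J, WIx.L, zpow_add₀ hy, zpow_add₀ hy, zpow_one, h2, pow_add, pow_add, one_zpow,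
    one_pow, Units.val_one]
  ring

section TwineSum

variable {y q : ℂ} (hq : ‖q‖ < 1) (hy1 : 1 < ‖y‖) (hyq : ‖y‖ * ‖q‖ < 1)

include hq hy1 hyq

theorem hasSum_twine (c : Fin 1 → ℂˣ) (d : Fin 2 → ℂˣ) (hd : ∀ i, ‖(d i : ℂ)‖ = 1) :
    HasSum (fun i : WIx => i.twine c d * (y ^ i.J * q ^ i.L))
      (twineValue (c 0) (d 0) (d 1) y q) := by
  have hy : y ≠ 0 := by
    rintro rfl
    rw [norm_zero] at hy1
    linarith
  simp only [twine_eq c d hy]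
  obtain ⟨he, he'⟩ := hasSum_fermi_charge hq
  obtain ⟨ha, ha'⟩ := hasSum_fermi c (y := y ^ 4) hq
  obtain ⟨hb, hb'⟩ := hasSum_bose d hq hd hy1 hyq
  have hea := Summable.mul_norm he ha
  have h1 := he'.mul ha' hea.of_norm
  have h2 := (h1.mul hb' (Summable.mul_norm hea hb).of_norm).mul_left y
  rw [Fin.prod_univ_one, Fin.prod_univ_one, Fin.prod_univ_two, Fin.prod_univ_two, ← mul_assoc,
    ← mul_assoc, ← div_eq_mul_inv] at h2
  exact h2

end TwineSum

/-- An integer plus 1/2 has absolute value at least 1/2, and the remaining factors are signs. -/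
theorem norm_twine_ge (i : WIx) : 1 / 2 ≤ ‖i.twine 1 1‖ := by
  have h1 : ∀ {k : ℕ} (m : Multiset (ModeIx k)), (m.map (diagWeight (1 : Fin k → ℂˣ))).prod = 1 := by
    intro k m
    refine Multiset.prod_eq_one fun u hu => ?_
    obtain ⟨j, -, rfl⟩ := Multiset.mem_map.1 hu
    rcases j with ⟨j, n⟩ | ⟨j, n⟩ <;> simp [diagWeight]
  rw [WIx.twine, h1, h1]
  generalize (i.1.1.1.map charge).sum = n
  simp only [Units.val_one, mul_one, norm_mul, norm_pow, norm_neg, norm_one, one_pow]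
  rw [show (1 / 2 + (n : ℂ)) = ((1 / 2 + n : ℝ) : ℂ) by push_cast; rfl, Complex.norm_real,
    Real.norm_eq_abs, le_abs]
  rcases le_or_gt 0 n with h | h
  · left
    have : (0 : ℝ) ≤ n := by exact_mod_cast h
    linarith
  · right
    have : (n : ℝ) ≤ -1 := by exact_mod_cast (by omega : n ≤ -1)
    linarith

/-- Finiteness follows from convergence: the series is summable at y = 2, q = 1/4, while its terms
in a fixed bidegree are bounded away from 0. -/
theorem finite_weight (p : ℤ × ℕ) : Finite {i : WIx // (i.J, i.L) = p} := by
  have hs := (hasSum_twine (q := 1 / 4) (y := 2) (by norm_num) (by norm_num) (by norm_num)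
    1 1 (by simp)).summable
  have hpos : 0 < 1 / 2 * ‖(2 : ℂ) ^ p.1 * (1 / 4 : ℂ) ^ p.2‖ := by
    have h2 : (2 : ℂ) ^ p.1 ≠ 0 := zpow_ne_zero _ two_ne_zero
    have h4 : (1 / 4 : ℂ) ^ p.2 ≠ 0 := pow_ne_zero _ (by norm_num)
    exact mul_pos one_half_pos (norm_pos_iff.2 (mul_ne_zero h2 h4))
  have h := hs.norm.tendsto_cofinite_zero.eventually (gt_mem_nhds hpos)
  rw [Filter.eventually_cofinite] at h
  refine (h.subset fun i hi => ?_ : {i : WIx | (i.J, i.L) = p}.Finite)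
  have hi' : (i.J, i.L) = p := hi
  subst hi'
  refine not_lt.2 ?_
  rw [norm_mul (i.twine 1 1)]
  exact mul_le_mul_of_nonneg_right (norm_twine_ge i) (norm_nonneg (_ : ℂ))

theorem bigraded_finiteDimensional (p : ℤ × ℕ) : FiniteDimensional ℂ (bigraded p) := by
  have := finite_weight p
  rw [bigraded_eq 1]
  exact Module.Finite.of_basis (weightBasis _ _ p)

/-! ### The coefficients of the trace function and their sum. -/

section Trace

variable {ϱ : G →* GL (Fin 1) ℂ} {ϱ' : G →* GL (Fin 2) ℂ} {g : G} {c : Fin 1 → ℂˣ} {h : GL (Fin 2) ℂ}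
  {d : Fin 2 → ℂˣ} (hc : ϱ g = diagGL c) (hd : ϱ' g = h * diagGL d * h⁻¹)

include hc hd

theorem twining_mem_bigraded (p : ℤ × ℕ) : ∀ w ∈ bigraded p, twining ϱ ϱ' g w ∈ bigraded p := by
  rw [bigraded_eq h]
  exact mapsTo_weightSpace _ (fun i => wBasis_twining h i hc hd) _ p

theorem ψtilde_eq_sum (p : ℤ × ℕ) [Fintype {i : WIx // (i.J, i.L) = p}] : ψtilde ϱ ϱ' g p
    = ∑ i : {i : WIx // (i.J, i.L) = p}, -(i.1.twine c d + i.1.twine c⁻¹ d⁻¹) := by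
  rw [ψtilde, bigraded_eq h, traceOn_weightSpace (wBasis h) (fun i => wBasis_twining h i hc hd),
    Finset.sum_neg_distrib]

theorem ψtilde_eq_zero (n : ℕ) (m : ℤ) (hm : 1 + 4 * (n : ℤ) < m) : ψtilde ϱ ϱ' g (m, n) = 0 := by
  have : IsEmpty {i : WIx // (i.J, i.L) = (m, n)} := ⟨fun i => by
    have h1 := i.1.J_le
    have h2 := Prod.ext_iff.1 i.2
    simp only at h2
    rw [h2.1, h2.2] at h1
    omega⟩
  have := Fintype.ofIsEmpty (α := {i : WIx // (i.J, i.L) = (m, n)})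
  rw [ψtilde_eq_sum hc hd, Finset.univ_eq_empty, Finset.sum_empty]

/-- The sum over the basis is grouped by bidegree into finite fibres, each of which sums to a trace.
The two values belong to g and g⁻¹. -/
theorem hasSum_ψtilde (hd1 : ∀ i, ‖(d i : ℂ)‖ = 1) {y q : ℂ} (hq : ‖q‖ < 1) (hy1 : 1 < ‖y‖)
    (hyq : ‖y‖ * ‖q‖ < 1) : HasSum (fun p : ℤ × ℕ => ψtilde ϱ ϱ' g p * (y ^ p.1 * q ^ p.2))
      (-(twineValue (c 0) (d 0) (d 1) y q
        + twineValue (c 0 : ℂ)⁻¹ (d 0 : ℂ)⁻¹ (d 1 : ℂ)⁻¹ y q)) := by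
  have h1 := hasSum_twine hq hy1 hyq c d hd1
  have h2 := hasSum_twine hq hy1 hyq c⁻¹ d⁻¹ (fun i => by
    rw [Pi.inv_apply, Units.val_inv_eq_inv_val, norm_inv, hd1, inv_one])
  have h3 := (h1.add h2).neg
  rw [← Equiv.hasSum_iff (Equiv.sigmaFiberEquiv fun i : WIx => (i.J, i.L))] at h3
  simp only [Pi.inv_apply, Units.val_inv_eq_inv_val] at h3
  refine h3.sigma fun p => ?_
  have := finite_weight p
  have := Fintype.ofFinite {i : WIx // (i.J, i.L) = p}
  rw [ψtilde_eq_sum hc hd, Finset.sum_mul]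
  convert hasSum_fintype _ using 1
  refine Finset.sum_congr rfl fun i _ => ?_
  have hi := Prod.ext_iff.1 i.2
  simp only at hi
  simp only [Function.comp_apply, Equiv.sigmaFiberEquiv_apply]
  rw [← hi.1, ← hi.2]
  ring

end Trace

/-! ## Theta functions -/

theorem e_add (x y : ℂ) : e (x + y) = e x * e y := by
  rw [e, e, e, ← Complex.exp_add]
  ring_nf

theorem e_ne_zero (x : ℂ) : e x ≠ 0 := Complex.exp_ne_zero _

theorem e_neg (x : ℂ) : e (-x) = (e x)⁻¹ := by
  rw [e, e, ← Complex.exp_neg]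
  ring_nf

theorem e_of_eq_nat_mul {x y : ℂ} (n : ℕ) (h : y = n * x) : e y = e x ^ n := by
  rw [h, e, e, ← Complex.exp_nat_mul]
  ring_nf

theorem norm_e (x : ℂ) : ‖e x‖ = Real.exp (-(2 * Real.pi * x.im)) := by
  rw [e, Complex.norm_exp]
  simp

theorem e_one_fourth : e (1 / 4) = Complex.I := by
  rw [e, show 2 * Real.pi * Complex.I * (1 / 4) = Real.pi / 2 * Complex.I by ring,
    Complex.exp_pi_div_two_mul_I]

theorem e_one_third : e (1 / 3) = b3 := by
  have h : (2 * Real.pi * Complex.I * (1 / 3) : ℂ) = ((Real.pi - Real.pi / 3 : ℝ) : ℂ) * Complex.I := by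
    push_cast
    ring
  rw [e, h, Complex.exp_mul_I, ← Complex.ofReal_cos, ← Complex.ofReal_sin, Real.cos_pi_sub,
    Real.sin_pi_sub, Real.cos_pi_div_three, Real.sin_pi_div_three, b3]
  push_cast
  ring

theorem norm_b3 : ‖b3‖ = 1 := by
  rw [← e_one_third, norm_e]
  simp

theorem b3_sq_add : b3 ^ 2 + b3 + 1 = 0 := by
  have h : (Real.sqrt 3 : ℂ) ^ 2 = 3 := by
    rw [← Complex.ofReal_pow, Real.sq_sqrt (by norm_num)]
    norm_num
  rw [b3]
  linear_combination (Complex.I ^ 2 / 4) * h + (3 / 4) * Complex.I_sq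

theorem conj_b3 : starRingEnd ℂ b3 = b3 ^ 2 := by
  have h : starRingEnd ℂ b3 = -1 - b3 := by
    simp only [b3, map_div₀, map_add, map_neg, map_one, map_mul, Complex.conj_ofReal,
      Complex.conj_I, map_ofNat]
    ring
  linear_combination h - b3_sq_add

/-- The product `∏_{n > 0} (1 - y⁻¹ q^{n-1}) (1 - y q^n)`. -/
def thetaProd (y q : ℂ) : ℂ := qprod (y * q) q * qprod y⁻¹ q

section ThetaProd

variable {q : ℂ} (hq : ‖q‖ < 1)

include hq

theorem thetaProd_mul_neg (y : ℂ) :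
    thetaProd y q * thetaProd (-y) q = thetaProd (y ^ 2) (q ^ 2) := by
  rw [thetaProd, thetaProd, thetaProd, ← mul_pow, ← inv_pow, ← qprod_mul_neg hq,
    ← qprod_mul_neg hq, neg_mul, inv_neg]
  ring

theorem thetaProd_mul_cube {ω : ℂ} (hω : ω ^ 2 + ω + 1 = 0) (y : ℂ) :
    thetaProd y q * thetaProd (ω * y) q * thetaProd (ω ^ 2 * y) q = thetaProd (y ^ 3) (q ^ 3) := by
  have h3 : ω * ω ^ 2 = 1 := by linear_combination (ω - 1) * hω
  have h1 : ω⁻¹ = ω ^ 2 := inv_eq_of_mul_eq_one_right h3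
  have h2 : (ω ^ 2)⁻¹ = ω := inv_eq_of_mul_eq_one_left h3
  rw [thetaProd, thetaProd, thetaProd, thetaProd, ← mul_pow, ← inv_pow, ← qprod_mul_cube hq hω,
    ← qprod_mul_cube hq hω, mul_inv, mul_inv, h1, h2]
  simp only [mul_assoc]
  ring

theorem thetaProd_ne_zero {y : ℂ} (hy1 : 1 < ‖y‖) (hyq : ‖y‖ * ‖q‖ < 1) : thetaProd y q ≠ 0 :=
  mul_ne_zero (qprod_ne_zero hq (by rwa [norm_mul]))
    (qprod_ne_zero hq (by rw [norm_inv]; exact inv_lt_one_of_one_lt₀ hy1))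

theorem tprod_theta (y : ℂ) :
    ∏' n : ℕ, (1 - y⁻¹ * q ^ n) * (1 - y * q ^ (n + 1)) * (1 - q ^ (n + 1))
      = thetaProd y q * qprod q q := by
  simp only [pow_succ', ← mul_assoc]
  have h1 := multipliable_qprod hq y⁻¹
  have h2 := multipliable_qprod hq (y * q)
  rw [(h1.mul h2).tprod_mul (multipliable_qprod hq q), h1.tprod_mul h2, mul_comm (∏' _, _),
    thetaProd]
  rfl

end ThetaProd

theorem twineValue_eq (c d₀ d₁ y q : ℂ) : twineValue c d₀ d₁ y q
    = y * qprod q q ^ 2 * thetaProd (c * y ^ 4) q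
      / (thetaProd (d₀ * y) q * thetaProd (d₁ * y) q) := by
  simp only [twineValue, thetaProd, mul_inv]
  congr 1
  ring

section Theta

variable {τ : ℂ} (hq : ‖e τ‖ < 1)

include hq

theorem θ1_eq (z : ℂ) : θ1 τ z
    = -Complex.I * e (τ / 8) * e (z / 2) * (thetaProd (e z) (e τ) * qprod (e τ) (e τ)) := by
  rw [θ1, tprod_theta hq]

theorem θ2_eq (z : ℂ) : θ2 τ z
    = e (τ / 8) * e (z / 2) * (thetaProd (-e z) (e τ) * qprod (e τ) (e τ)) := by
  rw [θ2, ← tprod_theta hq]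
  simp only [inv_neg, neg_mul, sub_neg_eq_add]

omit hq in
theorem eta_eq : ModularForm.eta τ = e (τ / 24) * qprod (e τ) (e τ) := by
  have h : Function.Periodic.qParam 24 τ = e (τ / 24) := by
    rw [Function.Periodic.qParam, e]
    push_cast
    ring_nf
  have h1 : Function.Periodic.qParam 1 τ = e τ := by
    rw [Function.Periodic.qParam, e]
    push_cast
    ring_nf
  rw [ModularForm.eta, h, qprod]
  simp only [ModularForm.eta_q, h1, pow_succ']

/-- All fractional powers are expressed through e (τ/24), e (z/2) and e (w/2), so that the
comparisons below become rational identities. -/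
theorem θ1_nat_mul_add (n : ℕ) (z w : ℂ) : θ1 τ (n * z + w)
    = -Complex.I * e (τ / 24) ^ 3 * (e (z / 2) ^ n * e (w / 2))
      * (thetaProd (e w * e z ^ n) (e τ) * qprod (e τ) (e τ)) := by
  rw [θ1_eq hq, add_div, e_add, e_add, ← e_of_eq_nat_mul (x := τ / 24) 3 (y := τ / 8)
    (by push_cast; ring), e_of_eq_nat_mul (x := z / 2) n (y := n * z / 2) (by ring),
    e_of_eq_nat_mul (x := z) n rfl, mul_comm (e w)]

theorem θ1_nat_mul (n : ℕ) (z : ℂ) : θ1 τ (n * z)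
    = -Complex.I * e (τ / 24) ^ 3 * e (z / 2) ^ n
      * (thetaProd (e z ^ n) (e τ) * qprod (e τ) (e τ)) := by
  rw [θ1_eq hq, ← e_of_eq_nat_mul (x := τ / 24) 3 (y := τ / 8)
    (by push_cast; ring), e_of_eq_nat_mul (x := z / 2) n (y := n * z / 2) (by ring),
    e_of_eq_nat_mul (x := z) n rfl]

/-- `θ_1(nτ, nz)`. -/
theorem θ1_nat_mul_nat_mul {n : ℕ} (hn : n ≠ 0) (z : ℂ) : θ1 (n * τ) (n * z)
    = -Complex.I * e (τ / 24) ^ (3 * n) * e (z / 2) ^ n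
      * (thetaProd (e z ^ n) (e τ ^ n) * qprod (e τ ^ n) (e τ ^ n)) := by
  rw [θ1_eq, e_of_eq_nat_mul (x := τ / 24) (3 * n) (y := n * τ / 8) (by push_cast; ring),
    e_of_eq_nat_mul (x := z / 2) n (y := n * z / 2) (by ring), e_of_eq_nat_mul (x := z) n rfl,
    e_of_eq_nat_mul (x := τ) n rfl]
  rw [e_of_eq_nat_mul (x := τ) n rfl, norm_pow]
  exact pow_lt_one₀ (norm_nonneg _) hq hn

/-- `θ_2(nτ, nz)`. -/
theorem θ2_nat_mul_nat_mul {n : ℕ} (hn : n ≠ 0) (z : ℂ) : θ2 (n * τ) (n * z)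
    = e (τ / 24) ^ (3 * n) * e (z / 2) ^ n
      * (thetaProd (-e z ^ n) (e τ ^ n) * qprod (e τ ^ n) (e τ ^ n)) := by
  rw [θ2_eq, e_of_eq_nat_mul (x := τ / 24) (3 * n) (y := n * τ / 8) (by push_cast; ring),
    e_of_eq_nat_mul (x := z / 2) n (y := n * z / 2) (by ring), e_of_eq_nat_mul (x := z) n rfl,
    e_of_eq_nat_mul (x := τ) n rfl]
  rw [e_of_eq_nat_mul (x := τ) n rfl, norm_pow]
  exact pow_lt_one₀ (norm_nonneg _) hq hn

omit hq in
theorem eta_nat_mul (n : ℕ) :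
    ModularForm.eta (n * τ) = e (τ / 24) ^ n * qprod (e τ ^ n) (e τ ^ n) := by
  rw [eta_eq, e_of_eq_nat_mul (x := τ / 24) n (y := n * τ / 24) (by ring),
    e_of_eq_nat_mul (x := τ) n rfl]

theorem qprod_self_ne_zero : qprod (e τ) (e τ) ≠ 0 := qprod_ne_zero hq hq

end Theta

/-! ### The theta quotients as values of the trace functions, class by class. -/

section Classes

variable {τ z : ℂ} (hz : 0 < -z.im) (hzτ : -z.im < τ.im)

theorem one_lt_norm_e (hz : 0 < -z.im) : 1 < ‖e z‖ := by
  rw [norm_e, Real.one_lt_exp_iff]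
  nlinarith [Real.pi_pos]

theorem norm_e_lt_one (hτ : 0 < τ.im) : ‖e τ‖ < 1 := by
  rw [norm_e, Real.exp_lt_one_iff]
  nlinarith [Real.pi_pos]

theorem norm_e_mul_lt_one (hzτ : -z.im < τ.im) : ‖e z‖ * ‖e τ‖ < 1 := by
  rw [← norm_mul, ← e_add]
  exact norm_e_lt_one (by rw [Complex.add_im]; linarith)

include hz hzτ

theorem thetaProd_mul_e_ne_zero {a : ℂ} (ha : ‖a‖ = 1) : thetaProd (a * e z) (e τ) ≠ 0 := by
  refine thetaProd_ne_zero (norm_e_lt_one (hz.trans hzτ)) ?_ ?_ <;> rw [norm_mul, ha, one_mul]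
  exacts [one_lt_norm_e hz, norm_e_mul_lt_one hzτ]

/-- The eigenvalues equal their inverses, so both trace values agree; this is the factor 2. The same
holds for `2A`. -/
theorem ψcls_1A : ψcls .c1A τ z
    = -(twineValue 1 1 1 (e z) (e τ) + twineValue (1 : ℂ)⁻¹ (1 : ℂ)⁻¹ (1 : ℂ)⁻¹ (e z) (e τ)) := by
  have hq := norm_e_lt_one (hz.trans hzτ)
  have h1 := thetaProd_mul_e_ne_zero hz hzτ (a := 1) (by simp)
  have h4 := θ1_nat_mul hq 4 z
  have h := θ1_nat_mul hq 1 z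
  have hQ := qprod_self_ne_zero hq
  have hE := e_ne_zero (τ / 24)
  have hu := e_ne_zero (z / 2)
  have hy : e z = e (z / 2) ^ 2 := e_of_eq_nat_mul 2 (by push_cast; ring)
  rw [Nat.cast_one, one_mul, pow_one, pow_one] at h
  push_cast at h4
  rw [ψcls, h4, h, eta_eq, inv_one, twineValue_eq, one_mul, one_mul]
  rw [one_mul] at h1
  generalize thetaProd (e z) (e τ) = T at *
  generalize thetaProd (e z ^ 4) (e τ) = T₄ at *
  rw [hy]
  field_simp
  ring

theorem ψcls_2A : ψcls .c2A τ z = -(twineValue 1 (-1) (-1) (e z) (e τ)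
    + twineValue (1 : ℂ)⁻¹ (-1 : ℂ)⁻¹ (-1 : ℂ)⁻¹ (e z) (e τ)) := by
  have hq := norm_e_lt_one (hz.trans hzτ)
  have h1 := thetaProd_mul_e_ne_zero hz hzτ (a := -1) (by simp)
  have h4 := θ1_nat_mul hq 4 z
  have h := θ2_nat_mul_nat_mul hq one_ne_zero z
  have hQ := qprod_self_ne_zero hq
  have hE := e_ne_zero (τ / 24)
  have hu := e_ne_zero (z / 2)
  have hy : e z = e (z / 2) ^ 2 := e_of_eq_nat_mul 2 (by push_cast; ring)
  simp only [Nat.cast_one, one_mul, pow_one] at h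
  push_cast at h4
  rw [ψcls, h4, h, eta_eq, inv_one, inv_neg, inv_one, twineValue_eq, one_mul, neg_one_mul]
  rw [neg_one_mul] at h1
  generalize thetaProd (-e z) (e τ) = T at *
  generalize thetaProd (e z ^ 4) (e τ) = T₄ at *
  rw [hy]
  field_simp
  linear_combination (2 * e (τ / 24) ^ 6 * T₄) * Complex.I_sq

/-- The theta products at iy and −iy multiply to one at −y² and q², which belongs to θ_2(2τ, 2z).
Inversion exchanges i and −i, so both trace values agree. -/
theorem ψcls_4A : ψcls .c4A τ z = -(twineValue 1 Complex.I (-Complex.I) (e z) (e τ)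
    + twineValue (1 : ℂ)⁻¹ (Complex.I)⁻¹ (-Complex.I)⁻¹ (e z) (e τ)) := by
  have hq := norm_e_lt_one (hz.trans hzτ)
  have h1 := thetaProd_mul_e_ne_zero hz hzτ (a := Complex.I) (by simp)
  have h2 := thetaProd_mul_e_ne_zero hz hzτ (a := -Complex.I) (by simp)
  have h4 := θ1_nat_mul hq 4 z
  have h := θ2_nat_mul_nat_mul hq two_ne_zero z
  have h' := eta_nat_mul (τ := τ) 2
  have hQ : qprod (e τ ^ 2) (e τ ^ 2) ≠ 0 := by
    have : ‖e τ ^ 2‖ < 1 := by rw [norm_pow]; exact pow_lt_one₀ (norm_nonneg _) hq two_ne_zero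
    exact qprod_ne_zero this this
  have hE := e_ne_zero (τ / 24)
  have hu := e_ne_zero (z / 2)
  have hy : e z = e (z / 2) ^ 2 := e_of_eq_nat_mul 2 (by push_cast; ring)
  have hT := thetaProd_mul_neg hq (Complex.I * e z)
  rw [mul_pow, Complex.I_sq, neg_one_mul, ← neg_mul] at hT
  push_cast at h4 h h'
  rw [ψcls, h4, h, h', eta_eq, ← hT, inv_one, inv_neg, Complex.inv_I, neg_neg, twineValue_eq,
    twineValue_eq, one_mul]
  generalize thetaProd (Complex.I * e z) (e τ) = T at *
  generalize thetaProd (-Complex.I * e z) (e τ) = T' at *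
  generalize thetaProd (e z ^ 4) (e τ) = T₄ at *
  rw [hy]
  field_simp
  linear_combination (2 * qprod (e τ) (e τ) ^ 2 * T₄) * Complex.I_sq

/-- Each denominator contains two of the three cube roots of unity. Supplying the third produces
θ_1(3τ, 3z) below and θ_1(τ, z ∓ 1/3) above; the two summands come from g and g⁻¹. -/
theorem ψcls_3A : ψcls .c3A τ z = -(twineValue b3 1 b3 (e z) (e τ)
    + twineValue b3⁻¹ (1 : ℂ)⁻¹ b3⁻¹ (e z) (e τ)) := by
  have hq := norm_e_lt_one (hz.trans hzτ)
  have h0 := thetaProd_mul_e_ne_zero hz hzτ (a := 1) (by simp)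
  have h1 := thetaProd_mul_e_ne_zero hz hzτ (a := b3) norm_b3
  have h2 := thetaProd_mul_e_ne_zero hz hzτ (a := b3 ^ 2) (by rw [norm_pow, norm_b3, one_pow])
  have hQ : qprod (e τ ^ 3) (e τ ^ 3) ≠ 0 := by
    have : ‖e τ ^ 3‖ < 1 := by rw [norm_pow]; exact pow_lt_one₀ (norm_nonneg _) hq three_ne_zero
    exact qprod_ne_zero this this
  have hE := e_ne_zero (τ / 24)
  have hu := e_ne_zero (z / 2)
  have hy : e z = e (z / 2) ^ 2 := e_of_eq_nat_mul 2 (by push_cast; ring)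
  have hT := thetaProd_mul_cube hq b3_sq_add (e z)
  have hb : b3⁻¹ = b3 ^ 2 := inv_eq_of_mul_eq_one_right (by linear_combination (b3 - 1) * b3_sq_add)
  have e1 : e (-1 / 3) = b3 ^ 2 := by rw [neg_div, e_neg, e_one_third, hb]
  have e2 : e (-1 / 3 / 2) = (e (1 / 3 / 2))⁻¹ := by rw [neg_div, neg_div, e_neg]
  have h41 := θ1_nat_mul_add hq 4 z (1 / 3)
  have h42 := θ1_nat_mul_add hq 4 z (-1 / 3)
  have h11 := θ1_nat_mul_add hq 1 z (1 / 3)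
  have h12 := θ1_nat_mul_add hq 1 z (-1 / 3)
  have h := θ1_nat_mul_nat_mul hq three_ne_zero z
  have h' := eta_nat_mul (τ := τ) 3
  simp only [Nat.cast_ofNat, Nat.cast_one, one_mul, pow_one, neg_div, ← sub_eq_add_neg]
    at h41 h42 h11 h12 h h' e1 e2
  have hζ := e_ne_zero (1 / 3 / 2)
  rw [ψcls, h41, h42, h11, h12, h, h', ← hT, e1, e2, e_one_third, inv_one, hb, twineValue_eq,
    twineValue_eq, one_mul]
  rw [one_mul] at h0
  generalize thetaProd (e z) (e τ) = T at *
  generalize thetaProd (b3 * e z) (e τ) = T' at *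
  generalize thetaProd (b3 ^ 2 * e z) (e τ) = T'' at *
  generalize thetaProd (b3 * e z ^ 4) (e τ) = U at *
  generalize thetaProd (b3 ^ 2 * e z ^ 4) (e τ) = U' at *
  rw [hy]
  generalize e (1 / 3 / 2) = ζ at *
  field_simp
  linear_combination e (τ / 24) ^ 9 * qprod (e τ) (e τ) ^ 2 * (T'' * U + T' * U') * Complex.I_sq

/-- The argument for `3A` with −y in the denominators. The missing factors sit at −b_3² = e(1/6) and
−b_3 = e(−1/6), hence the shifts of z by 1/6. -/
theorem ψcls_6A : ψcls .c6A τ z = -(twineValue b3 (-1) (-b3) (e z) (e τ)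
    + twineValue b3⁻¹ (-1 : ℂ)⁻¹ (-b3)⁻¹ (e z) (e τ)) := by
  have hq := norm_e_lt_one (hz.trans hzτ)
  have h0 := thetaProd_mul_e_ne_zero hz hzτ (a := -1) (by simp)
  have h1 := thetaProd_mul_e_ne_zero hz hzτ (a := -b3) (by rw [norm_neg, norm_b3])
  have h2 := thetaProd_mul_e_ne_zero hz hzτ (a := -b3 ^ 2)
    (by rw [norm_neg, norm_pow, norm_b3, one_pow])
  have hQ : qprod (e τ ^ 3) (e τ ^ 3) ≠ 0 := by
    have : ‖e τ ^ 3‖ < 1 := by rw [norm_pow]; exact pow_lt_one₀ (norm_nonneg _) hq three_ne_zero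
    exact qprod_ne_zero this this
  have hE := e_ne_zero (τ / 24)
  have hu := e_ne_zero (z / 2)
  have hy : e z = e (z / 2) ^ 2 := e_of_eq_nat_mul 2 (by push_cast; ring)
  have hT := thetaProd_mul_cube hq b3_sq_add (-e z)
  have hb : b3⁻¹ = b3 ^ 2 := inv_eq_of_mul_eq_one_right (by linear_combination (b3 - 1) * b3_sq_add)
  have e1 : e (-1 / 3) = b3 ^ 2 := by rw [neg_div, e_neg, e_one_third, hb]
  -- All roots of unity that occur, including the square roots from the prefactors e (w/2), are
  -- powers of ζ = e(1/12), and ζ³ = i, ζ⁴ = b_3.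
  have hζ3 : e (1 / 6 / 2) ^ 3 = Complex.I := by
    rw [← e_of_eq_nat_mul 3 (y := 1 / 4) (by norm_num), e_one_fourth]
  have hζ4 : e (1 / 6 / 2) ^ 4 = b3 := by
    rw [← e_of_eq_nat_mul 4 (y := 1 / 3) (by norm_num), e_one_third]
  have e3 : e (1 / 3 / 2) = e (1 / 6 / 2) ^ 2 := e_of_eq_nat_mul 2 (by norm_num)
  have e4 : e (1 / 6) = -b3 ^ 2 := by
    rw [← hζ4, e_of_eq_nat_mul 2 (x := 1 / 6 / 2) (by norm_num)]
    linear_combination (e (1 / 6 / 2) ^ 2 * (e (1 / 6 / 2) ^ 3 + Complex.I)) * hζ3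
      + e (1 / 6 / 2) ^ 2 * Complex.I_sq
  have e5 : e (-1 / 6) = -b3 := by
    rw [neg_div, e_neg, e4]
    exact inv_eq_of_mul_eq_one_right (by linear_combination (b3 - 1) * b3_sq_add)
  have e2 : e (-1 / 3 / 2) = (e (1 / 6 / 2) ^ 2)⁻¹ := by rw [neg_div, neg_div, e_neg, e3]
  have e6 : e (-1 / 6 / 2) = (e (1 / 6 / 2))⁻¹ := by rw [neg_div, neg_div, e_neg]
  have h41 := θ1_nat_mul_add hq 4 z (1 / 3)
  have h42 := θ1_nat_mul_add hq 4 z (-1 / 3)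
  have h11 := θ1_nat_mul_add hq 1 z (1 / 6)
  have h12 := θ1_nat_mul_add hq 1 z (-1 / 6)
  have h := θ2_nat_mul_nat_mul hq three_ne_zero z
  have h' := eta_nat_mul (τ := τ) 3
  rw [show (-e z) ^ 3 = -e z ^ 3 by ring, mul_neg, mul_neg, ← neg_mul, ← neg_mul] at hT
  simp only [Nat.cast_ofNat, Nat.cast_one, one_mul, pow_one, neg_div, ← sub_eq_add_neg]
    at h41 h42 h11 h12 h h' e1 e2 e5 e6
  have hζ := e_ne_zero (1 / 6 / 2)
  rw [ψcls, h41, h42, h11, h12, h, h', ← hT, e1, e2, e3, e4, e5, e6, e_one_third, inv_neg, inv_neg,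
    inv_one, hb, twineValue_eq, twineValue_eq, neg_one_mul]
  rw [neg_one_mul] at h0
  generalize thetaProd (-e z) (e τ) = T at *
  generalize thetaProd (-b3 * e z) (e τ) = T' at *
  generalize thetaProd (-b3 ^ 2 * e z) (e τ) = T'' at *
  generalize thetaProd (b3 * e z ^ 4) (e τ) = U at *
  generalize thetaProd (b3 ^ 2 * e z ^ 4) (e τ) = U' at *
  rw [hy]
  generalize e (1 / 6 / 2) = ζ at *
  field_simp
  linear_combination e (τ / 24) ^ 9 * qprod (e τ) (e τ) ^ 2 *
    (T'' * U * ((1 - Complex.I ^ 3 * (ζ ^ 3 + Complex.I)) * hζ3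
        + Complex.I * (1 - Complex.I ^ 2) * Complex.I_sq)
      + T' * U' * (hζ3 + Complex.I * Complex.I_sq))

end Classes


/-! ## The eigenvalues of group elements -/

theorem sl_sq_eq_one : ∀ g : G, g ^ 2 = 1 → g = 1 ∨ g = -1 := by decide +kernel

/-- The orders in SL_2(3) are 1, 2, 3, 4 and 6, and the elements of order 6 are the negatives of
those of order 3. -/
theorem sl_pow_eq_one : ∀ g : G, g ^ 4 = 1 ∨ (-g) ^ 3 = 1 ∨ g ^ 3 = 1 := by decide +kernel

theorem sl_neg_one_ne_one : (-1 : G) ≠ 1 := by decide +kernel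

theorem orderOf_neg_one : orderOf (-1 : G) = 2 :=
  orderOf_eq_prime (by simp) sl_neg_one_ne_one

theorem trace_sq (A : Matrix (Fin 2) (Fin 2) ℂ) : (A ^ 2).trace = A.trace ^ 2 - 2 * A.det := by
  simp only [pow_two, Matrix.trace_fin_two, Matrix.det_fin_two, Matrix.mul_apply, Fin.sum_univ_two]
  ring

theorem trace_cube (A : Matrix (Fin 2) (Fin 2) ℂ) :
    (A ^ 3).trace = A.trace ^ 3 - 3 * A.trace * A.det := by
  simp only [pow_succ, pow_zero, one_mul, Matrix.trace_fin_two, Matrix.det_fin_two,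
    Matrix.mul_apply, Fin.sum_univ_two]
  ring

theorem sq_eq_trace_smul_sub (A : Matrix (Fin 2) (Fin 2) ℂ) :
    A ^ 2 = A.trace • A - A.det • (1 : Matrix (Fin 2) (Fin 2) ℂ) := by
  ext i j
  fin_cases i <;> fin_cases j <;>
    simp [pow_two, Matrix.mul_apply, Matrix.trace_fin_two, Matrix.det_fin_two] <;> ring

/-- Trace and determinant make d 0 and d 1 the roots of the characteristic polynomial. As these are
distinct, the eigenvectors form the columns of an invertible h. -/
theorem exists_diagonalization {A : GL (Fin 2) ℂ} {d : Fin 2 → ℂˣ} (hd : d 0 ≠ d 1)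
    (ht : (A : Matrix (Fin 2) (Fin 2) ℂ).trace = d 0 + d 1)
    (hD : (A : Matrix (Fin 2) (Fin 2) ℂ).det = d 0 * d 1) :
    ∃ h : GL (Fin 2) ℂ, A = h * diagGL d * h⁻¹ := by
  have hex : ∀ i, ∃ v ≠ 0, (A : Matrix (Fin 2) (Fin 2) ℂ).mulVec v = (d i : ℂ) • v := by
    intro i
    have hdet : ((A : Matrix (Fin 2) (Fin 2) ℂ) - Matrix.scalar _ (d i : ℂ)).det = 0 := by
      rw [Matrix.det_fin_two] at hD ⊢
      rw [Matrix.trace_fin_two] at ht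
      fin_cases i <;> simp
      · linear_combination hD - (d 0 : ℂ) * ht
      · linear_combination hD - (d 1 : ℂ) * ht
    obtain ⟨v, hv, h⟩ := Matrix.exists_mulVec_eq_zero_iff.2 hdet
    refine ⟨v, hv, ?_⟩
    rw [Matrix.sub_mulVec, sub_eq_zero] at h
    rw [h, Matrix.scalar_apply, ← Matrix.smul_one_eq_diagonal, Matrix.smul_mulVec,
      Matrix.one_mulVec]
  choose v hv hAv using hex
  let P : Matrix (Fin 2) (Fin 2) ℂ := Matrix.of fun i j => v j i
  have hli : LinearIndependent ℂ v := by
    refine Module.End.eigenvectors_linearIndependent' (Matrix.mulVecLin A) (fun i => (d i : ℂ)) ?_ v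
      fun i => ⟨Module.End.mem_eigenspace_iff.2 (hAv i), hv i⟩
    intro i j hij
    have hij' : d i = d j := Units.ext hij
    fin_cases i <;> fin_cases j <;> first | rfl | exact absurd hij' hd | exact absurd hij'.symm hd
  have hP : IsUnit P := Matrix.linearIndependent_cols_iff_isUnit.1 hli
  obtain ⟨h, hh⟩ := hP
  refine ⟨h, eq_mul_inv_of_mul_eq (Units.ext ?_)⟩
  rw [Units.val_mul, Units.val_mul, hh]
  ext i j
  simp only [diagGL, Matrix.mul_diagonal]
  rw [Matrix.mul_apply]
  exact (congrFun (hAv j) i).trans (mul_comm _ _)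

theorem eq_diagGL_of_trace {A : GL (Fin 1) ℂ} {c : ℂˣ}
    (h : (A : Matrix (Fin 1) (Fin 1) ℂ).trace = c) : A = diagGL fun _ => c := by
  ext i j
  rw [Matrix.trace_fin_one] at h
  fin_cases i; fin_cases j
  simpa [diagGL] using h

/-- A primitive cube root of unity, `b_3` as a unit. -/
def b3Unit : ℂˣ := Units.mk0 b3 (norm_ne_zero_iff.1 (norm_b3.symm ▸ one_ne_zero))

theorem b3_inv : b3⁻¹ = b3 ^ 2 :=
  inv_eq_of_mul_eq_one_right (by linear_combination (b3 - 1) * b3_sq_add)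

/-- Replacing c by its inverse only exchanges the two summands, which is why `3A` and `3B` share one
function; likewise `6A` and `6B` below. -/
theorem ψcls_b3Unit {c : ℂˣ} (hc : c = b3Unit ∨ c = b3Unit⁻¹) {τ z : ℂ} (hz : 0 < -z.im)
    (hzτ : -z.im < τ.im) : ψcls .c3A τ z = -(twineValue c 1 c (e z) (e τ)
      + twineValue (c : ℂ)⁻¹ (1 : ℂ)⁻¹ (c : ℂ)⁻¹ (e z) (e τ)) := by
  rw [ψcls_3A hz hzτ]
  rcases hc with rfl | rfl
  · rfl
  · rw [Units.val_inv_eq_inv_val, inv_inv, inv_one, add_comm]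
    rfl

theorem ψcls_neg_b3Unit {c : ℂˣ} (hc : c = b3Unit ∨ c = b3Unit⁻¹) {τ z : ℂ} (hz : 0 < -z.im)
    (hzτ : -z.im < τ.im) : ψcls .c6A τ z = -(twineValue c (-1) (-c) (e z) (e τ)
      + twineValue (c : ℂ)⁻¹ (-1 : ℂ)⁻¹ (-c : ℂ)⁻¹ (e z) (e τ)) := by
  rw [ψcls_6A hz hzτ]
  rcases hc with rfl | rfl
  · rfl
  · simp only [Units.val_inv_eq_inv_val, inv_inv, inv_neg, inv_one]
    rw [add_comm]
    rfl

/-! ### Eigenvalues and faithfulness, read off from the characters. -/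

section Characters

variable {t : G} {ϱ : G →* GL (Fin 1) ℂ} {ϱ' : G →* GL (Fin 2) ℂ}
  (hϱ : ∀ g, (ϱ g : Matrix (Fin 1) (Fin 1) ℂ).trace = χ2 (cls t g))
  (hϱ' : ∀ g, (ϱ' g : Matrix (Fin 2) (Fin 2) ℂ).trace = χ6 (cls t g))

theorem cls_neg_one : cls t (-1) = .c2A := by
  rw [cls, if_neg (by rw [orderOf_neg_one]; decide), if_pos orderOf_neg_one]

include hϱ in
theorem rep_one_neg_one : ϱ (-1) = 1 := by
  have h : ϱ (-1) = diagGL fun _ => 1 :=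
    eq_diagGL_of_trace (by rw [hϱ, cls_neg_one, χ2, Units.val_one])
  rw [h]
  ext i j
  simp [diagGL, Matrix.one_apply]

include hϱ'

/-- Trace −2 and A² = 1 force det A = 1, and then Cayley–Hamilton reads 1 = −2A − 1. -/
theorem rep_two_neg_one : ϱ' (-1) = -1 := by
  have ht : (ϱ' (-1) : Matrix (Fin 2) (Fin 2) ℂ).trace = -2 := by rw [hϱ', cls_neg_one, χ6]
  have h2 : (ϱ' (-1) : Matrix (Fin 2) (Fin 2) ℂ) ^ 2 = 1 := by
    rw [← Units.val_pow_eq_pow_val, ← map_pow, neg_one_sq, map_one, Units.val_one]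
  have h3 := trace_sq (ϱ' (-1) : Matrix (Fin 2) (Fin 2) ℂ)
  rw [h2, ht, Matrix.trace_one, Fintype.card_fin] at h3
  have hD : (ϱ' (-1) : Matrix (Fin 2) (Fin 2) ℂ).det = 1 := by
    push_cast at h3
    linear_combination (1 / 2) * h3
  have h4 := sq_eq_trace_smul_sub (ϱ' (-1) : Matrix (Fin 2) (Fin 2) ℂ)
  rw [h2, ht, hD] at h4
  refine Units.ext (Matrix.ext fun i j => ?_)
  have h5 := congrFun (congrFun h4 i) j
  simp only [Matrix.sub_apply, Matrix.smul_apply, smul_eq_mul] at h5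
  simp only [Units.val_neg, Units.val_one, Matrix.neg_apply]
  linear_combination (1 / 2) * h5

theorem rep_two_neg (g : G) : ϱ' (-g) = -ϱ' g := by
  rw [← neg_one_mul, map_mul, rep_two_neg_one hϱ', neg_one_mul]

/-- The value 2 of χ_6 occurs only at the identity: the other values are −2, 0 and numbers of norm
1. -/
theorem rep_two_eq_one {g : G} (h : ϱ' g = 1) : g = 1 := by
  have h1 := hϱ' g
  have hn : ∀ z : ℂ, ‖z‖ = 1 → z ≠ 2 := fun z hz h => by
    rw [h] at hz
    norm_num at hz
  have hb : ‖starRingEnd ℂ b3‖ = 1 := by rw [Complex.norm_conj, norm_b3]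
  rw [h, Units.val_one, Matrix.trace_one, Fintype.card_fin, Nat.cast_ofNat] at h1
  have h2 : cls t g = .c1A := by
    cases hg : cls t g <;> simp only [hg, χ6] at h1
    · rfl
    · norm_num at h1
    · norm_num at h1
    · exact absurd h1.symm (hn _ (by rw [norm_neg, hb]))
    · exact absurd h1.symm (hn _ norm_b3)
    · exact absurd h1.symm (hn _ (by rw [norm_neg, norm_b3]))
    · exact absurd h1.symm (hn _ hb)
  unfold cls at h2
  split_ifs at h2 with h3
  exact orderOf_eq_one_iff.1 h3

include hϱ

/-- The eigenvalues of an element of order `3`. -/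
theorem exists_diag_of_order_three {g : G} (hg : orderOf g = 3) : ∃ (c : ℂˣ) (h : GL (Fin 2) ℂ),
    (c = b3Unit ∧ IsConj t g ∨ c = b3Unit⁻¹ ∧ ¬ IsConj t g) ∧ ϱ g = diagGL (fun _ => c) ∧
      ϱ' g = h * diagGL ![1, c] * h⁻¹ := by
  have hcls : cls t g = if IsConj t g then .c3A else .c3B := by
    simp [cls, hg]
  -- On `3A` and `3B` the characters are c and −c² = 1 + c for a primitive cube root of unity c.
  obtain ⟨c, hc, hc3, h1, h2⟩ : ∃ c : ℂˣ,
      (c = b3Unit ∧ IsConj t g ∨ c = b3Unit⁻¹ ∧ ¬ IsConj t g) ∧ (c : ℂ) ^ 2 + c + 1 = 0 ∧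
      χ2 (cls t g) = c ∧ χ6 (cls t g) = 1 + c := by
    by_cases h : IsConj t g
    · refine ⟨b3Unit, .inl ⟨rfl, h⟩, b3_sq_add, ?_, ?_⟩
      · rw [hcls, if_pos h]
        rfl
      · rw [hcls, if_pos h, χ6, conj_b3]
        change _ = 1 + b3
        linear_combination -b3_sq_add
    · have hv : ((b3Unit⁻¹ : ℂˣ) : ℂ) = b3 ^ 2 := by
        rw [Units.val_inv_eq_inv_val, ← b3_inv]
        rfl
      refine ⟨b3Unit⁻¹, .inr ⟨rfl, h⟩, ?_, ?_, ?_⟩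
      · rw [hv]
        linear_combination (b3 ^ 2 - b3 + 1) * b3_sq_add
      · rw [hcls, if_neg h, χ2, conj_b3, hv]
      · rw [hcls, if_neg h, χ6, hv]
        linear_combination -b3_sq_add
  have hc1 : (1 : ℂˣ) ≠ c := fun h => by
    rw [← h, Units.val_one] at hc3
    norm_num at hc3
  have ht := (hϱ' g).trans h2
  have h3 := trace_cube (ϱ' g : Matrix (Fin 2) (Fin 2) ℂ)
  have hg3 : g ^ 3 = 1 := by
    have h := pow_orderOf_eq_one g
    rwa [hg] at h
  rw [← Units.val_pow_eq_pow_val, ← map_pow, hg3, map_one, Units.val_one, ht,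
    Matrix.trace_one, Fintype.card_fin, Nat.cast_ofNat] at h3
  -- The determinant is not given. Inserting A³ = 1 and the trace 1 + c = −c² into `trace_cube`
  -- yields det A = c.
  obtain ⟨h, hh⟩ := exists_diagonalization (A := ϱ' g) (d := ![1, c]) hc1 (by simpa using ht) (by
    simp only [Matrix.cons_val_zero, Matrix.cons_val_one, Units.val_one, one_mul]
    linear_combination (-(c : ℂ) / 3) * h3
      + ((ϱ' g : Matrix (Fin 2) (Fin 2) ℂ).det - c * (c + 2) / 3) * hc3)
  exact ⟨c, h, hc, eq_diagGL_of_trace ((hϱ g).trans h1), hh⟩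

/-- The elements of `SL_2(3)` act diagonalizably, and their eigenvalues yield the meromorphic Jacobi
forms. -/
theorem exists_diag_ψcls (g : G) : ∃ (c : Fin 1 → ℂˣ) (d : Fin 2 → ℂˣ) (h : GL (Fin 2) ℂ),
    ϱ g = diagGL c ∧ ϱ' g = h * diagGL d * h⁻¹ ∧ (∀ i, ‖(d i : ℂ)‖ = 1) ∧
      ∀ τ z : ℂ, 0 < -z.im → -z.im < τ.im → ψcls (cls t g) τ z
        = -(twineValue (c 0) (d 0) (d 1) (e z) (e τ)
          + twineValue (c 0 : ℂ)⁻¹ (d 0 : ℂ)⁻¹ (d 1 : ℂ)⁻¹ (e z) (e τ)) := by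
  have hu : ∀ {c : ℂˣ} {P Q : Prop}, (c = b3Unit ∧ P ∨ c = b3Unit⁻¹ ∧ Q) →
      (c = b3Unit ∨ c = b3Unit⁻¹) ∧ ‖(c : ℂ)‖ = 1 := by
    rintro c P Q (⟨rfl, -⟩ | ⟨rfl, -⟩)
    · exact ⟨.inl rfl, norm_b3⟩
    · refine ⟨.inr rfl, ?_⟩
      rw [Units.val_inv_eq_inv_val, norm_inv]
      exact inv_eq_one.2 norm_b3
  have h1 : diagGL (fun _ : Fin 2 => (1 : ℂˣ)) = 1 := by
    ext i j
    simp [diagGL, Matrix.one_apply]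
  by_cases ho1 : orderOf g = 1
  · have hcls : cls t g = .c1A := by simp [cls, ho1]
    have hg := orderOf_eq_one_iff.1 ho1
    refine ⟨fun _ => 1, fun _ => 1, 1, eq_diagGL_of_trace ?_, ?_, by simp, fun τ z hz hzτ => ?_⟩
    · rw [hϱ, hcls, χ2, Units.val_one]
    · rw [hg, map_one, h1]
      group
    · rw [hcls]
      exact ψcls_1A hz hzτ
  by_cases ho2 : orderOf g = 2
  · have hg2 : g ^ 2 = 1 := orderOf_dvd_iff_pow_eq_one.1 ho2.dvd
    obtain rfl : g = -1 := (sl_sq_eq_one g hg2).resolve_left fun h => ho1 (orderOf_eq_one_iff.2 h)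
    refine ⟨fun _ => 1, fun _ => -1, 1, eq_diagGL_of_trace ?_, ?_, by simp, fun τ z hz hzτ => ?_⟩
    · rw [hϱ, cls_neg_one, χ2, Units.val_one]
    · rw [rep_two_neg_one hϱ', diagGL_neg_one]
      group
    · rw [cls_neg_one]
      exact ψcls_2A hz hzτ
  by_cases ho4 : orderOf g = 4
  · have hcls : cls t g = .c4A := by simp [cls, ho4]
    have hg4 : (g ^ 2) ^ 2 = 1 := by
      rw [← pow_mul]
      exact orderOf_dvd_iff_pow_eq_one.1 ho4.dvd
    -- As −1 is the only involution, A² = −1; with trace 0 this gives det A = 1 and the eigenvalues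
    -- ±i.
    have hg2 : g ^ 2 = -1 := (sl_sq_eq_one _ hg4).resolve_left fun h => by
      have := Nat.le_of_dvd two_pos (orderOf_dvd_of_pow_eq_one h)
      omega
    have ht : (ϱ' g : Matrix (Fin 2) (Fin 2) ℂ).trace = 0 := by rw [hϱ', hcls, χ6]
    have h3 := trace_sq (ϱ' g : Matrix (Fin 2) (Fin 2) ℂ)
    rw [← Units.val_pow_eq_pow_val, ← map_pow, hg2, rep_two_neg_one hϱ', ht, Units.val_neg,
      Units.val_one, Matrix.trace_neg, Matrix.trace_one, Fintype.card_fin, Nat.cast_ofNat] at h3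
    let i : ℂˣ := Units.mk0 Complex.I Complex.I_ne_zero
    have hi : i ≠ -i := fun h => by
      have h4 : Complex.I = -Complex.I := congrArg Units.val h
      exact Complex.I_ne_zero (self_eq_neg.1 h4)
    obtain ⟨h, hh⟩ := exists_diagonalization (A := ϱ' g) (d := ![i, -i]) hi
      (by simpa using ht) (by
        change _ = Complex.I * -Complex.I
        linear_combination (1 / 2) * h3 + Complex.I_sq)
    refine ⟨fun _ => 1, ![i, -i], h, eq_diagGL_of_trace ?_, hh, ?_, fun τ z hz hzτ => ?_⟩
    · rw [hϱ, hcls, χ2, Units.val_one]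
    · intro j
      fin_cases j <;> simp [i]
    · rw [hcls]
      exact ψcls_4A hz hzτ
  by_cases ho3 : orderOf g = 3
  · obtain ⟨c, h, hc, hc', hh⟩ := exists_diag_of_order_three hϱ hϱ' ho3
    obtain ⟨hc, hn⟩ := hu hc
    refine ⟨fun _ => c, ![1, c], h, hc', hh, ?_, fun τ z hz hzτ => ?_⟩
    · intro j
      fin_cases j
      exacts [by simp, hn]
    · refine Eq.trans ?_ (ψcls_b3Unit hc hz hzτ)
      have hcls : cls t g = if IsConj t g then .c3A else .c3B := by simp [cls, ho3]
      rw [hcls]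
      split_ifs <;> rfl
  -- Only order 6 is left, where −g has order 3. Since ϱ(−1) = 1 and ϱ'(−1) = −1, passing from −g to
  -- g changes only the signs of the eigenvalues on 𝔟⁺.
  have hg3 : (-g) ^ 3 = 1 := by
    rcases sl_pow_eq_one g with h | h | h
    · exfalso
      have h1 := orderOf_dvd_of_pow_eq_one h
      have h2 := Nat.le_of_dvd (by norm_num) h1
      interval_cases h4 : orderOf g <;> simp_all
    · exact h
    · exact absurd (orderOf_eq_prime h fun h => ho1 (orderOf_eq_one_iff.2 h)) ho3
  have hg : orderOf (-g) = 3 := orderOf_eq_prime hg3 fun h => ho2 (by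
    rw [neg_eq_iff_eq_neg.1 h, orderOf_neg_one])
  obtain ⟨c, h, hc, hc', hh⟩ := exists_diag_of_order_three hϱ hϱ' hg
  obtain ⟨hc, hn⟩ := hu hc
  refine ⟨fun _ => c, ![-1, -c], h, ?_, ?_, ?_, fun τ z hz hzτ => ?_⟩
  · rw [← hc', ← neg_one_mul, map_mul, rep_one_neg_one hϱ, one_mul]
  · have hneg : diagGL ![-1, -c] = -diagGL ![1, c] := by
      ext i j
      fin_cases i <;> fin_cases j <;> simp [diagGL]
    rw [hneg, mul_neg, neg_mul, ← hh, rep_two_neg hϱ', neg_neg]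
  · intro j
    fin_cases j
    exacts [by simp, by simpa using hn]
  · refine Eq.trans ?_ (ψcls_neg_b3Unit hc hz hzτ)
    have hcls : cls t g = if IsConj t (-g) then .c6B else .c6A := by
      simp [cls, ho1, ho2, ho3, ho4]
    rw [hcls]
    split_ifs <;> rfl

-- A linear form that does not vanish on v, applied to the left factor, recovers x up to a non-zero
-- scalar.
omit hϱ hϱ' in
theorem tmul_left_cancel {V V' : Type*} [AddCommGroup V] [Module ℂ V] [AddCommGroup V']
    [Module ℂ V'] {v : V} (hv : v ≠ 0) {x y : V'} (h : v ⊗ₜ[ℂ] x = v ⊗ₜ[ℂ] y) : x = y := by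
  obtain ⟨f, hf⟩ : ∃ f : Module.Dual ℂ V, f v ≠ 0 := by
    by_contra! h
    exact hv ((Module.forall_dual_apply_eq_zero_iff ℂ v).1 h)
  have h1 := congrArg (TensorProduct.lid ℂ V' ∘ TensorProduct.map f LinearMap.id) h
  simp only [Function.comp_apply, TensorProduct.map_tmul, TensorProduct.lid_tmul,
    LinearMap.id_apply] at h1
  exact smul_right_injective V' hf h1

-- The modes with number −1 of 𝔟, applied to the vacuum, span a copy of 𝔟 on which g acts through
-- ϱ'(g); its part 𝔟⁺ recovers the matrix, and ϱ' is injective.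
omit hϱ in
theorem actW_injective (ε : Sector) : Function.Injective (actW ε ϱ ϱ') := by
  refine (injective_iff_map_eq_one (actW ε ϱ ϱ')).2 fun g hg => rep_two_eq_one hϱ' ?_
  have hv : vac .fermi ε 1 ⊗ₜ[ℂ] vac .fermi ε 1 ≠ 0 := fun h => by
    rw [← TensorProduct.tmul_zero _ (vac .fermi ε 1)] at h
    exact vac_ne_zero _ _ _ (tmul_left_cancel (vac_ne_zero _ _ _) h)
  have hp : ∀ x, polAct (ϱ' g) x = x := fun x => by
    refine mode_neg_one_vac_injective (s := .bose) (ε := ε) ?_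
    have h := LinearMap.congr_fun hg
      ((vac .fermi ε 1 ⊗ₜ vac .fermi ε 1) ⊗ₜ mode .bose ε (-1) x (vac .bose ε 2))
    rw [actW_apply, tri_tmul, fockAct_vac, fockAct_mode, fockAct_vac] at h
    exact tmul_left_cancel hv h
  ext i j
  have h := hp (plus j)
  rw [polAct_plus] at h
  have h2 := congrFun (congrArg Prod.fst h) i
  fin_cases i <;> fin_cases j <;>
    simpa [plus, Prod.fst_sum, Pi.single_apply, Matrix.one_apply] using h2

end Characters

end UmbralSeven
end

theorem theorem1
    -- the class called `3A`
    (t : G) (ht : orderOf t = 3)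
    -- homomorphisms with characters `χ_2` and `χ_6`
    (ϱ : G →* GL (Fin 1) ℂ) (ϱ' : G →* GL (Fin 2) ℂ)
    (hϱ : ∀ g, (ϱ g : Matrix (Fin 1) (Fin 1) ℂ).trace = χ2 (cls t g))
    (hϱ' : ∀ g, (ϱ' g : Matrix (Fin 2) (Fin 2) ℂ).trace = χ6 (cls t g)) :
    -- the operators are the zero modes of `Y_tw(j_𝔢, z)`, `Y_tw(j, z)` and `Y_tw(ω, z)`
    (∀ (Y : SuperVertexAlgebra (W .ns) (parityW .ns) (vacW .ns))
      (M : TwistedModule Y (canonW .ns) (W .tw)), IsFreeField Y → IsFreeFieldTwisted M →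
        M.act 0 jE = JE ∧ M.act 0 jW = JW ∧ M.act 2 ωW = LW) ∧
    -- the bigrading of `W_tw`
    DirectSum.IsInternal bigraded ∧
    (∀ p, FiniteDimensional ℂ (bigraded p)) ∧
    -- the group acts faithfully and preserves the bigrading
    Function.Injective (actW .ns ϱ ϱ') ∧
    Function.Injective (actW .tw ϱ ϱ') ∧
    (∀ g p, ∀ w ∈ bigraded p, actW .tw ϱ ϱ' g w ∈ bigraded p) ∧
    ∀ g : G,
      (∀ p, ∀ w ∈ bigraded p, twining ϱ ϱ' g w ∈ bigraded p) ∧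
      -- the series belongs to `ℂ[y][[y⁻¹]][[q]]`
      (∀ n : ℕ, ∃ N : ℤ, ∀ m : ℤ, N < m → ψtilde ϱ ϱ' g (m, n) = 0) ∧
      -- and it converges absolutely to the meromorphic Jacobi form in the domain
      ∀ τ z : ℂ, 0 < -z.im → -z.im < τ.im →
        HasSum (fun p : ℤ × ℕ => ψtilde ϱ ϱ' g p * (e z ^ p.1 * e τ ^ p.2))
          (ψcls (cls t g) τ z) := by
  refine ⟨fun Y M hY hM => ⟨act_jE hY hM, act_jW hY hM, act_ωW hY hM⟩, bigraded_isInternal,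
    bigraded_finiteDimensional, actW_injective hϱ' .ns, actW_injective hϱ' .tw,
    actW_mem_bigraded ϱ ϱ', fun g => ?_⟩
  obtain ⟨c, d, h, hc, hd, hd1, hψ⟩ := exists_diag_ψcls hϱ hϱ' g
  -- The bound 1 + 4n on the powers of y is `WIx.J_le`.
  refine ⟨twining_mem_bigraded hc hd, fun n => ⟨1 + 4 * n, fun m => ψtilde_eq_zero hc hd n m⟩,
    fun τ z hz hzτ => ?_⟩
  rw [hψ τ z hz hzτ]
  exact hasSum_ψtilde hc hd hd1 (norm_e_lt_one (hz.trans hzτ)) (one_lt_norm_e hz)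
    (norm_e_mul_lt_one hzτ)
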